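/- **Theorem 4.3 (Staude).** Let $a_1>a_2>u^2_0>a_3>u^3_0$ be real numbers. For $u\ne a_1,a_2,a_3$ let $\mathcal Q_u=\{x\in\mathbb R^3: \sum_j (x^j)^2/(a_j-u)=1\}$ be the quadrics of the confocal family; the outside of $\mathcal Q_u$ is $\{\sum_j (x^j)^2/(a_j-u)>1\}$. Thus $\mathcal Q_{u^3_0}$ is an ellipsoid and $\mathcal Q_{u^2_0}$ is a hyperboloid with one sheet, whose part not inside the ellipsoid consists of two visible parts, one with $x^3>0$ and one with $x^3<0$. Each point $P$ outside the ellipsoid lies on exactly one confocal ellipsoid $\mathcal Q_{u^3_1}$, $u^3_1<u^3_0$; $u^3_1$ is the third elliptic coordinate of $P$. Consider a closed thread of length $\ell$ through a point $P$ outside both quadrics, with the following properties. It stays in the closed region outside both quadrics, goes exactly once (in either direction) around the $x^3$-axis, and touches each of the two visible parts of the hyperboloid once (the set of times of contact with each part is a point or an interval). It is stretched: parametrized by arc length as $\gamma:[0,\ell]\to\mathbb R^3$ with $\gamma(0)=\gamma(\ell)=P$, it has a continuous unit tangent $v=\gamma'$ on $[0,\ell]$ (one-sided at the ends), and away from $P$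 it is in frictionless equilibrium under constant tension, that is $$v(t)=v(0)-\int_0^t (p\,N_{u^2_0}+q\,N_{u^3_0})(\gamma(r))\,dr,$$ where $N_u(x)=(x^j/(a_j-u))_j$ is the outward normal of $\mathcal Q_u$ and $p,q\ge 0$ are integrable functions of $r$ that vanish where the thread does not touch $\mathcal Q_{u^2_0}$, respectively $\mathcal Q_{u^3_0}$. Then: 1. Every tangent line of the thread is tangent to both $\mathcal Q_{u^2_0}$ and $\mathcal Q_{u^3_0}$ (in the projective sense: the defining quadratic polynomial of the quadric, restricted to the line, has discriminant zero). The thread touches the ellipsoid exactly during one time interval $[s,t]$, $0<s\le t<\ell$. 2. The thread begins and ends at $P$ with rectilinear segments. Between them it consists, in this order, of: a geodesic segment on $\mathcal Q_{u^2_0}$, a rectilinear segment, a geodesic segment on $\mathcal Q_{u^3_0}$, a segment of a line of curvature $\mathcal Q_{u^2_0}\cap\mathcal Q_{u^3_0}$, a geodesic segment on $\mathcal Q_{u^3_0}$, a segment of a line of curvature $\mathcal Q_{u^2_0}\cap\mathcal Q_{u^3_0}$, a geodesic segment on $\mathcal Q_{u^3_0}$, a rectilinear segment, a geodesic segment on $\mathcal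 Q_{u^2_0}$, any of which may be absent. If no arc of the thread runs on the hyperboloid off the ellipsoid (the thread may still touch the hyperboloid at a single point of a rectilinear segment), then it consists of a rectilinear segment, followed by a geodesic segment on $\mathcal Q_{u^3_0}$, a line of curvature segment, a geodesic segment on $\mathcal Q_{u^3_0}$, a line of curvature segment, a geodesic segment on $\mathcal Q_{u^3_0}$ (any of these five may be absent), followed by a rectilinear segment. 3. With $\Delta(u)=(u-u^2_0)(u-u^3_0)(a_1-u)(a_2-u)(a_3-u)$, the length of the thread is $$\ell=2\int_{a_2}^{a_1}\frac{(u-u^2_0)(u-u^3_0)}{\sqrt{\Delta(u)}}\,du-2\int_{a_3}^{u^2_0}\frac{(u-u^2_0)(u-u^3_0)}{\sqrt{\Delta(u)}}\,du+\int_{u^3_1}^{u^3_0}\frac{(u-u^2_0)(u-u^3_0)}{\sqrt{\Delta(u)}}\,du,$$ where $u^3_1<u^3_0$ is the third elliptic coordinate of $P$, and these integrals converge absolutely; so $\ell$ depends only on $u^3_1$. 4. Consequently, if the length $\ell$ of the thread is kept, $P$ moves on a confocal ellipsoid: for every $\ell$ there is $u^3_1<u^3_0$ such that the vertex $P$ of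 every such thread of length $\ell$ lies on $\mathcal Q_{u^3_1}$. -/

import Mathlib

open Set

/-- Euclidean three-space. -/
abbrev E3 := EuclideanSpace ℝ (Fin 3)

/-- The symmetric bilinear form `∑ xⱼ yⱼ / (aⱼ - u)` of the member `u` of the confocal family. -/
noncomputable def confocalForm (a : Fin 3 → ℝ) (u : ℝ) (x y : E3) : ℝ :=
  ∑ j, x j * y j / (a j - u)

/-- The quadric `∑ xⱼ² / (aⱼ - u) = 1` of the confocal family. For `a₁ > a₂ > a₃` it is an ellipsoid
if `u < a₃`, a hyperboloid of one sheet if `a₃ < u < a₂`. -/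
def confocalQuadric (a : Fin 3 → ℝ) (u : ℝ) : Set E3 :=
  {x | confocalForm a u x x = 1}

/-- Half the gradient of `∑ xⱼ² / (aⱼ - u)`: a normal vector of the quadric `u` at its points,
directed towards the outside `{x | 1 < ∑ xⱼ² / (aⱼ - u)}`. -/
noncomputable def confocalNormal (a : Fin 3 → ℝ) (u : ℝ) (x : E3) : E3 :=
  WithLp.toLp 2 fun j => x j / (a j - u)

/-- The line `{x + r v}` is tangent to the quadric `u`: the polynomial
`r ↦ ∑ (xⱼ + r vⱼ)² / (aⱼ - u) - 1` has vanishing discriminant (so that it has a double root;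
as usual in projective geometry, the point of contact may lie at infinity). -/
def IsTangentLine (a : Fin 3 → ℝ) (u : ℝ) (x v : E3) : Prop :=
  confocalForm a u x v ^ 2 = confocalForm a u v v * (confocalForm a u x x - 1)

/-- The curve `γ`, restricted to `[0, ℓ]`, winds exactly once (in either direction) around the
third coordinate axis: a continuous polar angle of `(x¹, x²)` changes by `± 2π`. -/
def WindsOnce (γ : ℝ → E3) (ℓ : ℝ) : Prop :=
  ∃ ρ θ : ℝ → ℝ, ContinuousOn θ (Icc 0 ℓ) ∧
    (∀ t ∈ Icc 0 ℓ, 0 < ρ t ∧ γ t 0 = ρ t * Real.cos (θ t) ∧ γ t 1 = ρ t * Real.sin (θ t)) ∧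
    |θ ℓ - θ 0| = 2 * Real.pi

/-- A closed thread of length `ℓ`, parametrized by arc length on `[0, ℓ]`, that is passed around the
ellipsoid `u₃`, outside the hyperboloid of one sheet `u₂`, and stretched with a pen at `P`, such that
it touches each of the two visible parts of the hyperboloid once. -/
structure IsStretchedThread (a : Fin 3 → ℝ) (u₂ u₃ ℓ : ℝ) (P : E3) (γ : ℝ → E3) : Prop where
  length_pos : 0 < ℓ
  start : γ 0 = P
  finish : γ ℓ = P
  /-- The pen is outside both quadrics. -/
  vertex_outside : 1 < confocalForm a u₂ P P ∧ 1 < confocalForm a u₃ P P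
  /-- The thread does not enter either of the two solid quadrics. -/
  outside : ∀ t ∈ Icc 0 ℓ, 1 ≤ confocalForm a u₂ (γ t) (γ t) ∧ 1 ≤ confocalForm a u₃ (γ t) (γ t)
  /-- The thread goes once around. (The allowed region does not meet the third axis.) -/
  around : WindsOnce γ ℓ
  /-- The thread is stretched: away from the pen it is in equilibrium, without friction, under a
  constant tension (normalized to `1`). The unit tangent `v` is continuous, and its change is
  balanced by the reaction of the two obstacles, which act only where the thread touches them,
  in the direction of their normals, and can only push the thread outwards. -/
  stretched : ∃ (v : ℝ → E3) (p q : ℝ → ℝ),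
    ContinuousOn v (Icc 0 ℓ) ∧
    (∀ t ∈ Icc 0 ℓ, HasDerivWithinAt γ (v t) (Icc 0 ℓ) t ∧ ‖v t‖ = 1) ∧
    IntervalIntegrable p MeasureTheory.volume 0 ℓ ∧
    IntervalIntegrable q MeasureTheory.volume 0 ℓ ∧
    (∀ t ∈ Icc 0 ℓ, 0 ≤ p t ∧ 0 ≤ q t ∧
      (p t ≠ 0 → γ t ∈ confocalQuadric a u₂) ∧ (q t ≠ 0 → γ t ∈ confocalQuadric a u₃)) ∧
    ∀ t ∈ Icc 0 ℓ, v t = v 0 -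
      ∫ r in (0 : ℝ)..t, (p r • confocalNormal a u₂ (γ r) + q r • confocalNormal a u₃ (γ r))
  /-- The upper part of the hyperboloid is touched once: at a single time or time interval. -/
  touches_upper : IsConnected {t | t ∈ Icc 0 ℓ ∧ γ t ∈ confocalQuadric a u₂ ∧ 0 < γ t 2}
  /-- The lower part of the hyperboloid is touched once: at a single time or time interval. -/
  touches_lower : IsConnected {t | t ∈ Icc 0 ℓ ∧ γ t ∈ confocalQuadric a u₂ ∧ γ t 2 < 0}

/-- On `[s, t]` the curve `γ` is a rectilinear segment. -/
def IsRectilinear (γ : ℝ → E3) (s t : ℝ) : Prop :=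
  ∃ v : E3, ∀ r ∈ Icc s t, γ r = γ s + (r - s) • v

/-- On `[s, t]` the curve `γ` is a geodesic of the quadric `u`: it lies on the quadric and its
acceleration is normal to the quadric. -/
def IsGeodesicOn (a : Fin 3 → ℝ) (u : ℝ) (γ : ℝ → E3) (s t : ℝ) : Prop :=
  ∃ (v : ℝ → E3) (c : ℝ → ℝ), ∀ r ∈ Icc s t, γ r ∈ confocalQuadric a u ∧
    HasDerivWithinAt γ (v r) (Icc s t) r ∧
    HasDerivWithinAt v (c r • confocalNormal a u (γ r)) (Icc s t) r

/-- On `[s, t]` the curve `γ` runs along the intersection of the two confocal quadrics, which is a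
line of curvature on both of them. -/
def IsLineOfCurvature (a : Fin 3 → ℝ) (u₂ u₃ : ℝ) (γ : ℝ → E3) (s t : ℝ) : Prop :=
  ∀ r ∈ Icc s t, γ r ∈ confocalQuadric a u₂ ∧ γ r ∈ confocalQuadric a u₃

/-- The kinds of arcs of which a thread consists. -/
inductive ArcKind
  | rectilinear
  | ellipsoidGeodesic
  | hyperboloidGeodesic
  | lineOfCurvature

/-- On `[s, t]` the curve `γ` is an arc of the given kind. -/
def IsArc (a : Fin 3 → ℝ) (u₂ u₃ : ℝ) (γ : ℝ → E3) : ArcKind → ℝ → ℝ → Prop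
  | .rectilinear, s, t => IsRectilinear γ s t
  | .ellipsoidGeodesic, s, t => IsGeodesicOn a u₃ γ s t
  | .hyperboloidGeodesic, s, t => IsGeodesicOn a u₂ γ s t
  | .lineOfCurvature, s, t => IsLineOfCurvature a u₂ u₃ γ s t

/-- On `[s, t]` the curve `γ` is composed of consecutive arcs of positive length of the given
kinds, in the given order. -/
def ConsistsOf (a : Fin 3 → ℝ) (u₂ u₃ : ℝ) (γ : ℝ → E3) : List ArcKind → ℝ → ℝ → Prop
  | [], s, t => s = t
  | k :: ks, s, t => ∃ r, s < r ∧ IsArc a u₂ u₃ γ k s r ∧ ConsistsOf a u₂ u₃ γ ks r t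

/-- The hyperelliptic integrand `(u - u₂)(u - u₃) / √Δ(u)`, where
`Δ(u) = (u - u₂)(u - u₃)(a₁ - u)(a₂ - u)(a₃ - u)`. -/
noncomputable def lengthIntegrand (a : Fin 3 → ℝ) (u₂ u₃ u : ℝ) : ℝ :=
  (u - u₂) * (u - u₃) / Real.sqrt ((u - u₂) * (u - u₃) * ∏ j, (a j - u))

/-- The length of the thread as a function of the third elliptic coordinate `w` of the pen. -/
noncomputable def threadLength (a : Fin 3 → ℝ) (u₂ u₃ w : ℝ) : ℝ :=
  2 * (∫ u in (a 1)..(a 0), lengthIntegrand a u₂ u₃ u)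
    - 2 * (∫ u in (a 2)..u₂, lengthIntegrand a u₂ u₃ u)
    + ∫ u in w..u₃, lengthIntegrand a u₂ u₃ u

/-!
Jacobi's elliptic coordinates separate the problem. For a unit speed curve `γ` with velocity `v`, the
discriminant of the tangent with respect to the confocal quadric `u`, multiplied by `∏ (aⱼ - u)`, is a
monic quadratic polynomial `tangencyPoly` in `u`. Where the thread is pressed against one of the
quadrics, the thread is tangent to it, and the acceleration is normal to it; by Joachimsthal and
Chasles (`tangencyPoly_normal_variation`) the polynomial then does not change. So it is constant along
the thread (`IsEquilibrium.tangencyPoly_eq`), and it vanishes at `u₂` and at `u₃` as soon as the thread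
touches both quadrics. It touches the hyperboloid by hypothesis. It also touches the ellipsoid, namely
between its contacts with the two parts of the hyperboloid: otherwise it would be straight there, and a
line that touches a quadric twice is contained in it (`IsEquilibrium.exists_contact_between`). Hence
the polynomial is `(u - u₂) (u - u₃)`, that is, all tangents touch both quadrics.

Outside of both quadrics the elliptic coordinates `U ∈ [a₁, a₀]`, `V ∈ [a₂, u₂]`, `W ≤ u₃` of a point
(with the indices `0, 1, 2` of the formalization) are simple roots of a cubic and therefore
differentiable, and the identity above becomes Jacobi's equation `u̇² = 4 Δ(u) / ∏ (u - uᵏ)²` for each of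
them. In particular `Ẇ` vanishes only on the ellipsoid, and by Rolle's theorem the contact with the
ellipsoid is a single interval `[s, t]`. It meets the gap between the contacts `[A, B]` and `[C, D]`
with the hyperboloid, and the order of the numbers `A`, `B`, `C`, `D`, `s`, `t` yields the sequence of
arcs.

For the length, `1` is the sum of the shares `(uⁱ - u₂) (uⁱ - u₃) / ∏ (uⁱ - uᵏ)`, and by Jacobi's
equation each share is half of the absolute value of the integrand of the length formula times `|u̇ⁱ|`.
To integrate through the turning points, phases are used: `U = a₁ + (a₀ - a₁) sin² φ` with an angle `φ`
that has no critical points and winds around once, like the thread; and `V = a₂ + (u₂ - a₂) σ²`, where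
`σ` has the sign of the third coordinate and oscillates between the contacts `σ = 1` and `σ = -1`. The
coordinate `W` rises to `u₃` and falls back. So `U`, `V` and `W` run through their ranges four times,
four times and twice.
-/

section
/-! ### The confocal family in polynomial form -/

/-- The parameters of the two quadrics interlace with the parameters of the family: `u₂` belongs to
a hyperboloid of one sheet and `u₃` to an ellipsoid. -/
structure ConfocalOrder (a : Fin 3 → ℝ) (u₂ u₃ : ℝ) : Prop where
  a1_lt_a0 : a 1 < a 0
  u₂_lt_a1 : u₂ < a 1
  a2_lt_u₂ : a 2 < u₂
  u₃_lt_a2 : u₃ < a 2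

/-- The monic cubic polynomial in `u` obtained from `∑ xⱼ² / (aⱼ - u) - 1` by multiplication with
`∏ (aⱼ - u)`. Its roots are the elliptic coordinates of `x`. -/
noncomputable def confocalCubic (a : Fin 3 → ℝ) (x : E3) (u : ℝ) : ℝ :=
  x 0 ^ 2 * ((a 1 - u) * (a 2 - u)) + x 1 ^ 2 * ((a 0 - u) * (a 2 - u))
    + x 2 ^ 2 * ((a 0 - u) * (a 1 - u)) - (a 0 - u) * (a 1 - u) * (a 2 - u)

/-- The bilinear form `∑ xⱼ vⱼ / (aⱼ - u)` multiplied by `∏ (aⱼ - u)`. -/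
noncomputable def confocalPolar (a : Fin 3 → ℝ) (x v : E3) (u : ℝ) : ℝ :=
  x 0 * v 0 * ((a 1 - u) * (a 2 - u)) + x 1 * v 1 * ((a 0 - u) * (a 2 - u))
    + x 2 * v 2 * ((a 0 - u) * (a 1 - u))

/-- The discriminant of the line `{x + r v}` with respect to the quadric `u`, multiplied by
`∏ (aⱼ - u)`: a quadratic polynomial in `u`, whose roots belong to the confocal quadrics that are
tangent to the line. It depends on the moments `xⱼ vₖ - xₖ vⱼ` of the line only, and has no
denominators. -/
noncomputable def tangencyPoly (a : Fin 3 → ℝ) (x v : E3) (u : ℝ) : ℝ :=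
  v 0 ^ 2 * ((a 1 - u) * (a 2 - u)) + v 1 ^ 2 * ((a 0 - u) * (a 2 - u))
    + v 2 ^ 2 * ((a 0 - u) * (a 1 - u))
    - ((x 0 * v 1 - x 1 * v 0) ^ 2 * (a 2 - u) + (x 0 * v 2 - x 2 * v 0) ^ 2 * (a 1 - u)
      + (x 1 * v 2 - x 2 * v 1) ^ 2 * (a 0 - u))

variable {a : Fin 3 → ℝ} {u₂ u₃ : ℝ}

theorem ConfocalOrder.sub_u₂_ne_zero (ha : ConfocalOrder a u₂ u₃) (j : Fin 3) : a j - u₂ ≠ 0 := by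
  have := ha.1; have := ha.2; have := ha.3; have := ha.4
  fin_cases j <;> simp only [Fin.zero_eta, Fin.mk_one, Fin.reduceFinMk] <;> intro h <;> linarith

theorem ConfocalOrder.sub_u₃_pos (ha : ConfocalOrder a u₂ u₃) (j : Fin 3) : 0 < a j - u₃ := by
  have := ha.1; have := ha.2; have := ha.3; have := ha.4
  fin_cases j <;> simp only [Fin.zero_eta, Fin.mk_one, Fin.reduceFinMk] <;> linarith

theorem ConfocalOrder.sub_u₃_ne_zero (ha : ConfocalOrder a u₂ u₃) (j : Fin 3) : a j - u₃ ≠ 0 :=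
  (ha.sub_u₃_pos j).ne'

theorem confocalPolar_sq_sub (x v : E3) (u : ℝ) :
    confocalPolar a x v u ^ 2 - confocalPolar a v v u * confocalCubic a x u
      = (a 0 - u) * (a 1 - u) * (a 2 - u) * tangencyPoly a x v u := by
  simp only [confocalPolar, confocalCubic, tangencyPoly]; ring

theorem confocalPolar_eq {u : ℝ} (hu : ∀ j, a j - u ≠ 0) (x v : E3) :
    confocalPolar a x v u = confocalForm a u x v * ((a 0 - u) * (a 1 - u) * (a 2 - u)) := by
  have := hu 0; have := hu 1; have := hu 2
  simp only [confocalPolar, confocalForm, Fin.sum_univ_three]; field_simp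

theorem confocalCubic_eq {u : ℝ} (hu : ∀ j, a j - u ≠ 0) (x : E3) :
    confocalCubic a x u = (confocalForm a u x x - 1) * ((a 0 - u) * (a 1 - u) * (a 2 - u)) := by
  have := hu 0; have := hu 1; have := hu 2
  simp only [confocalCubic, confocalForm, Fin.sum_univ_three]; field_simp

theorem isTangentLine_iff {u : ℝ} (hu : ∀ j, a j - u ≠ 0) (x v : E3) :
    IsTangentLine a u x v ↔ tangencyPoly a x v u = 0 := by
  have h := confocalPolar_sq_sub (a := a) x v u
  have hne : (a 0 - u) * (a 1 - u) * (a 2 - u) ≠ 0 := mul_ne_zero (mul_ne_zero (hu 0) (hu 1)) (hu 2)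
  rw [confocalPolar_eq hu, confocalPolar_eq hu, confocalCubic_eq hu] at h
  rw [IsTangentLine]
  constructor
  · intro h'
    rw [mul_pow, h'] at h
    have : (a 0 - u) * (a 1 - u) * (a 2 - u) * tangencyPoly a x v u = 0 := by rw [← h]; ring
    exact (mul_eq_zero.1 this).resolve_left hne
  · intro h'
    rw [h', mul_zero] at h
    refine mul_right_cancel₀ (pow_ne_zero 2 hne) ?_
    linear_combination h

theorem confocalForm_self_pos {u : ℝ} (hu : ∀ j, a j - u ≠ 0) {x : E3}
    (hx : confocalForm a u x x = 1) :
    0 < ∑ j, (x j / (a j - u)) ^ 2 := by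
  refine lt_of_le_of_ne (Finset.sum_nonneg fun j _ => sq_nonneg _) fun h => ?_
  have h0 := (Finset.sum_eq_zero_iff_of_nonneg (fun j _ => sq_nonneg (x j / (a j - u)))).1 h.symm
  have h1 : ∀ j, x j = 0 := fun j => by
    have := pow_eq_zero_iff (two_ne_zero) |>.1 (h0 j (Finset.mem_univ j))
    exact (div_eq_zero_iff.1 this).resolve_right (hu j)
  simp [confocalForm, h1] at hx

/-! ### Equilibrium of a thread -/

/-- The mechanical part of the definition of a stretched thread: `γ` is a unit speed curve outside
both quadrics with velocity `v`, and `p`, `q` are the pressures of the two quadrics. -/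
structure IsEquilibrium (a : Fin 3 → ℝ) (u₂ u₃ ℓ : ℝ) (γ v : ℝ → E3) (p q : ℝ → ℝ) : Prop where
  length_pos : 0 < ℓ
  start_outside : 1 < confocalForm a u₂ (γ 0) (γ 0) ∧ 1 < confocalForm a u₃ (γ 0) (γ 0)
  finish_outside : 1 < confocalForm a u₂ (γ ℓ) (γ ℓ) ∧ 1 < confocalForm a u₃ (γ ℓ) (γ ℓ)
  outside : ∀ t ∈ Icc 0 ℓ, 1 ≤ confocalForm a u₂ (γ t) (γ t) ∧ 1 ≤ confocalForm a u₃ (γ t) (γ t)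
  continuousOn_vel : ContinuousOn v (Icc 0 ℓ)
  hasDeriv : ∀ t ∈ Icc 0 ℓ, HasDerivWithinAt γ (v t) (Icc 0 ℓ) t
  norm_vel : ∀ t ∈ Icc 0 ℓ, ‖v t‖ = 1
  integrable_left : IntervalIntegrable p MeasureTheory.volume 0 ℓ
  integrable_right : IntervalIntegrable q MeasureTheory.volume 0 ℓ
  contact_left : ∀ t ∈ Icc 0 ℓ, p t ≠ 0 → γ t ∈ confocalQuadric a u₂
  contact_right : ∀ t ∈ Icc 0 ℓ, q t ≠ 0 → γ t ∈ confocalQuadric a u₃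
  vel_eq : ∀ t ∈ Icc 0 ℓ, v t = v 0 -
      ∫ r in (0 : ℝ)..t, (p r • confocalNormal a u₂ (γ r) + q r • confocalNormal a u₃ (γ r))

theorem IsStretchedThread.exists_isEquilibrium {ℓ : ℝ} {P : E3} {γ : ℝ → E3}
    (h : IsStretchedThread a u₂ u₃ ℓ P γ) : ∃ v p q, IsEquilibrium a u₂ u₃ ℓ γ v p q := by
  obtain ⟨v, p, q, h1, h2, h3, h4, h5, h6⟩ := h.stretched
  exact ⟨v, p, q, h.length_pos, h.start ▸ h.vertex_outside, by rw [h.finish]; exact h.vertex_outside,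
    h.outside, h1, fun t ht => (h2 t ht).1, fun t ht => (h2 t ht).2, h3, h4,
    fun t ht => (h5 t ht).2.2.1, fun t ht => (h5 t ht).2.2.2, h6⟩

namespace IsEquilibrium

variable {ℓ : ℝ} {γ v : ℝ → E3} {p q : ℝ → ℝ}

theorem continuousOn (h : IsEquilibrium a u₂ u₃ ℓ γ v p q) : ContinuousOn γ (Icc 0 ℓ) :=
  fun t ht => (h.hasDeriv t ht).continuousWithinAt

theorem continuousOn_coord (h : IsEquilibrium a u₂ u₃ ℓ γ v p q) (j : Fin 3) :
    ContinuousOn (fun t => γ t j) (Icc 0 ℓ) :=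
  (EuclideanSpace.proj (𝕜 := ℝ) j).continuous.comp_continuousOn h.continuousOn

theorem continuousOn_vel_coord (h : IsEquilibrium a u₂ u₃ ℓ γ v p q) (j : Fin 3) :
    ContinuousOn (fun t => v t j) (Icc 0 ℓ) :=
  (EuclideanSpace.proj (𝕜 := ℝ) j).continuous.comp_continuousOn h.continuousOn_vel

theorem hasDerivWithinAt_coord (h : IsEquilibrium a u₂ u₃ ℓ γ v p q) {t : ℝ} (ht : t ∈ Icc 0 ℓ)
    (j : Fin 3) : HasDerivWithinAt (fun t => γ t j) (v t j) (Icc 0 ℓ) t :=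
  (EuclideanSpace.proj (𝕜 := ℝ) j).hasFDerivAt.comp_hasDerivWithinAt t (h.hasDeriv t ht)

theorem hasDerivAt_coord (h : IsEquilibrium a u₂ u₃ ℓ γ v p q) {t : ℝ} (ht : t ∈ Ioo 0 ℓ)
    (j : Fin 3) : HasDerivAt (fun t => γ t j) (v t j) t :=
  (h.hasDerivWithinAt_coord (Ioo_subset_Icc_self ht) j).hasDerivAt (Icc_mem_nhds ht.1 ht.2)

theorem sum_sq_vel (h : IsEquilibrium a u₂ u₃ ℓ γ v p q) {t : ℝ} (ht : t ∈ Icc 0 ℓ) :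
    v t 0 ^ 2 + v t 1 ^ 2 + v t 2 ^ 2 = 1 := by
  have := EuclideanSpace.norm_sq_eq (v t)
  rw [h.norm_vel t ht, Fin.sum_univ_three] at this
  simp only [Real.norm_eq_abs, sq_abs] at this
  linarith

theorem hasDerivAt_form (h : IsEquilibrium a u₂ u₃ ℓ γ v p q) (u : ℝ) {t : ℝ} (ht : t ∈ Ioo 0 ℓ) :
    HasDerivAt (fun t => confocalForm a u (γ t) (γ t)) (2 * confocalForm a u (γ t) (v t)) t := by
  simp only [confocalForm]
  have : HasDerivAt (fun t => ∑ j, γ t j * γ t j / (a j - u))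
      (∑ j, (v t j * γ t j + γ t j * v t j) / (a j - u)) t :=
    HasDerivAt.fun_sum fun j _ =>
      ((h.hasDerivAt_coord ht j).mul (h.hasDerivAt_coord ht j)).div_const _
  convert! this using 1
  rw [Finset.mul_sum]
  exact Finset.sum_congr rfl fun j _ => by ring

theorem mem_Ioo_of_contact_left (h : IsEquilibrium a u₂ u₃ ℓ γ v p q) {t : ℝ} (ht : t ∈ Icc 0 ℓ)
    (hc : γ t ∈ confocalQuadric a u₂) : t ∈ Ioo 0 ℓ := by
  have hc : confocalForm a u₂ (γ t) (γ t) = 1 := hc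
  refine ⟨lt_of_le_of_ne ht.1 ?_, lt_of_le_of_ne ht.2 ?_⟩
  · rintro rfl; exact h.start_outside.1.ne' hc
  · rintro rfl; exact h.finish_outside.1.ne' hc

theorem mem_Ioo_of_contact_right (h : IsEquilibrium a u₂ u₃ ℓ γ v p q) {t : ℝ} (ht : t ∈ Icc 0 ℓ)
    (hc : γ t ∈ confocalQuadric a u₃) : t ∈ Ioo 0 ℓ := by
  have hc : confocalForm a u₃ (γ t) (γ t) = 1 := hc
  refine ⟨lt_of_le_of_ne ht.1 ?_, lt_of_le_of_ne ht.2 ?_⟩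
  · rintro rfl; exact h.start_outside.2.ne' hc
  · rintro rfl; exact h.finish_outside.2.ne' hc

/-- A point of contact is a minimum of the defining function, so that the velocity is tangent to
the quadric there. -/
theorem form_eq_zero_left (h : IsEquilibrium a u₂ u₃ ℓ γ v p q) {t : ℝ} (ht : t ∈ Icc 0 ℓ)
    (hc : γ t ∈ confocalQuadric a u₂) : confocalForm a u₂ (γ t) (v t) = 0 := by
  have hI := h.mem_Ioo_of_contact_left ht hc
  have hmin : IsLocalMin (fun t => confocalForm a u₂ (γ t) (γ t)) t := by
    filter_upwards [Icc_mem_nhds hI.1 hI.2] with r hr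
    have hc : confocalForm a u₂ (γ t) (γ t) = 1 := hc
    rw [hc]; exact (h.outside r hr).1
  linarith [hmin.hasDerivAt_eq_zero (h.hasDerivAt_form u₂ hI)]

theorem form_eq_zero_right (h : IsEquilibrium a u₂ u₃ ℓ γ v p q) {t : ℝ} (ht : t ∈ Icc 0 ℓ)
    (hc : γ t ∈ confocalQuadric a u₃) : confocalForm a u₃ (γ t) (v t) = 0 := by
  have hI := h.mem_Ioo_of_contact_right ht hc
  have hmin : IsLocalMin (fun t => confocalForm a u₃ (γ t) (γ t)) t := by
    filter_upwards [Icc_mem_nhds hI.1 hI.2] with r hr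
    have hc : confocalForm a u₃ (γ t) (γ t) = 1 := hc
    rw [hc]; exact (h.outside r hr).2
  linarith [hmin.hasDerivAt_eq_zero (h.hasDerivAt_form u₃ hI)]

theorem continuousOn_normal (h : IsEquilibrium a u₂ u₃ ℓ γ v p q) (u : ℝ) :
    ContinuousOn (fun t => confocalNormal a u (γ t)) (Icc 0 ℓ) := by
  unfold confocalNormal
  refine (PiLp.continuous_toLp 2 _).comp_continuousOn (continuousOn_pi.2 fun j => ?_)
  exact (h.continuousOn_coord j).div_const _

theorem integrable_force_left (h : IsEquilibrium a u₂ u₃ ℓ γ v p q) {s t : ℝ} (hs : s ∈ Icc 0 ℓ)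
    (ht : t ∈ Icc 0 ℓ) :
    IntervalIntegrable (fun r => p r • confocalNormal a u₂ (γ r)) MeasureTheory.volume s t := by
  have : IntervalIntegrable (fun r => p r • confocalNormal a u₂ (γ r)) MeasureTheory.volume 0 ℓ :=
    h.integrable_left.smul_continuousOn
      (by rw [uIcc_of_le h.length_pos.le]; exact h.continuousOn_normal u₂)
  refine this.mono_set ?_
  rw [uIcc_of_le h.length_pos.le]
  exact uIcc_subset_Icc hs ht

theorem integrable_force_right (h : IsEquilibrium a u₂ u₃ ℓ γ v p q) {s t : ℝ} (hs : s ∈ Icc 0 ℓ)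
    (ht : t ∈ Icc 0 ℓ) :
    IntervalIntegrable (fun r => q r • confocalNormal a u₃ (γ r)) MeasureTheory.volume s t := by
  have : IntervalIntegrable (fun r => q r • confocalNormal a u₃ (γ r)) MeasureTheory.volume 0 ℓ :=
    h.integrable_right.smul_continuousOn
      (by rw [uIcc_of_le h.length_pos.le]; exact h.continuousOn_normal u₃)
  refine this.mono_set ?_
  rw [uIcc_of_le h.length_pos.le]
  exact uIcc_subset_Icc hs ht

theorem vel_sub (h : IsEquilibrium a u₂ u₃ ℓ γ v p q) {s t : ℝ} (hs : s ∈ Icc 0 ℓ)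
    (ht : t ∈ Icc 0 ℓ) : v t = v s -
      ∫ r in s..t, (p r • confocalNormal a u₂ (γ r) + q r • confocalNormal a u₃ (γ r)) := by
  have h0 : (0 : ℝ) ∈ Icc 0 ℓ := ⟨le_rfl, h.length_pos.le⟩
  rw [h.vel_eq t ht, h.vel_eq s hs, ← intervalIntegral.integral_add_adjacent_intervals
    ((h.integrable_force_left h0 hs).add (h.integrable_force_right h0 hs))
    ((h.integrable_force_left hs ht).add (h.integrable_force_right hs ht))]
  abel

end IsEquilibrium

/-- The gradient of the tangency polynomial with respect to the velocity vanishes along the normal of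
a confocal quadric at a point of contact. This is the reason why the tangents of a geodesic on one
quadric remain tangent to a second confocal quadric (Chasles). -/
theorem tangencyPoly_normal_variation {w : ℝ} (hw : ∀ j, a j - w ≠ 0) {x v : E3}
    (h1 : confocalForm a w x x = 1) (h0 : confocalForm a w x v = 0) (u : ℝ) :
    v 0 * confocalNormal a w x 0 * ((a 1 - u) * (a 2 - u))
    + v 1 * confocalNormal a w x 1 * ((a 0 - u) * (a 2 - u))
    + v 2 * confocalNormal a w x 2 * ((a 0 - u) * (a 1 - u))
    - ((x 0 * v 1 - x 1 * v 0) *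
        (x 0 * confocalNormal a w x 1 - x 1 * confocalNormal a w x 0) * (a 2 - u)
      + (x 0 * v 2 - x 2 * v 0) *
        (x 0 * confocalNormal a w x 2 - x 2 * confocalNormal a w x 0) * (a 1 - u)
      + (x 1 * v 2 - x 2 * v 1) *
        (x 1 * confocalNormal a w x 2 - x 2 * confocalNormal a w x 1) * (a 0 - u)) = 0 := by
  simp only [confocalForm, Fin.sum_univ_three] at h1 h0
  simp only [confocalNormal]
  obtain ⟨n, hn⟩ : ∃ n : Fin 3 → ℝ, ∀ j, x j = n j * (a j - w) :=
    ⟨fun j => x j / (a j - w), fun j => (div_mul_cancel₀ _ (hw j)).symm⟩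
  have hq : ∀ j, x j / (a j - w) = n j := fun j => by rw [hn j, mul_div_cancel_right₀ _ (hw j)]
  have e1 : ∀ j, x j * x j / (a j - w) = n j * x j := fun j => by rw [mul_div_right_comm, hq]
  have e0 : ∀ j, x j * v j / (a j - w) = n j * v j := fun j => by rw [mul_div_right_comm, hq]
  simp only [e1, e0] at h1 h0
  simp only [hq]
  simp only [hn] at h1 ⊢
  linear_combination
    (n 0 * (n 0 * (a 0 - w)) * ((a 1 - u) * (a 2 - u)) + n 1 * (n 1 * (a 1 - w)) *
      ((a 0 - u) * (a 2 - u)) + n 2 * (n 2 * (a 2 - w)) * ((a 0 - u) * (a 1 - u))) * h0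
    - (n 0 * v 0 * ((a 1 - u) * (a 2 - u)) + n 1 * v 1 * ((a 0 - u) * (a 2 - u))
      + n 2 * v 2 * ((a 0 - u) * (a 1 - u))) * h1
end

section
variable {a : Fin 3 → ℝ} {u₂ u₃ : ℝ}

namespace IsEquilibrium

variable {ℓ : ℝ} {γ v : ℝ → E3} {p q : ℝ → ℝ}

theorem absolutelyContinuous_coord (h : IsEquilibrium a u₂ u₃ ℓ γ v p q) (j : Fin 3) :
    AbsolutelyContinuousOnInterval (fun t => γ t j) 0 ℓ := by
  have : LipschitzOnWith 1 (fun t => γ t j) (uIcc 0 ℓ) := by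
    rw [uIcc_of_le h.length_pos.le]
    refine (convex_Icc 0 ℓ).lipschitzOnWith_of_nnnorm_hasDerivWithin_le
      (fun t ht => h.hasDerivWithinAt_coord ht j) fun t ht => ?_
    rw [← NNReal.coe_le_coe, coe_nnnorm, NNReal.coe_one, ← h.norm_vel t ht]
    exact PiLp.norm_apply_le (v t) j
  exact this.absolutelyContinuousOnInterval

theorem vel_coord_eq (h : IsEquilibrium a u₂ u₃ ℓ γ v p q) {t : ℝ} (ht : t ∈ Icc 0 ℓ) (j : Fin 3) :
    v t j = v 0 j - ∫ r in (0 : ℝ)..t,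
      (p r * confocalNormal a u₂ (γ r) j + q r * confocalNormal a u₃ (γ r) j) := by
  have h0 : (0 : ℝ) ∈ Icc 0 ℓ := ⟨le_rfl, h.length_pos.le⟩
  have := ContinuousLinearMap.intervalIntegral_comp_comm (EuclideanSpace.proj j : E3 →L[ℝ] ℝ)
    ((h.integrable_force_left h0 ht).add (h.integrable_force_right h0 ht))
  rw [h.vel_eq t ht, PiLp.sub_apply]
  congr 1
  simpa using this.symm

theorem integrable_force_coord (h : IsEquilibrium a u₂ u₃ ℓ γ v p q) (j : Fin 3) :
    IntervalIntegrable (fun r => p r * confocalNormal a u₂ (γ r) j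
      + q r * confocalNormal a u₃ (γ r) j) MeasureTheory.volume 0 ℓ := by
  have hc : ∀ u, ContinuousOn (fun r => confocalNormal a u (γ r) j) (uIcc 0 ℓ) := fun u => by
    rw [uIcc_of_le h.length_pos.le]
    exact (EuclideanSpace.proj (𝕜 := ℝ) j).continuous.comp_continuousOn (h.continuousOn_normal u)
  exact (h.integrable_left.mul_continuousOn (hc u₂)).add
    (h.integrable_right.mul_continuousOn (hc u₃))

/-- Almost everywhere the acceleration is the negative of the force of reaction. Since the pressures
are only integrable, the velocity need not be differentiable everywhere. -/
theorem ae_hasDerivAt_vel (h : IsEquilibrium a u₂ u₃ ℓ γ v p q) :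
    ∀ᵐ t, t ∈ Ioo 0 ℓ → ∀ j, HasDerivAt (fun t => v t j)
      (-(p t * confocalNormal a u₂ (γ t) j + q t * confocalNormal a u₃ (γ t) j)) t := by
  have := fun j => (h.integrable_force_coord j).ae_hasDerivAt_integral
  filter_upwards [MeasureTheory.ae_all_iff.2 this] with t ht hI j
  rw [uIcc_of_le h.length_pos.le] at ht
  have h1 := (ht j (Ioo_subset_Icc_self hI) 0 ⟨le_rfl, h.length_pos.le⟩).const_sub (v 0 j)
  refine h1.congr_of_eventuallyEq ?_
  filter_upwards [Icc_mem_nhds hI.1 hI.2] with r hr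
  exact h.vel_coord_eq hr j

/-- Joachimsthal's integrals: the quadrics of the family that are tangent to the tangents of the
thread are the same at all times. -/
theorem tangencyPoly_eq (h : IsEquilibrium a u₂ u₃ ℓ γ v p q) (ha : ConfocalOrder a u₂ u₃) (u : ℝ)
    {s t : ℝ} (hs : s ∈ Icc 0 ℓ) (ht : t ∈ Icc 0 ℓ) :
    tangencyPoly a (γ s) (v s) u = tangencyPoly a (γ t) (v t) u := by
  -- `V` extends the velocity beyond `[0, ℓ]`, where `v` is unspecified.
  set V : Fin 3 → ℝ → ℝ := fun j t => v 0 j - ∫ r in (0 : ℝ)..t,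
      (p r * confocalNormal a u₂ (γ r) j + q r * confocalNormal a u₃ (γ r) j) with hV
  have hVe : ∀ t ∈ Icc 0 ℓ, ∀ j, V j t = v t j := fun t ht j => (h.vel_coord_eq ht j).symm
  have acx := h.absolutelyContinuous_coord
  have acV : ∀ j, AbsolutelyContinuousOnInterval (V j) 0 ℓ := fun j => by
    have h1 := (h.integrable_force_coord j).absolutelyContinuousOnInterval_intervalIntegral
      (c := 0) left_mem_uIcc
    have h2 : AbsolutelyContinuousOnInterval (fun _ : ℝ => v 0 j) 0 ℓ :=
      (LipschitzWith.const' (v 0 j)).lipschitzOnWith.absolutelyContinuousOnInterval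
        (K := 0)
    exact h2.sub h1
  set f : ℝ → ℝ := fun t => V 0 t ^ 2 * ((a 1 - u) * (a 2 - u)) + V 1 t ^ 2 * ((a 0 - u) * (a 2 - u))
    + V 2 t ^ 2 * ((a 0 - u) * (a 1 - u))
    - ((γ t 0 * V 1 t - γ t 1 * V 0 t) ^ 2 * (a 2 - u)
      + (γ t 0 * V 2 t - γ t 2 * V 0 t) ^ 2 * (a 1 - u)
      + (γ t 1 * V 2 t - γ t 2 * V 1 t) ^ 2 * (a 0 - u)) with hf
  have hfe : ∀ t ∈ Icc 0 ℓ, f t = tangencyPoly a (γ t) (v t) u := fun t ht => by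
    simp only [hf, hVe t ht, tangencyPoly]
  have acf : AbsolutelyContinuousOnInterval f 0 ℓ := by
    have sq : ∀ (g : ℝ → ℝ) (c : ℝ), AbsolutelyContinuousOnInterval g 0 ℓ →
        AbsolutelyContinuousOnInterval (fun t => g t ^ 2 * c) 0 ℓ := fun g c hg => by
      have := (hg.mul hg).const_mul c
      convert! this using 1
      ext t; simp only [Pi.mul_apply]; ring
    have mom : ∀ j k, AbsolutelyContinuousOnInterval (fun t => γ t j * V k t - γ t k * V j t) 0 ℓ :=
      fun j k => ((acx j).mul (acV k)).sub ((acx k).mul (acV j))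
    exact (((sq _ _ (acV 0)).add (sq _ _ (acV 1))).add (sq _ _ (acV 2))).sub
      (((sq _ _ (mom 0 1)).add (sq _ _ (mom 0 2))).add (sq _ _ (mom 1 2)))
  have hder : ∀ᵐ t, t ∈ uIcc 0 ℓ → HasDerivAt f 0 t := by
    rw [uIcc_of_le h.length_pos.le]
    have hne0 : ∀ᵐ t : ℝ, t ≠ 0 := by simp [MeasureTheory.ae_iff]
    have hneℓ : ∀ᵐ t : ℝ, t ≠ ℓ := by simp [MeasureTheory.ae_iff]
    filter_upwards [h.ae_hasDerivAt_vel, hne0, hneℓ] with t hvt h1 h2 ht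
    have hI : t ∈ Ioo 0 ℓ := ⟨lt_of_le_of_ne ht.1 h1.symm, lt_of_le_of_ne ht.2 h2⟩
    set N₂ := confocalNormal a u₂ (γ t)
    set N₃ := confocalNormal a u₃ (γ t)
    have dV : ∀ j, HasDerivAt (V j) (-(p t * N₂ j + q t * N₃ j)) t := fun j => by
      refine (hvt hI j).congr_of_eventuallyEq ?_
      filter_upwards [Icc_mem_nhds hI.1 hI.2] with r hr
      exact hVe r hr j
    have dx := h.hasDerivAt_coord hI
    have mom : ∀ j k, HasDerivAt (fun t => γ t j * V k t - γ t k * V j t)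
        (-(p t * (γ t j * N₂ k - γ t k * N₂ j) + q t * (γ t j * N₃ k - γ t k * N₃ j))) t :=
      fun j k => by
        convert! ((dx j).mul (dV k)).sub ((dx k).mul (dV j)) using 1
        rw [hVe t ht, hVe t ht]; ring
    have df := ((((dV 0).pow 2).mul_const ((a 1 - u) * (a 2 - u))).add
      (((dV 1).pow 2).mul_const ((a 0 - u) * (a 2 - u)))).add
      (((dV 2).pow 2).mul_const ((a 0 - u) * (a 1 - u))) |>.sub
      (((((mom 0 1).pow 2).mul_const (a 2 - u)).add (((mom 0 2).pow 2).mul_const (a 1 - u))).add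
      (((mom 1 2).pow 2).mul_const (a 0 - u)))
    have hp : p t = 0 ∨ _ := or_iff_not_imp_left.2 fun hne =>
      tangencyPoly_normal_variation ha.sub_u₂_ne_zero (h.contact_left t ht hne)
        (h.form_eq_zero_left ht (h.contact_left t ht hne)) u
    have hq : q t = 0 ∨ _ := or_iff_not_imp_left.2 fun hne =>
      tangencyPoly_normal_variation ha.sub_u₃_ne_zero (h.contact_right t ht hne)
        (h.form_eq_zero_right ht (h.contact_right t ht hne)) u
    have hp := mul_eq_zero.2 hp
    have hq := mul_eq_zero.2 hq
    convert! df using 1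
    simp only [hVe t ht]
    linear_combination 2 * hp + 2 * hq
  obtain ⟨C, hC⟩ := acf.const_of_ae_hasDerivAt_zero hder
  rw [uIcc_of_le h.length_pos.le] at hC
  rw [← hfe s hs, ← hfe t ht, hC s hs, hC t ht]

theorem tangencyPoly_eq_zero_left (h : IsEquilibrium a u₂ u₃ ℓ γ v p q) (ha : ConfocalOrder a u₂ u₃)
    {t : ℝ} (ht : t ∈ Icc 0 ℓ) (hc : γ t ∈ confocalQuadric a u₂) :
    tangencyPoly a (γ t) (v t) u₂ = 0 := by
  rw [← isTangentLine_iff ha.sub_u₂_ne_zero, IsTangentLine, h.form_eq_zero_left ht hc,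
    show confocalForm a u₂ (γ t) (γ t) = 1 from hc]
  ring

theorem tangencyPoly_eq_zero_right (h : IsEquilibrium a u₂ u₃ ℓ γ v p q)
    (ha : ConfocalOrder a u₂ u₃) {t : ℝ} (ht : t ∈ Icc 0 ℓ) (hc : γ t ∈ confocalQuadric a u₃) :
    tangencyPoly a (γ t) (v t) u₃ = 0 := by
  rw [← isTangentLine_iff ha.sub_u₃_ne_zero, IsTangentLine, h.form_eq_zero_right ht hc,
    show confocalForm a u₃ (γ t) (γ t) = 1 from hc]
  ring

/-- A thread that touches both quadrics: all its tangents touch both of them, and this determines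
the tangency polynomial. -/
theorem tangencyPoly_eq_mul (h : IsEquilibrium a u₂ u₃ ℓ γ v p q) (ha : ConfocalOrder a u₂ u₃)
    (h₂ : ∃ t ∈ Icc 0 ℓ, γ t ∈ confocalQuadric a u₂) (h₃ : ∃ t ∈ Icc 0 ℓ, γ t ∈ confocalQuadric a u₃)
    {t : ℝ} (ht : t ∈ Icc 0 ℓ) (u : ℝ) :
    tangencyPoly a (γ t) (v t) u = (u - u₂) * (u - u₃) := by
  obtain ⟨r₂, hr₂, hc₂⟩ := h₂
  obtain ⟨r₃, hr₃, hc₃⟩ := h₃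
  have e₂ := h.tangencyPoly_eq_zero_left ha hr₂ hc₂
  have e₃ := h.tangencyPoly_eq_zero_right ha hr₃ hc₃
  rw [h.tangencyPoly_eq ha _ hr₂ ht] at e₂
  rw [h.tangencyPoly_eq ha _ hr₃ ht] at e₃
  have e1 := h.sum_sq_vel ht
  have hne : u₂ - u₃ ≠ 0 := by have := ha.3; have := ha.4; intro h; linarith
  simp only [tangencyPoly] at *
  refine mul_left_cancel₀ hne ?_
  linear_combination (u - u₃) * e₂ - (u - u₂) * e₃ + (u - u₂) * (u - u₃) * (u₂ - u₃) * e1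

/-! ### Arcs of a thread -/

/-- Where it is free from pressure the thread is straight. -/
theorem isRectilinear (h : IsEquilibrium a u₂ u₃ ℓ γ v p q) {s t : ℝ} (hs : s ∈ Icc 0 ℓ)
    (ht : t ∈ Icc 0 ℓ) (h₂ : ∀ᵐ r, r ∈ Ioo s t → γ r ∉ confocalQuadric a u₂)
    (h₃ : ∀ᵐ r, r ∈ Ioo s t → γ r ∉ confocalQuadric a u₃) :
    ∀ r ∈ Icc s t, v r = v s ∧ γ r = γ s + (r - s) • v s := by
  have hsub : Icc s t ⊆ Icc 0 ℓ := Icc_subset_Icc hs.1 ht.2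
  have hv : ∀ r ∈ Icc s t, v r = v s := fun r hr => by
    rw [h.vel_sub hs (hsub hr), sub_eq_self]
    refine intervalIntegral.integral_zero_ae ?_
    have hne : ∀ᵐ x : ℝ, x ≠ t := by simp [MeasureTheory.ae_iff]
    filter_upwards [h₂, h₃, hne] with x hx₂ hx₃ hxt hx
    rw [uIoc_of_le hr.1] at hx
    have hI : x ∈ Ioo s t := ⟨hx.1, lt_of_le_of_ne (hx.2.trans hr.2) hxt⟩
    have hI' := hsub (Ioo_subset_Icc_self hI)
    have e₂ : p x = 0 := by_contra fun hne => hx₂ hI (h.contact_left x hI' hne)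
    have e₃ : q x = 0 := by_contra fun hne => hx₃ hI (h.contact_right x hI' hne)
    rw [e₂, e₃, zero_smul, zero_smul, add_zero]
  intro r hr
  refine ⟨hv r hr, ?_⟩
  have hst : s ≤ t := hr.1.trans hr.2
  have key := constant_of_has_deriv_right_zero (f := fun r => γ r - (r - s) • v s) (a := s) (b := t)
    ((h.continuousOn.mono hsub).sub (by fun_prop)) (fun r hr => by
      have h1 := ((h.hasDeriv r (hsub (Ico_subset_Icc_self hr))).mono hsub)
      have h2 : HasDerivWithinAt (fun r => (r - s) • v s) ((1 : ℝ) • v s) (Icc s t) r :=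
        (((hasDerivAt_id r).sub_const s).smul_const (v s)).hasDerivWithinAt
      have h3 := h1.sub h2
      rw [hv r (Ico_subset_Icc_self hr), one_smul, sub_self] at h3
      exact (h3.mono_of_mem_nhdsWithin (Icc_mem_nhdsGE_of_mem hr))) r hr
  simp only [sub_self, zero_smul, sub_zero] at key
  rw [← key]; abel

/-- A unit speed curve on a quadric, whose acceleration is normal to the quadric in the weak sense,
is a geodesic. The pressure is determined almost everywhere as a continuous function, the normal
curvature, so that the velocity is in fact continuously differentiable. -/
theorem isGeodesicOn_of_force (h : IsEquilibrium a u₂ u₃ ℓ γ v p q) {w : ℝ} (hw : ∀ j, a j - w ≠ 0)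
    {s t : ℝ} (hs : s ∈ Icc 0 ℓ) (ht : t ∈ Icc 0 ℓ)
    (hon : ∀ r ∈ Icc s t, γ r ∈ confocalQuadric a w) (f : ℝ → ℝ)
    (hforce : ∀ᵐ r, r ∈ Ioo s t → p r • confocalNormal a u₂ (γ r) + q r • confocalNormal a u₃ (γ r)
      = f r • confocalNormal a w (γ r)) :
    IsGeodesicOn a w γ s t := by
  have hsub : Icc s t ⊆ Icc 0 ℓ := Icc_subset_Icc hs.1 ht.2
  have hsubo : Ioo s t ⊆ Ioo 0 ℓ := Ioo_subset_Ioo hs.1 ht.2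
  set μ : ℝ → ℝ := fun r => (∑ j, v r j * v r j / (a j - w)) / ∑ j, (γ r j / (a j - w)) ^ 2 with hμ
  have hN : ∀ r ∈ Icc s t, 0 < ∑ j, (γ r j / (a j - w)) ^ 2 := fun r hr =>
    confocalForm_self_pos hw (hon r hr)
  have hμc : ContinuousOn μ (Icc s t) := by
    refine ContinuousOn.div ?_ ?_ fun r hr => (hN r hr).ne'
    · refine continuousOn_finsetSum _ fun j _ => ContinuousOn.div_const ?_ _
      exact ((h.continuousOn_vel_coord j).mul (h.continuousOn_vel_coord j)).mono hsub
    · refine continuousOn_finsetSum _ fun j _ => ContinuousOn.pow (ContinuousOn.div_const ?_ _) _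
      exact (h.continuousOn_coord j).mono hsub
  have htan : ∀ r ∈ Ioo s t, ∑ j, γ r j * v r j / (a j - w) = 0 := fun r hr => by
    have h1 := h.hasDerivAt_form w (hsubo hr)
    have h2 : HasDerivAt (fun r => confocalForm a w (γ r) (γ r)) 0 r := by
      refine (hasDerivAt_const r (1 : ℝ)).congr_of_eventuallyEq ?_
      filter_upwards [Icc_mem_nhds hr.1 hr.2] with x hx using hon x hx
    have := h1.unique h2
    simp only [confocalForm] at this
    linarith
  have hforce' : ∀ᵐ r, r ∈ Ioo s t → p r • confocalNormal a u₂ (γ r) +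
      q r • confocalNormal a u₃ (γ r) = μ r • confocalNormal a w (γ r) := by
    filter_upwards [hforce, h.ae_hasDerivAt_vel] with r hr1 hr2 hr
    rw [hr1 hr]
    congr 1
    have hacc : ∀ j, HasDerivAt (fun t => v t j) (-(f r * (γ r j / (a j - w)))) r := fun j => by
      convert! hr2 (hsubo hr) j using 1
      have := congrArg (fun x : E3 => x j) (hr1 hr)
      simp only [PiLp.add_apply, PiLp.smul_apply, smul_eq_mul] at this
      rw [this]; rfl
    have h1 : HasDerivAt (fun r => ∑ j, γ r j * v r j / (a j - w))
        (∑ j, (v r j * v r j + γ r j * (-(f r * (γ r j / (a j - w))))) / (a j - w)) r :=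
      HasDerivAt.fun_sum fun j _ =>
        ((h.hasDerivAt_coord (hsubo hr) j).mul (hacc j)).div_const _
    have h2 : HasDerivAt (fun r => ∑ j, γ r j * v r j / (a j - w)) 0 r := by
      refine (hasDerivAt_const r (0 : ℝ)).congr_of_eventuallyEq ?_
      filter_upwards [Ioo_mem_nhds hr.1 hr.2] with x hx using htan x hx
    have h3 := h1.unique h2
    rw [hμ, eq_div_iff (hN r (Ioo_subset_Icc_self hr)).ne']
    have h4 : ∑ j, (v r j * v r j + γ r j * (-(f r * (γ r j / (a j - w))))) / (a j - w) =
        (∑ j, v r j * v r j / (a j - w)) - f r * ∑ j, (γ r j / (a j - w)) ^ 2 := by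
      rw [Finset.mul_sum, ← Finset.sum_sub_distrib]
      refine Finset.sum_congr rfl fun j _ => ?_
      have := hw j
      field_simp
      ring
    rw [h4] at h3
    linarith
  rcases lt_or_ge t s with hlt | hst
  · exact ⟨0, 0, fun r hr => absurd (hr.1.trans hr.2) hlt.not_ge⟩
  set F : ℝ → E3 := IccExtend hst ((Icc s t).domRestrict fun r => μ r • confocalNormal a w (γ r)) with hF
  have hFc : Continuous F :=
    (hμc.smul ((h.continuousOn_normal w).mono hsub)).domRestrict.Icc_extend'
  have hFe : ∀ r ∈ Icc s t, F r = μ r • confocalNormal a w (γ r) := fun r hr => by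
    rw [hF, IccExtend_of_mem _ _ hr]; rfl
  have hv : ∀ r ∈ Icc s t, v r = v s - ∫ x in s..r, F x := fun r hr => by
    rw [h.vel_sub hs (hsub hr)]
    congr 1
    refine intervalIntegral.integral_congr_ae ?_
    have hne : ∀ᵐ x : ℝ, x ≠ t := by simp [MeasureTheory.ae_iff]
    filter_upwards [hforce', hne] with x hx1 hxt hx
    rw [uIoc_of_le hr.1] at hx
    have hI : x ∈ Ioo s t := ⟨hx.1, lt_of_le_of_ne (hx.2.trans hr.2) hxt⟩
    rw [hx1 hI, hFe x (Ioo_subset_Icc_self hI)]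
  refine ⟨v, fun r => -μ r, fun r hr => ⟨hon r hr, (h.hasDeriv r (hsub hr)).mono hsub, ?_⟩⟩
  have h1 : HasDerivAt (fun r => v s - ∫ x in s..r, F x) (-F r) r :=
    ((hFc.integral_hasStrictDerivAt s r).hasDerivAt).const_sub (v s)
  rw [neg_smul, ← hFe r hr]
  exact h1.hasDerivWithinAt.congr hv (hv r hr)

theorem isGeodesicOn_left (h : IsEquilibrium a u₂ u₃ ℓ γ v p q) (ha : ConfocalOrder a u₂ u₃)
    {s t : ℝ} (hs : s ∈ Icc 0 ℓ) (ht : t ∈ Icc 0 ℓ)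
    (hon : ∀ r ∈ Icc s t, γ r ∈ confocalQuadric a u₂)
    (hoff : ∀ r ∈ Ioo s t, γ r ∉ confocalQuadric a u₃) : IsGeodesicOn a u₂ γ s t := by
  refine h.isGeodesicOn_of_force ha.sub_u₂_ne_zero hs ht hon p (.of_forall fun r hr => ?_)
  have hq : q r = 0 := by_contra fun hne => hoff r hr
    (h.contact_right r ⟨hs.1.trans hr.1.le, hr.2.le.trans ht.2⟩ hne)
  rw [hq, zero_smul, add_zero]

theorem isGeodesicOn_right (h : IsEquilibrium a u₂ u₃ ℓ γ v p q) (ha : ConfocalOrder a u₂ u₃)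
    {s t : ℝ} (hs : s ∈ Icc 0 ℓ) (ht : t ∈ Icc 0 ℓ)
    (hon : ∀ r ∈ Icc s t, γ r ∈ confocalQuadric a u₃)
    (hoff : ∀ r ∈ Ioo s t, γ r ∉ confocalQuadric a u₂) : IsGeodesicOn a u₃ γ s t := by
  refine h.isGeodesicOn_of_force ha.sub_u₃_ne_zero hs ht hon q (.of_forall fun r hr => ?_)
  have hp : p r = 0 := by_contra fun hne => hoff r hr
    (h.contact_left r ⟨hs.1.trans hr.1.le, hr.2.le.trans ht.2⟩ hne)
  rw [hp, zero_smul, zero_add]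

end IsEquilibrium
end

section
variable {a : Fin 3 → ℝ} {u₂ u₃ : ℝ}

/-! ### Elliptic coordinates -/

theorem continuous_confocalCubic (x : E3) : Continuous (confocalCubic a x) := by
  unfold confocalCubic; fun_prop

/-- A monic cubic with three distinct roots is the product of its linear factors. -/
theorem cubic_eq_mul_of_roots {b c d r s t : ℝ} (hrs : r ≠ s) (hrt : r ≠ t) (hst : s ≠ t)
    (hr : r ^ 3 + b * r ^ 2 + c * r + d = 0) (hs : s ^ 3 + b * s ^ 2 + c * s + d = 0)
    (ht : t ^ 3 + b * t ^ 2 + c * t + d = 0) (u : ℝ) :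
    u ^ 3 + b * u ^ 2 + c * u + d = (u - r) * (u - s) * (u - t) := by
  have h1 : r ^ 2 + r * s + s ^ 2 + b * (r + s) + c = 0 :=
    mul_left_cancel₀ (sub_ne_zero.2 hrs) (by linear_combination hr - hs)
  have h2 : r ^ 2 + r * t + t ^ 2 + b * (r + t) + c = 0 :=
    mul_left_cancel₀ (sub_ne_zero.2 hrt) (by linear_combination hr - ht)
  have h3 : r + s + t + b = 0 :=
    mul_left_cancel₀ (sub_ne_zero.2 hst) (by linear_combination h1 - h2)
  have hb : b = -(r + s + t) := by linarith
  subst hb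
  have hc : c = r * s + r * t + s * t := by linear_combination h1
  subst hc
  linear_combination hr

/-- The elliptic coordinates of a point outside of both quadrics. -/
theorem ConfocalOrder.exists_elliptic (ha : ConfocalOrder a u₂ u₃) {x : E3}
    (h₂ : 1 ≤ confocalForm a u₂ x x) (h₃ : 1 ≤ confocalForm a u₃ x x) :
    ∃ U V W : ℝ, U ∈ Icc (a 1) (a 0) ∧ V ∈ Icc (a 2) u₂ ∧ W ≤ u₃ ∧
      ∀ u, confocalCubic a x u = (u - U) * (u - V) * (u - W) := by
  obtain ⟨h1, h2, h3, h4⟩ := id ha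
  have hc := continuous_confocalCubic (a := a) x
  have p0 : 0 ≤ confocalCubic a x (a 0) := by
    have : confocalCubic a x (a 0) = x 0 ^ 2 * ((a 0 - a 1) * (a 0 - a 2)) := by
      simp only [confocalCubic]; ring
    rw [this]; exact mul_nonneg (sq_nonneg _) (mul_nonneg (by linarith) (by linarith))
  have p1 : confocalCubic a x (a 1) ≤ 0 := by
    have : -confocalCubic a x (a 1) = x 1 ^ 2 * ((a 0 - a 1) * (a 1 - a 2)) := by
      simp only [confocalCubic]; ring
    have h : 0 ≤ x 1 ^ 2 * ((a 0 - a 1) * (a 1 - a 2)) :=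
      mul_nonneg (sq_nonneg _) (mul_nonneg (by linarith) (by linarith))
    linarith
  have p2 : confocalCubic a x u₂ ≤ 0 := by
    rw [confocalCubic_eq ha.sub_u₂_ne_zero]
    exact mul_nonpos_of_nonneg_of_nonpos (by linarith) (mul_nonpos_of_nonneg_of_nonpos
      (mul_nonneg (by linarith) (by linarith)) (by linarith))
  have p3 : 0 ≤ confocalCubic a x (a 2) := by
    have : confocalCubic a x (a 2) = x 2 ^ 2 * ((a 0 - a 2) * (a 1 - a 2)) := by
      simp only [confocalCubic]; ring
    rw [this]; exact mul_nonneg (sq_nonneg _) (mul_nonneg (by linarith) (by linarith))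
  have p4 : 0 ≤ confocalCubic a x u₃ := by
    rw [confocalCubic_eq ha.sub_u₃_ne_zero]
    exact mul_nonneg (by linarith) (mul_nonneg (mul_nonneg (ha.sub_u₃_pos 0).le
      (ha.sub_u₃_pos 1).le) (ha.sub_u₃_pos 2).le)
  -- The point lies inside the ellipsoid `w = a₂ - D` if `D ≥ |x|²`.
  obtain ⟨w, hw, p5⟩ : ∃ w ≤ u₃, confocalCubic a x w ≤ 0 := by
    set D := (a 2 - u₃) + x 0 ^ 2 + x 1 ^ 2 + x 2 ^ 2 with hD
    have hD0 : 0 < D := by positivity [sub_pos.2 h4]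
    refine ⟨a 2 - D, by rw [hD]; nlinarith [sq_nonneg (x 0), sq_nonneg (x 1), sq_nonneg (x 2)], ?_⟩
    have e0 : 0 < a 0 - a 2 := by linarith
    have e1 : 0 < a 1 - a 2 := by linarith
    have key : -confocalCubic a x (a 2 - D) = (a 2 - u₃) * ((a 0 - a 2 + D) * (a 1 - a 2 + D))
        + x 0 ^ 2 * ((a 0 - a 2) * (a 1 - a 2 + D)) + x 1 ^ 2 * ((a 1 - a 2) * (a 0 - a 2 + D)) := by
      simp only [confocalCubic]; rw [hD]; ring
    have : 0 ≤ -confocalCubic a x (a 2 - D) := by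
      rw [key]; have := sub_pos.2 h4; positivity
    linarith
  obtain ⟨U, hU, hU0⟩ := intermediate_value_Icc h1.le hc.continuousOn (⟨p1, p0⟩ : (0 : ℝ) ∈ Icc _ _)
  obtain ⟨V, hV, hV0⟩ := intermediate_value_Icc' h3.le hc.continuousOn (⟨p2, p3⟩ : (0 : ℝ) ∈ Icc _ _)
  obtain ⟨W, hW, hW0⟩ := intermediate_value_Icc hw hc.continuousOn (⟨p5, p4⟩ : (0 : ℝ) ∈ Icc _ _)
  refine ⟨U, V, W, hU, hV, hW.2, fun u => ?_⟩
  have hUV : U ≠ V := by intro h; have := hU.1; have := hV.2; linarith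
  have hUW : U ≠ W := by intro h; have := hU.1; have := hW.2; linarith
  have hVW : V ≠ W := by intro h; have := hV.1; have := hW.2; linarith
  obtain ⟨b, c, d, e⟩ : ∃ b c d : ℝ, ∀ u, confocalCubic a x u = u ^ 3 + b * u ^ 2 + c * u + d := by
    refine ⟨x 0 ^ 2 + x 1 ^ 2 + x 2 ^ 2 - (a 0 + a 1 + a 2), -(x 0 ^ 2 * (a 1 + a 2)
      + x 1 ^ 2 * (a 0 + a 2) + x 2 ^ 2 * (a 0 + a 1)) + (a 0 * a 1 + a 0 * a 2 + a 1 * a 2),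
      x 0 ^ 2 * (a 1 * a 2) + x 1 ^ 2 * (a 0 * a 2) + x 2 ^ 2 * (a 0 * a 1) - a 0 * a 1 * a 2,
      fun u => ?_⟩
    simp only [confocalCubic]; ring
  rw [e] at hU0 hV0 hW0 ⊢
  exact cubic_eq_mul_of_roots hUV hUW hVW hU0 hV0 hW0 u

/-- A root of a family of cubics that stays away from the two other roots is continuous. -/
theorem continuousOn_cubic_root {I : Set ℝ} {f : ℝ → ℝ → ℝ} {A B C : ℝ → ℝ} {δ : ℝ} (hδ : 0 < δ)
    (hf : ∀ t ∈ I, ∀ u, f t u = (u - A t) * (u - B t) * (u - C t))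
    (hB : ∀ t ∈ I, ∀ r ∈ I, δ ≤ |A t - B r|) (hC : ∀ t ∈ I, ∀ r ∈ I, δ ≤ |A t - C r|)
    (hcont : ∀ u, ContinuousOn (fun t => f t u) I) : ContinuousOn A I := by
  intro t ht
  have h1 := (hcont (A t) t ht).abs.const_mul (δ ^ 2)⁻¹
  have h0 : f t (A t) = 0 := by rw [hf t ht]; ring
  rw [ContinuousWithinAt, h0, abs_zero, mul_zero] at h1
  rw [ContinuousWithinAt, tendsto_iff_dist_tendsto_zero]
  refine squeeze_zero' (.of_forall fun _ => dist_nonneg) ?_ h1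
  filter_upwards [self_mem_nhdsWithin] with r hr
  rw [hf r hr, abs_mul, abs_mul, Real.dist_eq, abs_sub_comm, inv_mul_eq_div,
    le_div_iff₀ (by positivity), pow_two, mul_assoc]
  exact mul_le_mul_of_nonneg_left (mul_le_mul (hB t ht r hr) (hC t ht r hr) hδ.le (abs_nonneg _))
    (abs_nonneg _)

/-- A simple root of a differentiable family of cubics is differentiable. -/
theorem hasDerivAt_cubic_root {I : Set ℝ} {f : ℝ → ℝ → ℝ} {A B C : ℝ → ℝ} {t d : ℝ}
    (hI : I ∈ nhds t) (hf : ∀ t ∈ I, ∀ u, f t u = (u - A t) * (u - B t) * (u - C t))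
    (hB : ContinuousAt B t) (hC : ContinuousAt C t) (hAB : A t ≠ B t) (hAC : A t ≠ C t)
    (hd : HasDerivAt (fun r => f r (A t)) d t) :
    HasDerivAt A (-d / ((A t - B t) * (A t - C t))) t := by
  have hcont : ContinuousAt (fun r => (A t - B r) * (A t - C r)) t :=
    (continuousAt_const.sub hB).mul (continuousAt_const.sub hC)
  have hne : (A t - B t) * (A t - C t) ≠ 0 := mul_ne_zero (sub_ne_zero.2 hAB) (sub_ne_zero.2 hAC)
  rw [hasDerivAt_iff_tendsto_slope] at hd ⊢
  refine (hd.neg.div (hcont.tendsto.mono_left nhdsWithin_le_nhds) hne).congr' ?_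
  filter_upwards [nhdsWithin_le_nhds hI, nhdsWithin_le_nhds (hcont.eventually_ne hne),
    self_mem_nhdsWithin] with r hr hne' hrt
  have h0 : f t (A t) = 0 := by rw [hf t (mem_of_mem_nhds hI)]; ring
  rw [Pi.div_apply, slope_def_field, slope_def_field, h0, hf r hr]
  have hrt : r - t ≠ 0 := sub_ne_zero.2 hrt
  rw [div_eq_iff hne']
  field_simp
  ring

/-- `U`, `V`, `W` are the elliptic coordinates of a differentiable curve `γ` with velocity `v`, that
runs outside of the quadrics `u₂` and `u₃` in such a way that all its tangents are tangent to both
of them. -/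
structure IsEllipticMotion (a : Fin 3 → ℝ) (u₂ u₃ ℓ : ℝ) (γ v : ℝ → E3) (U V W : ℝ → ℝ) : Prop where
  order : ConfocalOrder a u₂ u₃
  length_pos : 0 < ℓ
  continuousOn_coord : ∀ j, ContinuousOn (fun t => γ t j) (Icc 0 ℓ)
  continuousOn_vel : ∀ j, ContinuousOn (fun t => v t j) (Icc 0 ℓ)
  hasDerivAt_coord : ∀ t ∈ Ioo 0 ℓ, ∀ j, HasDerivAt (fun t => γ t j) (v t j) t
  tangency : ∀ t ∈ Icc 0 ℓ, ∀ u, tangencyPoly a (γ t) (v t) u = (u - u₂) * (u - u₃)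
  mem_U : ∀ t ∈ Icc 0 ℓ, U t ∈ Icc (a 1) (a 0)
  mem_V : ∀ t ∈ Icc 0 ℓ, V t ∈ Icc (a 2) u₂
  le_W : ∀ t ∈ Icc 0 ℓ, W t ≤ u₃
  factor : ∀ t ∈ Icc 0 ℓ, ∀ u, confocalCubic a (γ t) u = (u - U t) * (u - V t) * (u - W t)

theorem IsEquilibrium.exists_isEllipticMotion {ℓ : ℝ} {γ v : ℝ → E3} {p q : ℝ → ℝ}
    (h : IsEquilibrium a u₂ u₃ ℓ γ v p q) (ha : ConfocalOrder a u₂ u₃)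
    (h₂ : ∃ t ∈ Icc 0 ℓ, γ t ∈ confocalQuadric a u₂)
    (h₃ : ∃ t ∈ Icc 0 ℓ, γ t ∈ confocalQuadric a u₃) :
    ∃ U V W, IsEllipticMotion a u₂ u₃ ℓ γ v U V W := by
  have key : ∀ t, ∃ U V W : ℝ, t ∈ Icc 0 ℓ → U ∈ Icc (a 1) (a 0) ∧ V ∈ Icc (a 2) u₂ ∧ W ≤ u₃ ∧
      ∀ u, confocalCubic a (γ t) u = (u - U) * (u - V) * (u - W) := fun t => by
    by_cases ht : t ∈ Icc 0 ℓ
    · obtain ⟨U, V, W, hh⟩ := ha.exists_elliptic (h.outside t ht).1 (h.outside t ht).2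
      exact ⟨U, V, W, fun _ => hh⟩
    · exact ⟨0, 0, 0, fun h => absurd h ht⟩
  choose U V W hh using key
  exact ⟨U, V, W, ha, h.length_pos, h.continuousOn_coord, h.continuousOn_vel_coord,
    fun t ht => h.hasDerivAt_coord ht, fun t ht => h.tangencyPoly_eq_mul ha h₂ h₃ ht,
    fun t ht => (hh t ht).1, fun t ht => (hh t ht).2.1, fun t ht => (hh t ht).2.2.1,
    fun t ht => (hh t ht).2.2.2⟩

/-- The derivative of the elliptic coordinate `U` along a line with direction `v` through `x`, where
`V` and `W` are the two other elliptic coordinates of `x`. -/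
noncomputable def ellipticVel (a : Fin 3 → ℝ) (x v : E3) (U V W : ℝ) : ℝ :=
  -(2 * confocalPolar a x v U) / ((U - V) * (U - W))

namespace IsEllipticMotion

variable {ℓ : ℝ} {γ v : ℝ → E3} {U V W : ℝ → ℝ}

theorem V_lt_U (h : IsEllipticMotion a u₂ u₃ ℓ γ v U V W) {t r : ℝ} (ht : t ∈ Icc 0 ℓ)
    (hr : r ∈ Icc 0 ℓ) : a 1 - u₂ ≤ U t - V r := by
  have := (h.mem_U t ht).1; have := (h.mem_V r hr).2; linarith

theorem W_lt_V (h : IsEllipticMotion a u₂ u₃ ℓ γ v U V W) {t r : ℝ} (ht : t ∈ Icc 0 ℓ)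
    (hr : r ∈ Icc 0 ℓ) : a 2 - u₃ ≤ V t - W r := by
  have := (h.mem_V t ht).1; have := h.le_W r hr; linarith

theorem W_lt_U (h : IsEllipticMotion a u₂ u₃ ℓ γ v U V W) {t r : ℝ} (ht : t ∈ Icc 0 ℓ)
    (hr : r ∈ Icc 0 ℓ) : a 1 - u₃ ≤ U t - W r := by
  have := (h.mem_U t ht).1; have := h.le_W r hr; linarith

theorem sub_UV_pos (h : IsEllipticMotion a u₂ u₃ ℓ γ v U V W) {t : ℝ} (ht : t ∈ Icc 0 ℓ) :
    0 < U t - V t := by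
  have := h.V_lt_U ht ht; have := h.order.2; linarith

theorem sub_VW_pos (h : IsEllipticMotion a u₂ u₃ ℓ γ v U V W) {t : ℝ} (ht : t ∈ Icc 0 ℓ) :
    0 < V t - W t := by
  have := h.W_lt_V ht ht; have := h.order.4; linarith

theorem sub_UW_pos (h : IsEllipticMotion a u₂ u₃ ℓ γ v U V W) {t : ℝ} (ht : t ∈ Icc 0 ℓ) :
    0 < U t - W t := by
  have := h.sub_UV_pos ht; have := h.sub_VW_pos ht; linarith

theorem continuousOn_cubic (h : IsEllipticMotion a u₂ u₃ ℓ γ v U V W) (u : ℝ) :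
    ContinuousOn (fun t => confocalCubic a (γ t) u) (Icc 0 ℓ) := by
  have h0 := h.continuousOn_coord 0
  have h1 := h.continuousOn_coord 1
  have h2 := h.continuousOn_coord 2
  simp only [confocalCubic]
  fun_prop

theorem continuousOn_U (h : IsEllipticMotion a u₂ u₃ ℓ γ v U V W) : ContinuousOn U (Icc 0 ℓ) := by
  obtain ⟨h1, h2, h3, h4⟩ := h.order
  refine continuousOn_cubic_root (f := fun t => confocalCubic a (γ t)) (B := V) (C := W)
    (δ := a 1 - u₂) (by linarith) h.factor
    (fun t ht r hr => (h.V_lt_U ht hr).trans (le_abs_self _))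
    (fun t ht r hr => le_trans ?_ ((h.W_lt_U ht hr).trans (le_abs_self _))) h.continuousOn_cubic
  linarith

theorem continuousOn_V (h : IsEllipticMotion a u₂ u₃ ℓ γ v U V W) : ContinuousOn V (Icc 0 ℓ) := by
  obtain ⟨h1, h2, h3, h4⟩ := h.order
  refine continuousOn_cubic_root (f := fun t => confocalCubic a (γ t)) (B := U) (C := W)
    (δ := min (a 1 - u₂) (a 2 - u₃)) (lt_min (by linarith) (by linarith))
    (fun t ht u => by rw [h.factor t ht]; ring)
    (fun t ht r hr => (min_le_left _ _).trans ?_)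
    (fun t ht r hr => (min_le_right _ _).trans ((h.W_lt_V ht hr).trans (le_abs_self _)))
    h.continuousOn_cubic
  rw [abs_sub_comm]; exact (h.V_lt_U hr ht).trans (le_abs_self _)

theorem continuousOn_W (h : IsEllipticMotion a u₂ u₃ ℓ γ v U V W) : ContinuousOn W (Icc 0 ℓ) := by
  obtain ⟨h1, h2, h3, h4⟩ := h.order
  refine continuousOn_cubic_root (f := fun t => confocalCubic a (γ t)) (B := V) (C := U)
    (δ := a 2 - u₃) (by linarith) (fun t ht u => by rw [h.factor t ht]; ring)
    (fun t ht r hr => ?_) (fun t ht r hr => ?_) h.continuousOn_cubic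
  · rw [abs_sub_comm]; exact (h.W_lt_V hr ht).trans (le_abs_self _)
  · rw [abs_sub_comm]
    exact le_trans (by linarith) ((h.W_lt_U hr ht).trans (le_abs_self _))

theorem hasDerivAt_cubic (h : IsEllipticMotion a u₂ u₃ ℓ γ v U V W) {t : ℝ} (ht : t ∈ Ioo 0 ℓ)
    (u : ℝ) : HasDerivAt (fun t => confocalCubic a (γ t) u) (2 * confocalPolar a (γ t) (v t) u) t := by
  have hd := h.hasDerivAt_coord t ht
  have := (((((hd 0).pow 2).mul_const ((a 1 - u) * (a 2 - u))).add
    (((hd 1).pow 2).mul_const ((a 0 - u) * (a 2 - u)))).add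
    (((hd 2).pow 2).mul_const ((a 0 - u) * (a 1 - u)))).sub_const ((a 0 - u) * (a 1 - u) * (a 2 - u))
  convert! this using 1
  simp only [confocalPolar]; ring

theorem hasDerivAt_U (h : IsEllipticMotion a u₂ u₃ ℓ γ v U V W) {t : ℝ} (ht : t ∈ Ioo 0 ℓ) :
    HasDerivAt U (ellipticVel a (γ t) (v t) (U t) (V t) (W t)) t := by
  have hI := Icc_mem_nhds ht.1 ht.2
  have ht' := Ioo_subset_Icc_self ht
  exact hasDerivAt_cubic_root hI (f := fun t => confocalCubic a (γ t)) h.factor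
    (h.continuousOn_V.continuousAt hI) (h.continuousOn_W.continuousAt hI)
    (sub_ne_zero.1 (h.sub_UV_pos ht').ne') (sub_ne_zero.1 (h.sub_UW_pos ht').ne')
    (h.hasDerivAt_cubic ht _)

theorem hasDerivAt_V (h : IsEllipticMotion a u₂ u₃ ℓ γ v U V W) {t : ℝ} (ht : t ∈ Ioo 0 ℓ) :
    HasDerivAt V (ellipticVel a (γ t) (v t) (V t) (U t) (W t)) t := by
  have hI := Icc_mem_nhds ht.1 ht.2
  have ht' := Ioo_subset_Icc_self ht
  exact hasDerivAt_cubic_root hI (f := fun t => confocalCubic a (γ t))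
    (fun t ht u => by rw [h.factor t ht]; ring)
    (h.continuousOn_U.continuousAt hI) (h.continuousOn_W.continuousAt hI)
    (sub_ne_zero.1 (h.sub_UV_pos ht').ne').symm (sub_ne_zero.1 (h.sub_VW_pos ht').ne')
    (h.hasDerivAt_cubic ht _)

theorem hasDerivAt_W (h : IsEllipticMotion a u₂ u₃ ℓ γ v U V W) {t : ℝ} (ht : t ∈ Ioo 0 ℓ) :
    HasDerivAt W (ellipticVel a (γ t) (v t) (W t) (U t) (V t)) t := by
  have hI := Icc_mem_nhds ht.1 ht.2
  have ht' := Ioo_subset_Icc_self ht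
  exact hasDerivAt_cubic_root hI (f := fun t => confocalCubic a (γ t))
    (fun t ht u => by rw [h.factor t ht]; ring)
    (h.continuousOn_U.continuousAt hI) (h.continuousOn_V.continuousAt hI)
    (sub_ne_zero.1 (h.sub_UW_pos ht').ne').symm (sub_ne_zero.1 (h.sub_VW_pos ht').ne').symm
    (h.hasDerivAt_cubic ht _)

theorem polar_sq (h : IsEllipticMotion a u₂ u₃ ℓ γ v U V W) {t : ℝ} (ht : t ∈ Icc 0 ℓ) {u : ℝ}
    (hu : confocalCubic a (γ t) u = 0) : confocalPolar a (γ t) (v t) u ^ 2 =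
      (u - u₂) * (u - u₃) * ((a 0 - u) * (a 1 - u) * (a 2 - u)) := by
  have := confocalPolar_sq_sub (a := a) (γ t) (v t) u
  rw [hu, h.tangency t ht] at this
  linear_combination this

/-- Jacobi's equations of motion, `u̇ⁱ = ± 2 √Δ(uⁱ) / ∏ (uⁱ - uᵏ)`. -/
theorem vel_U_sq (h : IsEllipticMotion a u₂ u₃ ℓ γ v U V W) {t : ℝ} (ht : t ∈ Icc 0 ℓ) :
    ellipticVel a (γ t) (v t) (U t) (V t) (W t) ^ 2 =
      4 * ((U t - u₂) * (U t - u₃) * ((a 0 - U t) * (a 1 - U t) * (a 2 - U t)))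
        / ((U t - V t) * (U t - W t)) ^ 2 := by
  rw [ellipticVel, div_pow, neg_sq, mul_pow, h.polar_sq ht (by rw [h.factor t ht]; ring)]
  norm_num

theorem vel_V_sq (h : IsEllipticMotion a u₂ u₃ ℓ γ v U V W) {t : ℝ} (ht : t ∈ Icc 0 ℓ) :
    ellipticVel a (γ t) (v t) (V t) (U t) (W t) ^ 2 =
      4 * ((V t - u₂) * (V t - u₃) * ((a 0 - V t) * (a 1 - V t) * (a 2 - V t)))
        / ((V t - U t) * (V t - W t)) ^ 2 := by
  rw [ellipticVel, div_pow, neg_sq, mul_pow, h.polar_sq ht (by rw [h.factor t ht]; ring)]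
  norm_num

theorem vel_W_sq (h : IsEllipticMotion a u₂ u₃ ℓ γ v U V W) {t : ℝ} (ht : t ∈ Icc 0 ℓ) :
    ellipticVel a (γ t) (v t) (W t) (U t) (V t) ^ 2 =
      4 * ((W t - u₂) * (W t - u₃) * ((a 0 - W t) * (a 1 - W t) * (a 2 - W t)))
        / ((W t - U t) * (W t - V t)) ^ 2 := by
  rw [ellipticVel, div_pow, neg_sq, mul_pow, h.polar_sq ht (by rw [h.factor t ht]; ring)]
  norm_num

theorem continuousOn_ellipticVel (h : IsEllipticMotion a u₂ u₃ ℓ γ v U V W) {A B C : ℝ → ℝ}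
    (hA : ContinuousOn A (Icc 0 ℓ)) (hB : ContinuousOn B (Icc 0 ℓ)) (hC : ContinuousOn C (Icc 0 ℓ))
    (hAB : ∀ t ∈ Icc 0 ℓ, A t - B t ≠ 0) (hAC : ∀ t ∈ Icc 0 ℓ, A t - C t ≠ 0) :
    ContinuousOn (fun t => ellipticVel a (γ t) (v t) (A t) (B t) (C t)) (Icc 0 ℓ) := by
  unfold ellipticVel
  refine ContinuousOn.div ?_ ((hA.sub hB).mul (hA.sub hC)) fun t ht =>
    mul_ne_zero (hAB t ht) (hAC t ht)
  have h0 := h.continuousOn_coord 0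
  have h1 := h.continuousOn_coord 1
  have h2 := h.continuousOn_coord 2
  have k0 := h.continuousOn_vel 0
  have k1 := h.continuousOn_vel 1
  have k2 := h.continuousOn_vel 2
  simp only [confocalPolar]
  fun_prop

theorem mem_quadric_left (h : IsEllipticMotion a u₂ u₃ ℓ γ v U V W) {t : ℝ} (ht : t ∈ Icc 0 ℓ) :
    γ t ∈ confocalQuadric a u₂ ↔ V t = u₂ := by
  obtain ⟨h1, h2, h3, h4⟩ := id h.order
  have e1 := confocalCubic_eq h.order.sub_u₂_ne_zero (γ t)
  rw [h.factor t ht] at e1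
  have hne : (a 0 - u₂) * (a 1 - u₂) * (a 2 - u₂) ≠ 0 := mul_ne_zero (mul_ne_zero
    (h.order.sub_u₂_ne_zero 0) (h.order.sub_u₂_ne_zero 1)) (h.order.sub_u₂_ne_zero 2)
  have hU : u₂ - U t ≠ 0 := by have := (h.mem_U t ht).1; intro h; linarith
  have hW : u₂ - W t ≠ 0 := by have := h.le_W t ht; intro h; linarith
  change confocalForm a u₂ (γ t) (γ t) = 1 ↔ _
  constructor
  · intro hq
    rw [hq, sub_self, zero_mul] at e1
    rcases mul_eq_zero.1 e1 with e | e
    · linarith [(mul_eq_zero.1 e).resolve_left hU]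
    · exact absurd e hW
  · intro hV
    rw [hV, sub_self, mul_zero, zero_mul] at e1
    linarith [(mul_eq_zero.1 e1.symm).resolve_right hne]

theorem mem_quadric_right (h : IsEllipticMotion a u₂ u₃ ℓ γ v U V W) {t : ℝ} (ht : t ∈ Icc 0 ℓ) :
    γ t ∈ confocalQuadric a u₃ ↔ W t = u₃ := by
  obtain ⟨h1, h2, h3, h4⟩ := id h.order
  have e1 := confocalCubic_eq h.order.sub_u₃_ne_zero (γ t)
  rw [h.factor t ht] at e1
  have hne : (a 0 - u₃) * (a 1 - u₃) * (a 2 - u₃) ≠ 0 := mul_ne_zero (mul_ne_zero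
    (h.order.sub_u₃_ne_zero 0) (h.order.sub_u₃_ne_zero 1)) (h.order.sub_u₃_ne_zero 2)
  have hU : u₃ - U t ≠ 0 := by have := (h.mem_U t ht).1; intro h; linarith
  have hV : u₃ - V t ≠ 0 := by have := (h.mem_V t ht).1; intro h; linarith
  change confocalForm a u₃ (γ t) (γ t) = 1 ↔ _
  constructor
  · intro hq
    rw [hq, sub_self, zero_mul] at e1
    linarith [(mul_eq_zero.1 e1).resolve_left (mul_ne_zero hU hV)]
  · intro hW
    rw [hW, sub_self, mul_zero] at e1
    linarith [(mul_eq_zero.1 e1.symm).resolve_right hne]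

theorem mem_quadric_W (h : IsEllipticMotion a u₂ u₃ ℓ γ v U V W) {t : ℝ} (ht : t ∈ Icc 0 ℓ) :
    γ t ∈ confocalQuadric a (W t) := by
  obtain ⟨h1, h2, h3, h4⟩ := id h.order
  have hW := h.le_W t ht
  have hne : ∀ j, a j - W t ≠ 0 := fun j => by have := h.order.sub_u₃_pos j; intro h; linarith
  have e1 := confocalCubic_eq hne (γ t)
  rw [h.factor t ht, sub_self, mul_zero] at e1
  have := (mul_eq_zero.1 e1.symm).resolve_right
    (mul_ne_zero (mul_ne_zero (hne 0) (hne 1)) (hne 2))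
  change confocalForm a (W t) (γ t) (γ t) = 1
  linarith

/-- The curve crosses the coordinate planes transversally. -/
theorem vel_coord_ne_zero (h : IsEllipticMotion a u₂ u₃ ℓ γ v U V W) {t : ℝ} (ht : t ∈ Icc 0 ℓ)
    (j : Fin 3) (hj : γ t j = 0) : v t j ≠ 0 := by
  intro hv
  have e := h.tangency t ht (a j)
  have h2 := h.order.sub_u₂_ne_zero j
  have h3 := h.order.sub_u₃_ne_zero j
  refine mul_ne_zero h2 h3 (e.symm.trans ?_)
  fin_cases j <;> simp only [Fin.zero_eta, Fin.mk_one, Fin.reduceFinMk] at hj hv <;>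
    simp [tangencyPoly, hj, hv]

theorem coord_zero_sq (h : IsEllipticMotion a u₂ u₃ ℓ γ v U V W) {t : ℝ} (ht : t ∈ Icc 0 ℓ) :
    γ t 0 ^ 2 = (a 0 - U t) * (a 0 - V t) * (a 0 - W t) / ((a 0 - a 1) * (a 0 - a 2)) := by
  obtain ⟨h1, h2, h3, h4⟩ := id h.order
  have h02 : a 0 - a 2 ≠ 0 := by intro h; linarith
  rw [← h.factor t ht, eq_div_iff (mul_ne_zero (sub_ne_zero.2 h1.ne') h02)]
  simp only [confocalCubic]; ring

theorem coord_one_sq (h : IsEllipticMotion a u₂ u₃ ℓ γ v U V W) {t : ℝ} (ht : t ∈ Icc 0 ℓ) :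
    γ t 1 ^ 2 = (U t - a 1) * (a 1 - V t) * (a 1 - W t) / ((a 0 - a 1) * (a 1 - a 2)) := by
  obtain ⟨h1, h2, h3, h4⟩ := id h.order
  have h12 : a 1 - a 2 ≠ 0 := by intro h; linarith
  have := h.factor t ht (a 1)
  rw [eq_div_iff (mul_ne_zero (sub_ne_zero.2 h1.ne') h12)]
  simp only [confocalCubic] at this; linear_combination -this

theorem coord_two_sq (h : IsEllipticMotion a u₂ u₃ ℓ γ v U V W) {t : ℝ} (ht : t ∈ Icc 0 ℓ) :
    γ t 2 ^ 2 = (U t - a 2) * (V t - a 2) * (a 2 - W t) / ((a 0 - a 2) * (a 1 - a 2)) := by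
  obtain ⟨h1, h2, h3, h4⟩ := id h.order
  have h12 : a 1 - a 2 ≠ 0 := by intro h; linarith
  have h02 : a 0 - a 2 ≠ 0 := by intro h; linarith
  have := h.factor t ht (a 2)
  rw [eq_div_iff (mul_ne_zero h02 h12)]
  simp only [confocalCubic] at this; linear_combination this

end IsEllipticMotion
end

section
variable {a : Fin 3 → ℝ} {u₂ u₃ : ℝ}

/-! ### The contacts of the thread with the quadrics -/

/-- Outside the ellipsoid, the hyperboloid does not meet the plane of the first two axes. -/
theorem ConfocalOrder.coord_two_ne_zero (ha : ConfocalOrder a u₂ u₃) {x : E3}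
    (h₂ : x ∈ confocalQuadric a u₂) (h₃ : 1 ≤ confocalForm a u₃ x x) : x 2 ≠ 0 := by
  obtain ⟨h1, h2, h3, h4⟩ := id ha
  have h₂ : confocalForm a u₂ x x = 1 := h₂
  intro h0
  simp only [confocalForm, Fin.sum_univ_three, h0, mul_zero, zero_div, add_zero] at h₂ h₃
  have p0 : 0 < a 0 - u₂ := by linarith
  have p1 : 0 < a 1 - u₂ := by linarith
  have q0 : a 0 - u₂ < a 0 - u₃ := by linarith
  have q1 : a 1 - u₂ < a 1 - u₃ := by linarith
  have e0 : x 0 * x 0 / (a 0 - u₃) ≤ x 0 * x 0 / (a 0 - u₂) :=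
    div_le_div_of_nonneg_left (mul_self_nonneg _) p0 q0.le
  have e1 : x 1 * x 1 / (a 1 - u₃) ≤ x 1 * x 1 / (a 1 - u₂) :=
    div_le_div_of_nonneg_left (mul_self_nonneg _) p1 q1.le
  rcases eq_or_ne (x 0) 0 with hx | hx
  · have hx1 : x 1 ≠ 0 := by rintro h; simp [hx, h] at h₂
    have : x 1 * x 1 / (a 1 - u₃) < x 1 * x 1 / (a 1 - u₂) :=
      div_lt_div_of_pos_left (mul_self_pos.2 hx1) p1 q1
    linarith
  · have : x 0 * x 0 / (a 0 - u₃) < x 0 * x 0 / (a 0 - u₂) :=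
      div_lt_div_of_pos_left (mul_self_pos.2 hx) p0 q0
    linarith

namespace IsEquilibrium

variable {ℓ : ℝ} {γ v : ℝ → E3} {p q : ℝ → ℝ}

theorem isClosed_contact (h : IsEquilibrium a u₂ u₃ ℓ γ v p q) (u : ℝ) :
    IsClosed {t | t ∈ Icc 0 ℓ ∧ γ t ∈ confocalQuadric a u} := by
  have hc : ContinuousOn (fun t => confocalForm a u (γ t) (γ t)) (Icc 0 ℓ) := by
    unfold confocalForm
    exact continuousOn_finsetSum _ fun j _ =>
      ((h.continuousOn_coord j).mul (h.continuousOn_coord j)).div_const _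
  exact hc.preimage_isClosed_of_isClosed isClosed_Icc (isClosed_singleton (x := (1 : ℝ)))

/-- The times of contact with one of the visible parts of the hyperboloid, in dependence of the sign
`ε` of the third coordinate. -/
theorem exists_contact_eq_Icc (h : IsEquilibrium a u₂ u₃ ℓ γ v p q) (ha : ConfocalOrder a u₂ u₃)
    {ε : ℝ} (hε : ε ≠ 0)
    (hK : IsConnected {t | t ∈ Icc 0 ℓ ∧ γ t ∈ confocalQuadric a u₂ ∧ 0 < ε * γ t 2}) :
    ∃ A B, A ≤ B ∧ {t | t ∈ Icc 0 ℓ ∧ γ t ∈ confocalQuadric a u₂ ∧ 0 < ε * γ t 2} = Icc A B := by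
  set K := {t | t ∈ Icc 0 ℓ ∧ γ t ∈ confocalQuadric a u₂ ∧ 0 < ε * γ t 2} with hKdef
  have hcl : IsClosed K := by
    have h1 : IsClosed {t | t ∈ Icc 0 ℓ ∧ 0 ≤ ε * γ t 2} :=
      (continuousOn_const.mul (h.continuousOn_coord 2)).preimage_isClosed_of_isClosed isClosed_Icc
        isClosed_Ici
    convert! (h.isClosed_contact u₂).inter h1 using 1
    ext t
    constructor
    · rintro ⟨ht, hc, hp⟩; exact ⟨⟨ht, hc⟩, ht, hp.le⟩
    · rintro ⟨⟨ht, hc⟩, -, hp⟩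
      exact ⟨ht, hc, lt_of_le_of_ne hp
        (mul_ne_zero hε (ha.coord_two_ne_zero hc (h.outside t ht).2)).symm⟩
  have hcomp : IsCompact K := isCompact_Icc.of_isClosed_subset hcl fun t ht => ht.1
  have := eq_Icc_of_connected_compact hK hcomp
  refine ⟨sInf K, sSup K, ?_, this⟩
  obtain ⟨x, hx⟩ := hK.nonempty
  rw [this] at hx
  exact hx.1.trans hx.2

/-- A line that touches a quadric at two points lies on the quadric. Hence the thread cannot run
freely between two separate contacts with the hyperboloid. -/
theorem exists_contact_between (h : IsEquilibrium a u₂ u₃ ℓ γ v p q) {s t : ℝ} (hs : s ∈ Icc 0 ℓ)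
    (ht : t ∈ Icc 0 ℓ) (hst : s < t) (hcs : γ s ∈ confocalQuadric a u₂)
    (hct : γ t ∈ confocalQuadric a u₂) (hoff : ∀ r ∈ Ioo s t, γ r ∉ confocalQuadric a u₂) :
    ∃ r ∈ Ioo s t, γ r ∈ confocalQuadric a u₃ := by
  by_contra! hno
  have hline := h.isRectilinear hs ht (.of_forall hoff) (.of_forall hno)
  have hp : ∀ r ∈ Icc s t, confocalForm a u₂ (γ r) (γ r) = confocalForm a u₂ (γ s) (γ s)
      + 2 * (r - s) * confocalForm a u₂ (γ s) (v s)
      + (r - s) ^ 2 * confocalForm a u₂ (v s) (v s) := fun r hr => by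
    rw [(hline r hr).2]
    simp only [confocalForm, Fin.sum_univ_three, PiLp.add_apply, PiLp.smul_apply, smul_eq_mul]
    ring
  have e1 : confocalForm a u₂ (γ s) (γ s) = 1 := hcs
  have e2 : confocalForm a u₂ (γ t) (γ t) = 1 := hct
  have e3 := h.form_eq_zero_left hs hcs
  have e4 := hp t ⟨hst.le, le_rfl⟩
  rw [e1, e2, e3] at e4
  have e5 : confocalForm a u₂ (v s) (v s) = 0 := by
    have : (t - s) ^ 2 * confocalForm a u₂ (v s) (v s) = 0 := by linarith
    exact (mul_eq_zero.1 this).resolve_left (pow_ne_zero 2 (sub_pos.2 hst).ne')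
  refine hoff ((s + t) / 2) ⟨by linarith, by linarith⟩ ?_
  have e6 := hp ((s + t) / 2) ⟨by linarith, by linarith⟩
  rw [e1, e3, e5, mul_zero, mul_zero, add_zero, add_zero] at e6
  exact e6

end IsEquilibrium

/-- The times of contact of a stretched thread with the two quadrics: `[A, B]` and `[C, D]` are the
contacts with the two visible parts of the hyperboloid, where the sign `ε` tells which part is
touched first, and `[s, t]` is the contact with the ellipsoid. -/
structure ContactTimes (a : Fin 3 → ℝ) (u₂ u₃ ℓ : ℝ) (γ : ℝ → E3) (ε A B C D s t : ℝ) : Prop where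
  sign : ε = 1 ∨ ε = -1
  zero_lt_A : 0 < A
  A_le_B : A ≤ B
  B_lt_C : B < C
  C_le_D : C ≤ D
  D_lt : D < ℓ
  zero_lt_s : 0 < s
  s_le_t : s ≤ t
  t_lt : t < ℓ
  B_lt_t : B < t
  s_lt_C : s < C
  contact_left : ∀ r ∈ Icc 0 ℓ, γ r ∈ confocalQuadric a u₂ ↔ r ∈ Icc A B ∪ Icc C D
  contact_right : ∀ r ∈ Icc 0 ℓ, γ r ∈ confocalQuadric a u₃ ↔ r ∈ Icc s t
  pos_AB : ∀ r ∈ Icc A B, 0 < ε * γ r 2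
  neg_CD : ∀ r ∈ Icc C D, ε * γ r 2 < 0

/-- The contact with the ellipsoid is an interval, since the third elliptic coordinate has no
critical points off the ellipsoid. -/
theorem IsEllipticMotion.exists_contact_right {ℓ : ℝ} {γ v : ℝ → E3} {U V W : ℝ → ℝ}
    (h : IsEllipticMotion a u₂ u₃ ℓ γ v U V W) {e : ℝ} (he : e ∈ Icc 0 ℓ)
    (hc : γ e ∈ confocalQuadric a u₃) : ∃ s t, s ≤ t ∧ s ∈ Icc 0 ℓ ∧ t ∈ Icc 0 ℓ ∧
      ∀ r ∈ Icc 0 ℓ, γ r ∈ confocalQuadric a u₃ ↔ r ∈ Icc s t := by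
  obtain ⟨h1, h2, h3, h4⟩ := id h.order
  set K := {r | r ∈ Icc 0 ℓ ∧ W r = u₃} with hK
  have hcl : IsClosed K :=
    h.continuousOn_W.preimage_isClosed_of_isClosed isClosed_Icc (isClosed_singleton (x := u₃))
  have hcomp : IsCompact K := isCompact_Icc.of_isClosed_subset hcl fun t ht => ht.1
  have heK : e ∈ K := ⟨he, (h.mem_quadric_right he).1 hc⟩
  have hcrit : ∀ r ∈ Ioo 0 ℓ, ellipticVel a (γ r) (v r) (W r) (U r) (V r) = 0 → W r = u₃ := by
    intro r hr h0
    have hr' := Ioo_subset_Icc_self hr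
    have e1 := h.vel_W_sq hr'
    have hW := h.le_W r hr'
    have nU := h.sub_UW_pos hr'
    have nV := h.sub_VW_pos hr'
    rw [h0, eq_comm, div_eq_iff (pow_ne_zero 2 (mul_ne_zero (by linarith) (by linarith)))] at e1
    by_contra hne
    have n3 : W r - u₃ ≠ 0 := sub_ne_zero.2 hne
    have n2 : W r - u₂ ≠ 0 := by intro h; linarith
    have m0 : a 0 - W r ≠ 0 := by intro h; linarith
    have m1 : a 1 - W r ≠ 0 := by intro h; linarith
    have m2 : a 2 - W r ≠ 0 := by intro h; linarith
    have : 4 * ((W r - u₂) * (W r - u₃) * ((a 0 - W r) * (a 1 - W r) * (a 2 - W r))) ≠ 0 :=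
      mul_ne_zero four_ne_zero (mul_ne_zero (mul_ne_zero n2 n3) (mul_ne_zero (mul_ne_zero m0 m1) m2))
    exact this (by rw [e1]; ring)
  have hmin := hcomp.sInf_mem ⟨e, heK⟩
  have hmax := hcomp.sSup_mem ⟨e, heK⟩
  refine ⟨sInf K, sSup K, (csInf_le hcomp.bddBelow heK).trans (le_csSup hcomp.bddAbove heK),
    hmin.1, hmax.1, fun r hr => ?_⟩
  rw [h.mem_quadric_right hr]
  refine ⟨fun hW => ⟨csInf_le hcomp.bddBelow ⟨hr, hW⟩, le_csSup hcomp.bddAbove ⟨hr, hW⟩⟩,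
    fun hI => ?_⟩
  by_contra hne
  -- On the component of `{W < u₃}` around `r`, Rolle's theorem gives a critical point.
  set L := K ∩ Iic r
  set R := K ∩ Ici r
  have hL : IsCompact L := hcomp.inter_right isClosed_Iic
  have hR : IsCompact R := hcomp.inter_right isClosed_Ici
  have hLm := hL.sSup_mem ⟨sInf K, hmin, hI.1⟩
  have hRm := hR.sInf_mem ⟨sSup K, hmax, hI.2⟩
  have hlr : sSup L < r := lt_of_le_of_ne hLm.2 fun h => hne (h ▸ hLm.1.2)
  have hrr : r < sInf R := lt_of_le_of_ne hRm.2 fun h => hne (h ▸ hRm.1.2)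
  obtain ⟨x, hx, hx0⟩ := exists_hasDerivAt_eq_zero (hlr.trans hrr)
    (h.continuousOn_W.mono (Icc_subset_Icc hLm.1.1.1 hRm.1.1.2)) (hLm.1.2.trans hRm.1.2.symm)
    (fun x hx => h.hasDerivAt_W ⟨hLm.1.1.1.trans_lt hx.1, hx.2.trans_le hRm.1.1.2⟩)
  have hxI : x ∈ Ioo 0 ℓ := ⟨hLm.1.1.1.trans_lt hx.1, hx.2.trans_le hRm.1.1.2⟩
  have hxK : x ∈ K := ⟨Ioo_subset_Icc_self hxI, hcrit x hxI hx0⟩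
  rcases le_total x r with hxr | hxr
  · exact absurd (le_csSup hL.bddAbove ⟨hxK, hxr⟩) hx.1.not_ge
  · exact absurd (csInf_le hR.bddBelow ⟨hxK, hxr⟩) hx.2.not_ge

theorem IsEquilibrium.exists_contactTimes {ℓ : ℝ} {γ v : ℝ → E3} {p q : ℝ → ℝ}
    (h : IsEquilibrium a u₂ u₃ ℓ γ v p q) (ha : ConfocalOrder a u₂ u₃)
    (hup : IsConnected {t | t ∈ Icc 0 ℓ ∧ γ t ∈ confocalQuadric a u₂ ∧ 0 < γ t 2})
    (hlow : IsConnected {t | t ∈ Icc 0 ℓ ∧ γ t ∈ confocalQuadric a u₂ ∧ γ t 2 < 0}) :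
    ∃ U V W, IsEllipticMotion a u₂ u₃ ℓ γ v U V W ∧
      ∃ ε A B C D s t, ContactTimes a u₂ u₃ ℓ γ ε A B C D s t := by
  -- the contacts with the hyperboloid, in their temporal order
  obtain ⟨ε, A, B, C, D, hε, hAB, hCD, hBC, hK₁, hK₂⟩ : ∃ ε A B C D : ℝ, (ε = 1 ∨ ε = -1) ∧ A ≤ B ∧
      C ≤ D ∧ B < C ∧
      {t | t ∈ Icc 0 ℓ ∧ γ t ∈ confocalQuadric a u₂ ∧ 0 < ε * γ t 2} = Icc A B ∧
      {t | t ∈ Icc 0 ℓ ∧ γ t ∈ confocalQuadric a u₂ ∧ 0 < -ε * γ t 2} = Icc C D := by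
    obtain ⟨A, B, hAB, hK₁⟩ := h.exists_contact_eq_Icc ha one_ne_zero (by simpa only [one_mul] using hup)
    obtain ⟨C, D, hCD, hK₂⟩ := h.exists_contact_eq_Icc ha (neg_ne_zero.2 one_ne_zero)
      (by simpa only [neg_mul, one_mul, neg_pos] using hlow)
    have hdis : ∀ r, r ∈ Icc A B → r ∉ Icc C D := fun r h1 h2 => by
      rw [← hK₁] at h1
      rw [← hK₂] at h2
      have := h1.2.2; have := h2.2.2; linarith
    rcases lt_or_ge B C with hBC | hCB
    · exact ⟨1, A, B, C, D, .inl rfl, hAB, hCD, hBC, hK₁, hK₂⟩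
    · refine ⟨-1, C, D, A, B, .inr rfl, hCD, hAB, ?_, hK₂, by rwa [neg_neg]⟩
      by_contra! hle
      exact hdis (max A C) ⟨le_max_left _ _, max_le hAB hCB⟩ ⟨le_max_right _ _, max_le hle hCD⟩
  have hon₁ : ∀ r ∈ Icc A B, r ∈ Icc 0 ℓ ∧ γ r ∈ confocalQuadric a u₂ ∧ 0 < ε * γ r 2 :=
    fun r hr => by rwa [← hK₁] at hr
  have hon₂ : ∀ r ∈ Icc C D, r ∈ Icc 0 ℓ ∧ γ r ∈ confocalQuadric a u₂ ∧ 0 < -ε * γ r 2 :=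
    fun r hr => by rwa [← hK₂] at hr
  have hA := hon₁ A ⟨le_rfl, hAB⟩
  have hB := hon₁ B ⟨hAB, le_rfl⟩
  have hC := hon₂ C ⟨le_rfl, hCD⟩
  have hD := hon₂ D ⟨hCD, le_rfl⟩
  have hε0 : ε ≠ 0 := by rcases hε with rfl | rfl <;> norm_num
  have hiff : ∀ r ∈ Icc 0 ℓ, γ r ∈ confocalQuadric a u₂ ↔ r ∈ Icc A B ∪ Icc C D := fun r hr => by
    refine ⟨fun hc => ?_, ?_⟩
    · rcases lt_or_gt_of_ne (mul_ne_zero hε0 (ha.coord_two_ne_zero hc (h.outside r hr).2)) with hs | hs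
      · right; rw [← hK₂]; exact ⟨hr, hc, by linarith⟩
      · left; rw [← hK₁]; exact ⟨hr, hc, hs⟩
    · rintro (hI | hI)
      · exact (hon₁ r hI).2.1
      · exact (hon₂ r hI).2.1
  obtain ⟨e, he, hce⟩ := h.exists_contact_between hB.1 hC.1 hBC hB.2.1 hC.2.1 fun r hr hc => by
    rcases (hiff r ⟨hB.1.1.trans hr.1.le, hr.2.le.trans hC.1.2⟩).1 hc with hI | hI
    · exact hr.1.not_ge hI.2
    · exact hr.2.not_ge hI.1
  have heI : e ∈ Icc 0 ℓ := ⟨hB.1.1.trans he.1.le, he.2.le.trans hC.1.2⟩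
  obtain ⟨U, V, W, hm⟩ := h.exists_isEllipticMotion ha ⟨A, hA.1, hA.2.1⟩ ⟨e, heI, hce⟩
  obtain ⟨s, t, hst, hs, ht, hE⟩ := hm.exists_contact_right heI hce
  have hest := (hE e heI).1 hce
  exact ⟨U, V, W, hm, ε, A, B, C, D, s, t, hε, (h.mem_Ioo_of_contact_left hA.1 hA.2.1).1, hAB, hBC,
    hCD, (h.mem_Ioo_of_contact_left hD.1 hD.2.1).2,
    (h.mem_Ioo_of_contact_right hs ((hE s hs).2 ⟨le_rfl, hst⟩)).1, hst,
    (h.mem_Ioo_of_contact_right ht ((hE t ht).2 ⟨hst, le_rfl⟩)).2, he.1.trans_le hest.2,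
    hest.1.trans_lt he.2, hiff, hE, fun r hr => (hon₁ r hr).2.2,
    fun r hr => by linarith [(hon₂ r hr).2.2]⟩
end

section
variable {a : Fin 3 → ℝ} {u₂ u₃ : ℝ}

/-! ### The arcs of the thread -/

/-- On `[s, t]` the curve `γ` is composed of arcs of the given kinds, some of which may degenerate
to points. -/
def ConsistsWeaklyOf (a : Fin 3 → ℝ) (u₂ u₃ : ℝ) (γ : ℝ → E3) : List ArcKind → ℝ → ℝ → Prop
  | [], s, t => s = t
  | k :: ks, s, t => ∃ r, s ≤ r ∧ (s < r → IsArc a u₂ u₃ γ k s r) ∧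
      ConsistsWeaklyOf a u₂ u₃ γ ks r t

theorem ConsistsWeaklyOf.exists_sublist {γ : ℝ → E3} {tail : List ArcKind} {z : ℝ} :
    ∀ {ks : List ArcKind} {s t : ℝ}, ConsistsWeaklyOf a u₂ u₃ γ ks s t →
      ConsistsOf a u₂ u₃ γ tail t z →
      ∃ mid : List ArcKind, mid.Sublist ks ∧ ConsistsOf a u₂ u₃ γ (mid ++ tail) s z
  | [], s, t, h, ht => ⟨[], List.Sublist.refl _, by cases (show s = t from h); exact ht⟩
  | k :: ks, s, t, ⟨r, hsr, harc, h⟩, ht => by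
    obtain ⟨mid, hmid, hc⟩ := h.exists_sublist ht
    rcases hsr.eq_or_lt with rfl | hlt
    · exact ⟨mid, hmid.cons k, hc⟩
    · exact ⟨k :: mid, hmid.cons_cons k, r, hlt, harc hlt, hc⟩

variable {ℓ : ℝ} {γ v : ℝ → E3} {p q : ℝ → ℝ} {ε A B C D s t : ℝ}

namespace ContactTimes

/-- The arcs between the first and the last contact with the ellipsoid. -/
theorem consistsWeaklyOf_right (hT : ContactTimes a u₂ u₃ ℓ γ ε A B C D s t)
    (h : IsEquilibrium a u₂ u₃ ℓ γ v p q) (ha : ConfocalOrder a u₂ u₃) {ks : List ArcKind} {z : ℝ}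
    (hks : ConsistsWeaklyOf a u₂ u₃ γ ks t z) :
    ConsistsWeaklyOf a u₂ u₃ γ (.ellipsoidGeodesic :: .lineOfCurvature :: .ellipsoidGeodesic ::
      .lineOfCurvature :: .ellipsoidGeodesic :: ks) s z := by
  obtain ⟨-, hA, hAB, hBC, hCD, hD, hs, hst, ht, hBt, hsC, hc₂, hc₃, -, -⟩ := hT
  have I : ∀ {r}, s ≤ r → r ≤ t → r ∈ Icc 0 ℓ := fun h1 h2 => ⟨hs.le.trans h1, h2.trans ht.le⟩
  have hE : ∀ {x y}, s ≤ x → y ≤ t → ∀ r ∈ Icc x y, γ r ∈ confocalQuadric a u₃ :=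
    fun h1 h2 r hr => (hc₃ r (I (h1.trans hr.1) (hr.2.trans h2))).2 ⟨h1.trans hr.1, hr.2.trans h2⟩
  have hgeo : ∀ {x y}, s ≤ x → x ≤ y → y ≤ t → (∀ r ∈ Ioo x y, r ∉ Icc A B ∪ Icc C D) →
      IsGeodesicOn a u₃ γ x y := fun {x y} h1 h12 h2 h3 =>
    h.isGeodesicOn_right ha (I h1 (h12.trans h2)) (I (h1.trans h12) h2) (hE h1 h2) fun r hr hc =>
      h3 r hr ((hc₂ r (I (h1.trans hr.1.le) (hr.2.le.trans h2))).1 hc)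
  refine ⟨max A s, le_max_right _ _, fun hlt => ?_, max B s, max_le_max_right s hAB, fun hlt => ?_,
    min C t, le_min (max_le hBC.le hsC.le) (max_le hBt.le hst), fun hlt => ?_,
    min D t, min_le_min_right t hCD, fun hlt => ?_, t, min_le_right _ _, fun hlt => ?_, hks⟩
  · refine hgeo le_rfl hlt.le (max_le (hAB.trans hBt.le) hst) ?_
    rintro r hr (hI | hI)
    · rcases lt_max_iff.1 hr.2 with h1 | h1
      · exact h1.not_ge hI.1
      · exact hr.1.not_gt h1
    · rcases lt_max_iff.1 hr.2 with h1 | h1 <;> linarith [hr.1, hI.1]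
  · intro r hr
    have hrB : r ≤ B := by
      rcases le_max_iff.1 hr.2 with h1 | h1
      · exact h1
      · rcases lt_max_iff.1 hlt with h2 | h2
        · exact (h1.trans (le_max_right _ _)).trans h2.le
        · exact absurd h2 (le_max_right _ _).not_gt
    have hI : r ∈ Icc 0 ℓ := I ((le_max_right _ _).trans hr.1) (hrB.trans hBt.le)
    exact ⟨(hc₂ r hI).2 (.inl ⟨(le_max_left _ _).trans hr.1, hrB⟩),
      (hc₃ r hI).2 ⟨(le_max_right _ _).trans hr.1, hrB.trans hBt.le⟩⟩
  · refine hgeo (le_max_right _ _) hlt.le (min_le_right _ _) ?_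
    rintro r hr (hI | hI)
    · exact ((le_max_left _ _).trans_lt hr.1).not_ge hI.2
    · exact (hr.2.trans_le (min_le_left _ _)).not_ge hI.1
  · intro r hr
    have hrC : C ≤ r := by
      rcases min_le_iff.1 hr.1 with h1 | h1
      · exact h1
      · rcases min_lt_iff.1 hlt with h2 | h2
        · exact h2.le.trans ((min_le_right _ _).trans h1)
        · exact absurd h2 (min_le_right _ _).not_gt
    have hI : r ∈ Icc 0 ℓ := I (hsC.le.trans hrC) (hr.2.trans (min_le_right _ _))
    exact ⟨(hc₂ r hI).2 (.inr ⟨hrC, hr.2.trans (min_le_left _ _)⟩),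
      (hc₃ r hI).2 ⟨hsC.le.trans hrC, hr.2.trans (min_le_right _ _)⟩⟩
  · refine hgeo (le_min (hsC.le.trans hCD) hst) hlt.le le_rfl ?_
    rintro r hr (hI | hI)
    · rcases min_lt_iff.1 hr.1 with h1 | h1 <;> linarith [hr.2, hI.2]
    · rcases min_lt_iff.1 hr.1 with h1 | h1
      · exact h1.not_ge hI.2
      · exact hr.2.not_gt h1

theorem isRectilinear (hT : ContactTimes a u₂ u₃ ℓ γ ε A B C D s t)
    (h : IsEquilibrium a u₂ u₃ ℓ γ v p q) {x y : ℝ} (hx : 0 ≤ x) (hxy : x ≤ y) (hy : y ≤ ℓ)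
    (h₂ : ∀ᵐ r, r ∈ Ioo x y → r ∉ Icc A B ∪ Icc C D) (h₃ : ∀ r ∈ Ioo x y, r ∉ Icc s t) :
    IsRectilinear γ x y := by
  have I : ∀ {r}, r ∈ Ioo x y → r ∈ Icc 0 ℓ := fun hr =>
    ⟨hx.trans hr.1.le, hr.2.le.trans hy⟩
  refine ⟨v x, fun r hr => (h.isRectilinear ⟨hx, hxy.trans hy⟩ ⟨hx.trans hxy, hy⟩ ?_
    (.of_forall fun r hr hc => h₃ r hr ((hT.contact_right r (I hr)).1 hc)) r hr).2⟩
  filter_upwards [h₂] with r hr hrI hc using hr hrI ((hT.contact_left r (I hrI)).1 hc)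

theorem exists_arcs (hT : ContactTimes a u₂ u₃ ℓ γ ε A B C D s t)
    (h : IsEquilibrium a u₂ u₃ ℓ γ v p q) (ha : ConfocalOrder a u₂ u₃) :
    ∃ mid : List ArcKind,
      mid.Sublist [.hyperboloidGeodesic, .rectilinear, .ellipsoidGeodesic, .lineOfCurvature,
        .ellipsoidGeodesic, .lineOfCurvature, .ellipsoidGeodesic, .rectilinear,
        .hyperboloidGeodesic] ∧
      ConsistsOf a u₂ u₃ γ (.rectilinear :: (mid ++ [.rectilinear])) 0 ℓ := by
  have hT' := hT
  obtain ⟨-, hA, hAB, hBC, hCD, hD, hs, hst, ht, hBt, hsC, hc₂, hc₃, -, -⟩ := hT'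
  have hgeo : ∀ {x y}, 0 ≤ x → x ≤ y → y ≤ ℓ → (∀ r ∈ Icc x y, r ∈ Icc A B ∪ Icc C D) →
      (∀ r ∈ Ioo x y, r ∉ Icc s t) → IsGeodesicOn a u₂ γ x y := fun {x y} h1 h12 h2 h3 h4 =>
    h.isGeodesicOn_left ha ⟨h1, h12.trans h2⟩ ⟨h1.trans h12, h2⟩
      (fun r hr => (hc₂ r ⟨h1.trans hr.1, hr.2.trans h2⟩).2 (h3 r hr))
      fun r hr hc => h4 r hr ((hc₃ r ⟨h1.trans hr.1.le, hr.2.le.trans h2⟩).1 hc)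
  have hlast : ConsistsOf a u₂ u₃ γ [.rectilinear] (max D t) ℓ := by
    refine ⟨ℓ, max_lt hD ht, ?_, rfl⟩
    refine hT.isRectilinear h (hs.le.trans (hst.trans (le_max_right _ _))) (max_lt hD ht).le le_rfl
      (.of_forall ?_) fun r hr hI => ((le_max_right _ _).trans_lt hr.1).not_ge hI.2
    rintro r hr (hI | hI)
    · have := (le_max_left _ _).trans_lt hr.1; linarith [hI.2]
    · exact ((le_max_left _ _).trans_lt hr.1).not_ge hI.2
  have htail : ConsistsWeaklyOf a u₂ u₃ γ [.rectilinear, .hyperboloidGeodesic] t (max D t) := by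
    refine ⟨max C t, le_max_right _ _, fun hlt => ?_, max D t, max_le_max_right t hCD, fun hlt => ?_,
      rfl⟩
    · refine hT.isRectilinear h (hs.le.trans hst) hlt.le (max_le (hCD.trans hD.le) ht.le)
        (.of_forall ?_) fun r hr hI => hr.1.not_ge hI.2
      rintro r hr (hI | hI)
      · linarith [hr.1, hI.2]
      · rcases lt_max_iff.1 hr.2 with h1 | h1
        · exact h1.not_ge hI.1
        · exact hr.1.not_gt h1
    · refine hgeo (hs.le.trans (hst.trans (le_max_right _ _))) hlt.le (max_lt hD ht).le (fun r hr => ?_)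
        fun r hr hI => ((le_max_right _ _).trans_lt hr.1).not_ge hI.2
      refine .inr ⟨(le_max_left _ _).trans hr.1, ?_⟩
      rcases le_max_iff.1 hr.2 with h1 | h1
      · exact h1
      · rcases lt_max_iff.1 hlt with h2 | h2
        · exact (h1.trans (le_max_right _ _)).trans h2.le
        · exact absurd h2 (le_max_right _ _).not_gt
  have hmid := hT.consistsWeaklyOf_right h ha htail
  have hhead : ConsistsWeaklyOf a u₂ u₃ γ [.hyperboloidGeodesic, .rectilinear, .ellipsoidGeodesic,
      .lineOfCurvature, .ellipsoidGeodesic, .lineOfCurvature, .ellipsoidGeodesic, .rectilinear,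
      .hyperboloidGeodesic] (min A s) (max D t) := by
    refine ⟨min B s, min_le_min_right s hAB, fun hlt => ?_, s, min_le_right _ _, fun hlt => ?_, hmid⟩
    · refine hgeo (le_min hA.le hs.le) hlt.le ((min_le_right _ _).trans (hst.trans ht.le))
        (fun r hr => ?_) fun r hr hI => (hr.2.trans_le (min_le_right _ _)).not_ge hI.1
      refine .inl ⟨?_, hr.2.trans (min_le_left _ _)⟩
      rcases min_le_iff.1 hr.1 with h1 | h1
      · exact h1
      · rcases min_lt_iff.1 hlt with h2 | h2
        · exact h2.le.trans ((min_le_right _ _).trans h1)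
        · exact absurd h2 (min_le_right _ _).not_gt
    · refine hT.isRectilinear h (le_min (hA.le.trans hAB) hs.le) hlt.le (hst.trans ht.le)
        (.of_forall ?_) fun r hr hI => hr.2.not_ge hI.1
      rintro r hr (hI | hI)
      · rcases min_lt_iff.1 hr.1 with h1 | h1
        · exact h1.not_ge hI.2
        · exact hr.2.not_gt h1
      · linarith [hr.2, hI.1]
  obtain ⟨mid, hsub, hc⟩ := hhead.exists_sublist hlast
  refine ⟨mid, hsub, min A s, lt_min hA hs, ?_, hc⟩
  refine hT.isRectilinear h le_rfl (le_min hA.le hs.le) ((min_le_right _ _).trans (hst.trans ht.le))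
    (.of_forall ?_) fun r hr hI => (hr.2.trans_le (min_le_right _ _)).not_ge hI.1
  rintro r hr (hI | hI)
  · exact (hr.2.trans_le (min_le_left _ _)).not_ge hI.1
  · linarith [hr.2.trans_le (min_le_left _ _), hI.1]

/-- If the thread has no arcs on the hyperboloid off the ellipsoid, then before and after the
ellipsoid it touches the hyperboloid at isolated points only, and these exert no force. -/
theorem exists_arcs_of_no_hyperboloid_arc (hT : ContactTimes a u₂ u₃ ℓ γ ε A B C D s t)
    (h : IsEquilibrium a u₂ u₃ ℓ γ v p q) (ha : ConfocalOrder a u₂ u₃)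
    (hno : ∀ s t, 0 ≤ s → s < t → t ≤ ℓ →
      ∃ r ∈ Icc s t, ¬ (γ r ∈ confocalQuadric a u₂ ∧ γ r ∉ confocalQuadric a u₃)) :
    ∃ mid : List ArcKind,
      mid.Sublist [.ellipsoidGeodesic, .lineOfCurvature, .ellipsoidGeodesic, .lineOfCurvature,
        .ellipsoidGeodesic] ∧
      ConsistsOf a u₂ u₃ γ (.rectilinear :: (mid ++ [.rectilinear])) 0 ℓ := by
  have hT' := hT
  obtain ⟨-, hA, hAB, hBC, hCD, hD, hs, hst, ht, hBt, hsC, hc₂, hc₃, -, -⟩ := hT'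
  have hnull : ∀ {x y}, 0 ≤ x → y ≤ ℓ → (∀ r ∈ Icc x y, r ∈ Icc A B ∪ Icc C D) →
      (∀ r ∈ Icc x y, r ∉ Icc s t) → ¬ x < y := fun {x y} h1 h2 h3 h4 hlt => by
    obtain ⟨r, hr, hr'⟩ := hno x y h1 hlt h2
    have hI : r ∈ Icc 0 ℓ := ⟨h1.trans hr.1, hr.2.trans h2⟩
    exact hr' ⟨(hc₂ r hI).2 (h3 r hr), fun hc => h4 r hr ((hc₃ r hI).1 hc)⟩
  have hAs : A < s → A = B := fun hlt => by
    by_contra hne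
    have hlt' := lt_of_le_of_ne hAB hne
    refine hnull (x := A) (y := min B ((A + s) / 2)) hA.le ((min_le_left _ _).trans (by linarith))
      (fun r hr => .inl ⟨hr.1, hr.2.trans (min_le_left _ _)⟩)
      (fun r hr hI => ?_) (lt_min hlt' (by linarith))
    linarith [hr.2.trans (min_le_right _ _), hI.1]
  have hDt : t < D → C = D := fun hlt => by
    by_contra hne
    have hlt' := lt_of_le_of_ne hCD hne
    refine hnull (x := max C ((D + t) / 2)) (y := D) (le_max_of_le_left (by linarith)) hD.le
      (fun r hr => .inr ⟨(le_max_left _ _).trans hr.1, hr.2⟩)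
      (fun r hr hI => ?_) (max_lt hlt' (by linarith))
    linarith [(le_max_right _ _).trans hr.1, hI.2]
  have hlast : ConsistsOf a u₂ u₃ γ [.rectilinear] t ℓ := by
    refine ⟨ℓ, ht, ?_, rfl⟩
    refine hT.isRectilinear h (hs.le.trans hst) ht.le le_rfl ?_ fun r hr hI => hr.1.not_ge hI.2
    have hne : ∀ᵐ x : ℝ, x ≠ D := by simp [MeasureTheory.ae_iff]
    filter_upwards [hne] with r hrD hr
    rintro (hI | hI)
    · linarith [hr.1, hI.2]
    · have := hDt (hr.1.trans_le hI.2)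
      exact hrD (le_antisymm hI.2 (this ▸ hI.1))
  obtain ⟨mid, hsub, hc⟩ := (hT.consistsWeaklyOf_right h ha (ks := []) rfl).exists_sublist hlast
  refine ⟨mid, hsub, s, hs, ?_, hc⟩
  refine hT.isRectilinear h le_rfl hs.le (hst.trans ht.le) ?_ fun r hr hI => hr.2.not_ge hI.1
  have hne : ∀ᵐ x : ℝ, x ≠ A := by simp [MeasureTheory.ae_iff]
  filter_upwards [hne] with r hrA hr
  rintro (hI | hI)
  · have := hAs (hI.1.trans_lt hr.2)
    exact hrA (le_antisymm (this ▸ hI.2) hI.1)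
  · linarith [hr.2, hI.1]

end ContactTimes
end

section

/-! ### Phases -/

/-- Change of variables along a phase `f` without critical points. -/
theorem integral_eq_integral_of_phase {x y : ℝ} (hxy : x ≤ y) {f f' h w : ℝ → ℝ}
    (hf : ContinuousOn f (Icc x y)) (hd : ∀ t ∈ Ioo x y, HasDerivAt f (f' t) t)
    (hne : ∀ t ∈ Ioo x y, f' t ≠ 0) (hle : f x ≤ f y) (hh : ContinuousOn h (Icc (f x) (f y)))
    (hw : ContinuousOn w (Icc x y)) (hwe : ∀ t ∈ Ioo x y, w t = |f' t| * h (f t)) :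
    ∫ t in x..y, w t = ∫ u in (f x)..(f y), h u := by
  rcases hxy.eq_or_lt with rfl | hlt
  · simp
  have hpos : ∀ t ∈ Ioo x y, 0 < f' t := by
    rcases hasDerivWithinAt_forall_lt_or_forall_gt_of_forall_ne (convex_Ioo x y)
      (fun t ht => (hd t ht).hasDerivWithinAt) hne with hneg | hpos
    · have := strictAntiOn_of_deriv_neg (convex_Icc x y) hf fun t ht => by
        rw [interior_Icc] at ht; rw [(hd t ht).deriv]; exact hneg t ht
      exact absurd (this ⟨le_rfl, hxy⟩ ⟨hxy, le_rfl⟩ hlt) hle.not_gt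
    · exact hpos
  have hmono : MonotoneOn f (Icc x y) := (strictMonoOn_of_deriv_pos (convex_Icc x y) hf fun t ht => by
    rw [interior_Icc] at ht; rw [(hd t ht).deriv]; exact hpos t ht).monotoneOn
  have hmaps : ∀ t ∈ Icc x y, f t ∈ Icc (f x) (f y) := fun t ht =>
    ⟨hmono ⟨le_rfl, hxy⟩ ht ht.1, hmono ht ⟨hxy, le_rfl⟩ ht.2⟩
  have hwe' : ∀ t ∈ Ioo x y, w t = (h ∘ f) t * f' t := fun t ht => by
    rw [hwe t ht, abs_of_pos (hpos t ht), mul_comm]; rfl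
  rw [← intervalIntegral.integral_comp_mul_deriv''' (a := x) (b := y) (f := f) (f' := f') (g := h)]
  · refine intervalIntegral.integral_congr_ae ?_
    have hne : ∀ᵐ t : ℝ, t ≠ y := by simp [MeasureTheory.ae_iff]
    filter_upwards [hne] with t hty ht
    rw [uIoc_of_le hxy] at ht
    exact hwe' t ⟨ht.1, lt_of_le_of_ne ht.2 hty⟩
  · rwa [uIcc_of_le hxy]
  · rw [min_eq_left hxy, max_eq_right hxy]
    exact fun t ht => (hd t ht).hasDerivWithinAt
  · rw [min_eq_left hxy, max_eq_right hxy]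
    exact hh.mono (by rintro _ ⟨t, ht, rfl⟩; exact hmaps t (Ioo_subset_Icc_self ht))
  · refine hh.integrableOn_Icc.mono_set ?_
    rw [uIcc_of_le hxy]
    rintro _ ⟨t, ht, rfl⟩; exact hmaps t ht
  · rw [uIcc_of_le hxy, integrableOn_Icc_iff_integrableOn_Ioo]
    refine (hw.integrableOn_Icc.mono_set Ioo_subset_Icc_self).congr_fun hwe' measurableSet_Ioo

/-- If `x² = y k` with `k > 0`, then `x / √k` is a square root of `y` which changes sign where `x`
does, and is differentiable. If `ẏ² = 4 y R`, the square of its derivative is `R`, also at the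
transversal zeros of `x`, by continuity. -/
theorem exists_hasDerivAt_signed_sqrt {ℓ : ℝ} {x k y x' k' y' R : ℝ → ℝ}
    (hx : ContinuousOn x (Icc 0 ℓ)) (hk : ContinuousOn k (Icc 0 ℓ)) (hkpos : ∀ t ∈ Icc 0 ℓ, 0 < k t)
    (hx' : ContinuousOn x' (Icc 0 ℓ)) (hk' : ContinuousOn k' (Icc 0 ℓ)) (hR : ContinuousOn R (Icc 0 ℓ))
    (dx : ∀ t ∈ Ioo 0 ℓ, HasDerivAt x (x' t) t) (dk : ∀ t ∈ Ioo 0 ℓ, HasDerivAt k (k' t) t)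
    (dy : ∀ t ∈ Ioo 0 ℓ, HasDerivAt y (y' t) t) (hsq : ∀ t ∈ Icc 0 ℓ, x t ^ 2 = y t * k t)
    (hy : ∀ t ∈ Ioo 0 ℓ, y' t ^ 2 = 4 * y t * R t) (hne : ∀ t ∈ Ioo 0 ℓ, x t = 0 → x' t ≠ 0) :
    ContinuousOn (fun t => x t / √(k t)) (Icc 0 ℓ) ∧
    (∀ t ∈ Icc 0 ℓ, (x t / √(k t)) ^ 2 = y t) ∧
    ∃ c' : ℝ → ℝ, ContinuousOn c' (Ioo 0 ℓ) ∧
      ∀ t ∈ Ioo 0 ℓ, HasDerivAt (fun t => x t / √(k t)) (c' t) t ∧ c' t ^ 2 = R t := by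
  have hs : ∀ t ∈ Icc 0 ℓ, √(k t) ≠ 0 := fun t ht => (Real.sqrt_pos.2 (hkpos t ht)).ne'
  have hc : ContinuousOn (fun t => x t / √(k t)) (Icc 0 ℓ) := hx.div hk.sqrt hs
  have hc2 : ∀ t ∈ Icc 0 ℓ, (x t / √(k t)) ^ 2 = y t := fun t ht => by
    rw [div_pow, Real.sq_sqrt (hkpos t ht).le, hsq t ht, mul_div_cancel_right₀ _ (hkpos t ht).ne']
  set c' : ℝ → ℝ := fun t => (x' t * √(k t) - x t * (k' t / (2 * √(k t)))) / √(k t) ^ 2 with hc'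
  have hcc : ContinuousOn c' (Icc 0 ℓ) :=
    ((hx'.mul hk.sqrt).sub (hx.mul (hk'.div (continuousOn_const.mul hk.sqrt)
      fun t ht => mul_ne_zero two_ne_zero (hs t ht)))).div (hk.sqrt.pow 2)
      fun t ht => pow_ne_zero 2 (hs t ht)
  have dc : ∀ t ∈ Ioo 0 ℓ, HasDerivAt (fun t => x t / √(k t)) (c' t) t := fun t ht =>
    (dx t ht).div ((dk t ht).sqrt (hkpos t (Ioo_subset_Icc_self ht)).ne')
      (hs t (Ioo_subset_Icc_self ht))
  have key : ∀ t ∈ Ioo 0 ℓ, x t ≠ 0 → c' t ^ 2 = R t := fun t ht hxt => by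
    have ht' := Ioo_subset_Icc_self ht
    have h1 : HasDerivAt y (2 * (x t / √(k t)) * c' t) t := by
      have := (dc t ht).pow 2
      simp only [Nat.cast_ofNat, Nat.add_one_sub_one, pow_one] at this
      refine this.congr_of_eventuallyEq ?_
      filter_upwards [Icc_mem_nhds ht.1 ht.2] with r hr using (hc2 r hr).symm
    have h2 := hy t ht
    rw [(dy t ht).unique h1, mul_pow, mul_pow, hc2 t ht'] at h2
    have hy0 : y t ≠ 0 := by
      rw [← hc2 t ht']; exact pow_ne_zero 2 (div_ne_zero hxt (hs t ht'))
    refine mul_left_cancel₀ (mul_ne_zero (four_ne_zero (α := ℝ)) hy0) ?_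
    linear_combination h2
  refine ⟨hc, hc2, c', hcc.mono Ioo_subset_Icc_self, fun t ht => ⟨dc t ht, ?_⟩⟩
  by_cases hxt : x t = 0
  · have hI := Icc_mem_nhds ht.1 ht.2
    have h1 : Filter.Tendsto (fun r => c' r ^ 2) (nhdsWithin t {t}ᶜ) (nhds (c' t ^ 2)) :=
      ((hcc.continuousAt hI).pow 2).tendsto.mono_left nhdsWithin_le_nhds
    have h2 : Filter.Tendsto R (nhdsWithin t {t}ᶜ) (nhds (R t)) :=
      (hR.continuousAt hI).tendsto.mono_left nhdsWithin_le_nhds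
    refine tendsto_nhds_unique (h1.congr' ?_) h2
    filter_upwards [(dx t ht).eventually_ne (c := 0) (hne t ht hxt),
      nhdsWithin_le_nhds (Ioo_mem_nhds ht.1 ht.2)] with r hr1 hr2 using key r hr2 hr1
  · exact key t ht hxt

/-- A curve on the unit circle whose angular velocity does not vanish has a continuous angle. -/
theorem exists_angle {ℓ : ℝ} (hℓ : 0 < ℓ) {c s c' s' R : ℝ → ℝ} (hc : ContinuousOn c (Icc 0 ℓ))
    (hs : ContinuousOn s (Icc 0 ℓ)) (hcs : ∀ t ∈ Icc 0 ℓ, c t ^ 2 + s t ^ 2 = 1)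
    (hR : ContinuousOn R (Icc 0 ℓ)) (hRpos : ∀ t ∈ Icc 0 ℓ, 0 < R t)
    (hc' : ContinuousOn c' (Ioo 0 ℓ)) (hs' : ContinuousOn s' (Ioo 0 ℓ))
    (dc : ∀ t ∈ Ioo 0 ℓ, HasDerivAt c (c' t) t) (ds : ∀ t ∈ Ioo 0 ℓ, HasDerivAt s (s' t) t)
    (hsum : ∀ t ∈ Ioo 0 ℓ, c' t ^ 2 + s' t ^ 2 = R t) :
    ∃ φ φ' : ℝ → ℝ, Continuous φ ∧
      (∀ t ∈ Icc 0 ℓ, Real.cos (φ t) = c t ∧ Real.sin (φ t) = s t) ∧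
      ∀ t ∈ Ioo 0 ℓ, HasDerivAt φ (φ' t) t ∧ φ' t ^ 2 = R t := by
  set ω : ℝ → ℝ := fun t => c t * s' t - s t * c' t with hω
  have horth : ∀ t ∈ Ioo 0 ℓ, c t * c' t + s t * s' t = 0 := fun t ht => by
    have h1 := ((dc t ht).pow 2).add ((ds t ht).pow 2)
    have h2 := h1.unique ((hasDerivAt_const t (1 : ℝ)).congr_of_eventuallyEq (by
      filter_upwards [Icc_mem_nhds ht.1 ht.2] with r hr using hcs r hr))
    simp only [Nat.cast_ofNat, Nat.add_one_sub_one, pow_one] at h2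
    linarith
  have hω2 : ∀ t ∈ Ioo 0 ℓ, ω t ^ 2 = R t := fun t ht => by
    have h1 := hcs t (Ioo_subset_Icc_self ht)
    have h2 := horth t ht
    have h3 := hsum t ht
    simp only [hω]
    linear_combination h3 + (c' t ^ 2 + s' t ^ 2) * h1 - (c t * c' t + s t * s' t) * h2
  obtain ⟨σ, hσ2, hσ⟩ : ∃ σ : ℝ, σ ^ 2 = 1 ∧ ∀ t ∈ Ioo 0 ℓ, ω t = σ * √(R t) := by
    have hωc : ContinuousOn ω (Ioo 0 ℓ) :=
      ((hc.mono Ioo_subset_Icc_self).mul hs').sub ((hs.mono Ioo_subset_Icc_self).mul hc')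
    rcases isPreconnected_Ioo.eq_or_eq_neg_of_sq_eq hωc (hR.mono Ioo_subset_Icc_self).sqrt
      (fun t ht => by
        simp only [Pi.pow_apply]
        rw [hω2 t ht, Real.sq_sqrt (hRpos t (Ioo_subset_Icc_self ht)).le])
      (fun ht => (Real.sqrt_pos.2 (hRpos _ (Ioo_subset_Icc_self ht))).ne') with h | h
    · exact ⟨1, by norm_num, fun t ht => by rw [h ht, one_mul]⟩
    · exact ⟨-1, by norm_num, fun t ht => by rw [h ht]; simp⟩
  set G : ℝ → ℝ := IccExtend hℓ.le ((Icc 0 ℓ).domRestrict fun t => √(R t)) with hG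
  have hGc : Continuous G := hR.sqrt.domRestrict.Icc_extend'
  have hGe : ∀ t ∈ Icc 0 ℓ, G t = √(R t) := fun t ht => by
    rw [hG, IccExtend_of_mem _ _ ht]; rfl
  obtain ⟨φ₀, h0c, h0s⟩ : ∃ φ₀, Real.cos φ₀ = c 0 ∧ Real.sin φ₀ = s 0 := by
    have h1 := hcs 0 ⟨le_rfl, hℓ.le⟩
    have hn : ‖(⟨c 0, s 0⟩ : ℂ)‖ = 1 := by
      rw [← sq_eq_sq₀ (norm_nonneg _) zero_le_one, Complex.sq_norm, Complex.normSq_mk]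
      linarith
    refine ⟨Complex.arg ⟨c 0, s 0⟩, ?_, ?_⟩
    · rw [Complex.cos_arg (by rw [← norm_ne_zero_iff, hn]; exact one_ne_zero), hn, div_one]
    · rw [Complex.sin_arg, hn, div_one]
  set φ : ℝ → ℝ := fun t => φ₀ + σ * ∫ r in (0 : ℝ)..t, G r with hφ
  have dφ : ∀ t, HasDerivAt φ (σ * G t) t := fun t =>
    ((hGc.integral_hasStrictDerivAt 0 t).hasDerivAt.const_mul σ).const_add φ₀
  have hφc : Continuous φ := continuous_iff_continuousAt.2 fun t => (dφ t).continuousAt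
  have hφ0 : φ 0 = φ₀ := by simp [hφ]
  refine ⟨φ, fun t => σ * G t, hφc, fun t ht => ?_, fun t ht => ⟨dφ t, ?_⟩⟩
  · -- the scalar product of `(c, s)` and `(cos φ, sin φ)` is constant
    have he : c t * Real.cos (φ t) + s t * Real.sin (φ t) = 1 := by
      have h0 : c 0 * Real.cos (φ 0) + s 0 * Real.sin (φ 0) = 1 := by
        rw [hφ0, h0c, h0s]; linarith [hcs 0 ⟨le_rfl, hℓ.le⟩]
      rcases ht.1.eq_or_lt with rfl | hlt
      · exact h0
      obtain ⟨r, hr, hr0⟩ := exists_hasDerivAt_eq_slope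
        (fun t => c t * Real.cos (φ t) + s t * Real.sin (φ t)) (fun _ => 0) hlt
        ((((hc.mul (Real.continuous_cos.comp hφc).continuousOn).add
          (hs.mul (Real.continuous_sin.comp hφc).continuousOn))).mono (Icc_subset_Icc_right ht.2))
        (fun r hr => by
          have hrI : r ∈ Ioo 0 ℓ := ⟨hr.1, hr.2.trans_le ht.2⟩
          have hrI' := Ioo_subset_Icc_self hrI
          have h1 := ((dc r hrI).mul (dφ r).cos).add ((ds r hrI).mul (dφ r).sin)
          convert! h1 using 1
          have h2 : σ * G r = c r * s' r - s r * c' r := by rw [hGe r hrI', ← hσ r hrI]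
          have h3 := horth r hrI
          have h4 := hcs r hrI'
          rw [h2]
          linear_combination (-(c' r) * Real.cos (φ r) - s' r * Real.sin (φ r)) * (-h4)
            + (-(c r) * Real.cos (φ r) - s r * Real.sin (φ r)) * h3)
      rw [eq_comm, div_eq_zero_iff] at hr0
      have := hr0.resolve_right (by linarith)
      linarith
    have h1 := hcs t ht
    have h2 := Real.cos_sq_add_sin_sq (φ t)
    have h3 : (Real.cos (φ t) - c t) ^ 2 + (Real.sin (φ t) - s t) ^ 2 = 0 := by
      linear_combination h1 + h2 - 2 * he
    constructor
    · have : (Real.cos (φ t) - c t) ^ 2 = 0 := by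
        linarith [sq_nonneg (Real.sin (φ t) - s t), sq_nonneg (Real.cos (φ t) - c t)]
      exact sub_eq_zero.1 (pow_eq_zero_iff two_ne_zero |>.1 this)
    · have : (Real.sin (φ t) - s t) ^ 2 = 0 := by
        linarith [sq_nonneg (Real.sin (φ t) - s t), sq_nonneg (Real.cos (φ t) - c t)]
      exact sub_eq_zero.1 (pow_eq_zero_iff two_ne_zero |>.1 this)
  · have ht' := Ioo_subset_Icc_self ht
    rw [mul_pow, hσ2, one_mul, hGe t ht', Real.sq_sqrt (hRpos t ht').le]

/-- Two closed angle functions that differ by less than a right angle modulo full turns wind equally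
often. -/
theorem abs_sub_eq_two_pi_of_cos_pos {ℓ : ℝ} (hℓ : 0 < ℓ) {φ θ : ℝ → ℝ}
    (hφ : ContinuousOn φ (Icc 0 ℓ)) (hθ : ContinuousOn θ (Icc 0 ℓ))
    (hpos : ∀ t ∈ Icc 0 ℓ, 0 < Real.cos (φ t - θ t)) (hc : Real.cos (φ ℓ) = Real.cos (φ 0))
    (hs : Real.sin (φ ℓ) = Real.sin (φ 0)) (hw : |θ ℓ - θ 0| = 2 * Real.pi) :
    |φ ℓ - φ 0| = 2 * Real.pi := by
  have h0 : (0 : ℝ) ∈ Icc 0 ℓ := ⟨le_rfl, hℓ.le⟩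
  have h1 : ℓ ∈ Icc 0 ℓ := ⟨hℓ.le, le_rfl⟩
  have hcont : ContinuousOn (fun t => φ t - θ t) (Icc 0 ℓ) := hφ.sub hθ
  have hlt : |(φ ℓ - θ ℓ) - (φ 0 - θ 0)| < Real.pi := by
    by_contra! hge
    have hpi := Real.pi_pos
    have hc0 := hpos 0 h0
    rcases le_abs.1 hge with h | h
    · obtain ⟨t, ht, e⟩ := intermediate_value_Icc hℓ.le hcont
        (show (φ 0 - θ 0) + Real.pi ∈ Icc _ _ from ⟨by linarith, by linarith⟩)
      have := hpos t ht
      simp only at e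
      rw [e, Real.cos_add_pi] at this
      linarith
    · obtain ⟨t, ht, e⟩ := intermediate_value_Icc' hℓ.le hcont
        (show (φ 0 - θ 0) - Real.pi ∈ Icc _ _ from ⟨by linarith, by linarith⟩)
      have := hpos t ht
      simp only at e
      rw [e, Real.cos_sub_pi] at this
      linarith
  obtain ⟨n, hn⟩ := (Real.cos_eq_one_iff (φ ℓ - φ 0)).1 (by
    rw [Real.cos_sub, hc, hs]; linarith [Real.cos_sq_add_sin_sq (φ 0)])
  have hpi := Real.pi_pos
  rw [abs_lt] at hlt
  rcases abs_eq (by positivity) |>.1 hw with h | h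
  · have h3 : (n : ℝ) < 2 := by by_contra! hh; nlinarith
    have h4 : (0 : ℝ) < n := by by_contra! hh; nlinarith
    have h5 : n < 2 := by exact_mod_cast h3
    have h6 : 0 < n := by exact_mod_cast h4
    have : n = 1 := by omega
    rw [← hn, this, Int.cast_one, one_mul, abs_of_pos (by positivity)]
  · have h3 : (-2 : ℝ) < n := by by_contra! hh; nlinarith
    have h4 : (n : ℝ) < 0 := by by_contra! hh; nlinarith
    have h5 : -2 < n := by exact_mod_cast h3
    have h6 : n < 0 := by exact_mod_cast h4
    have : n = -1 := by omega
    rw [← hn, this, Int.cast_neg, Int.cast_one, neg_one_mul, abs_neg, abs_of_pos (by positivity)]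
end

section
variable {a : Fin 3 → ℝ} {u₂ u₃ : ℝ}

/-! ### The hyperelliptic integrals -/

theorem lengthIntegrand_sq {u : ℝ} (h : 0 ≤ (u - u₂) * (u - u₃) * ∏ j, (a j - u)) :
    lengthIntegrand a u₂ u₃ u ^ 2 = (u - u₂) * (u - u₃) / ∏ j, (a j - u) := by
  rw [lengthIntegrand, div_pow, Real.sq_sqrt h]
  rcases eq_or_ne ((u - u₂) * (u - u₃)) 0 with h0 | h0
  · simp [h0]
  · rw [pow_two, mul_div_mul_left _ _ h0]

/-- Substitution in an integral whose integrand may be unbounded at both ends, provided that it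
becomes continuous by the substitution. -/
theorem intervalIntegrable_and_integral_of_substitution {b : ℝ} (hb : 0 < b) {f f' g k : ℝ → ℝ}
    (hf : ContinuousOn f (Icc 0 b)) (hd : ∀ x ∈ Ioo 0 b, HasDerivAt f (f' x) x)
    (hpos : ∀ x ∈ Ioo 0 b, 0 < f' x) (hk : ContinuousOn k (Icc 0 b))
    (hgk : ∀ x ∈ Ioo 0 b, f' x * g (f x) = k x) :
    IntervalIntegrable g MeasureTheory.volume (f 0) (f b) ∧
      ∫ u in (f 0)..(f b), g u = ∫ x in (0 : ℝ)..b, k x := by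
  have hmono : StrictMonoOn f (Icc 0 b) := strictMonoOn_of_deriv_pos (convex_Icc 0 b) hf fun t ht => by
    rw [interior_Icc] at ht; rw [(hd t ht).deriv]; exact hpos t ht
  have h0 : (0 : ℝ) ∈ Icc 0 b := ⟨le_rfl, hb.le⟩
  have h1 : b ∈ Icc 0 b := ⟨hb.le, le_rfl⟩
  have hle : f 0 ≤ f b := hmono.monotoneOn h0 h1 hb.le
  have himg : f '' Ioo 0 b = Ioo (f 0) (f b) := by
    refine subset_antisymm ?_ (intermediate_value_Ioo hb.le hf)
    rintro _ ⟨x, hx, rfl⟩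
    exact ⟨hmono h0 (Ioo_subset_Icc_self hx) hx.1, hmono (Ioo_subset_Icc_self hx) h1 hx.2⟩
  have hinj : InjOn f (Ioo 0 b) := hmono.injOn.mono Ioo_subset_Icc_self
  have hd' : ∀ x ∈ Ioo 0 b, HasDerivWithinAt f (f' x) (Ioo 0 b) x :=
    fun x hx => (hd x hx).hasDerivWithinAt
  have hgk' : ∀ x ∈ Ioo 0 b, |f' x| • g (f x) = k x := fun x hx => by
    rw [abs_of_pos (hpos x hx), smul_eq_mul, hgk x hx]
  constructor
  · rw [intervalIntegrable_iff_integrableOn_Ioo_of_le hle, ← himg,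
      MeasureTheory.integrableOn_image_iff_integrableOn_abs_deriv_smul measurableSet_Ioo hd' hinj]
    exact (hk.integrableOn_Icc.mono_set Ioo_subset_Icc_self).congr_fun
      (fun x hx => (hgk' x hx).symm) measurableSet_Ioo
  · rw [intervalIntegral.integral_of_le hle, MeasureTheory.integral_Ioc_eq_integral_Ioo, ← himg,
      MeasureTheory.integral_image_eq_integral_abs_deriv_smul measurableSet_Ioo hd' hinj,
      intervalIntegral.integral_of_le hb.le, MeasureTheory.integral_Ioc_eq_integral_Ioo]
    exact MeasureTheory.setIntegral_congr_fun measurableSet_Ioo hgk'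

/-- The contribution to the length of the first elliptic coordinate `a₁ + (a₀ - a₁) sin² φ`, as a
density with respect to the phase `φ`. -/
noncomputable def firstDensity (a : Fin 3 → ℝ) (u₂ u₃ φ : ℝ) : ℝ :=
  √((a 1 + (a 0 - a 1) * Real.sin φ ^ 2 - u₂) * (a 1 + (a 0 - a 1) * Real.sin φ ^ 2 - u₃)
    / (a 1 + (a 0 - a 1) * Real.sin φ ^ 2 - a 2))

/-- The contribution to the length of the second elliptic coordinate `a₂ + (u₂ - a₂) s²`, as a
density with respect to the phase `s`. -/
noncomputable def secondDensity (a : Fin 3 → ℝ) (u₂ u₃ s : ℝ) : ℝ :=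
  √((u₂ - a 2) ^ 2 * (1 - s ^ 2) * (a 2 + (u₂ - a 2) * s ^ 2 - u₃)
    / ((a 0 - (a 2 + (u₂ - a 2) * s ^ 2)) * (a 1 - (a 2 + (u₂ - a 2) * s ^ 2))))

theorem firstDensity_nonneg (φ : ℝ) : 0 ≤ firstDensity a u₂ u₃ φ :=
  Real.sqrt_nonneg _

theorem secondDensity_nonneg (s : ℝ) : 0 ≤ secondDensity a u₂ u₃ s :=
  Real.sqrt_nonneg _

theorem firstDensity_sq (ha : ConfocalOrder a u₂ u₃) (φ : ℝ) :
    firstDensity a u₂ u₃ φ ^ 2 =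
      (a 1 + (a 0 - a 1) * Real.sin φ ^ 2 - u₂) * (a 1 + (a 0 - a 1) * Real.sin φ ^ 2 - u₃)
        / (a 1 + (a 0 - a 1) * Real.sin φ ^ 2 - a 2) := by
  obtain ⟨h1, h2, h3, h4⟩ := ha
  have h : 0 ≤ (a 0 - a 1) * Real.sin φ ^ 2 := mul_nonneg (by linarith) (sq_nonneg _)
  exact Real.sq_sqrt (div_nonneg (mul_nonneg (by linarith) (by linarith)) (by linarith))

theorem continuous_firstDensity (ha : ConfocalOrder a u₂ u₃) :
    Continuous (firstDensity a u₂ u₃) := by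
  obtain ⟨h1, h2, h3, h4⟩ := ha
  unfold firstDensity
  refine Continuous.sqrt (Continuous.div (by fun_prop) (by fun_prop) fun φ => ?_)
  have h : 0 ≤ (a 0 - a 1) * Real.sin φ ^ 2 := mul_nonneg (by linarith) (sq_nonneg _)
  exact ne_of_gt (by linarith)

theorem ConfocalOrder.second_bounds (ha : ConfocalOrder a u₂ u₃) {s : ℝ} (hs : s ∈ Icc (-1) 1) :
    0 ≤ 1 - s ^ 2 ∧ 0 < a 2 + (u₂ - a 2) * s ^ 2 - u₃ ∧ 0 < a 0 - (a 2 + (u₂ - a 2) * s ^ 2) ∧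
      0 < a 1 - (a 2 + (u₂ - a 2) * s ^ 2) := by
  obtain ⟨h1, h2, h3, h4⟩ := ha
  have hs2 : s ^ 2 ≤ 1 := by nlinarith [hs.1, hs.2]
  have h : 0 ≤ (u₂ - a 2) * s ^ 2 := mul_nonneg (by linarith) (sq_nonneg _)
  have h' : (u₂ - a 2) * s ^ 2 ≤ u₂ - a 2 := by nlinarith
  exact ⟨by linarith, by linarith, by linarith, by linarith⟩

theorem secondDensity_sq (ha : ConfocalOrder a u₂ u₃) {s : ℝ} (hs : s ∈ Icc (-1) 1) :
    secondDensity a u₂ u₃ s ^ 2 =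
      (u₂ - a 2) ^ 2 * (1 - s ^ 2) * (a 2 + (u₂ - a 2) * s ^ 2 - u₃)
        / ((a 0 - (a 2 + (u₂ - a 2) * s ^ 2)) * (a 1 - (a 2 + (u₂ - a 2) * s ^ 2))) := by
  obtain ⟨k1, k2, k3, k4⟩ := ha.second_bounds hs
  exact Real.sq_sqrt (by positivity)

theorem continuousOn_secondDensity (ha : ConfocalOrder a u₂ u₃) :
    ContinuousOn (secondDensity a u₂ u₃) (Icc (-1) 1) := by
  unfold secondDensity
  refine ContinuousOn.sqrt (ContinuousOn.div (by fun_prop) (by fun_prop) fun s hs => ?_)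
  obtain ⟨k1, k2, k3, k4⟩ := ha.second_bounds hs
  positivity

theorem integral_lengthIntegrand_first (ha : ConfocalOrder a u₂ u₃) :
    IntervalIntegrable (lengthIntegrand a u₂ u₃) MeasureTheory.volume (a 1) (a 0) ∧
      ∫ u in (a 1)..(a 0), lengthIntegrand a u₂ u₃ u
        = 2 * ∫ φ in (0 : ℝ)..(Real.pi / 2), firstDensity a u₂ u₃ φ := by
  obtain ⟨h1, h2, h3, h4⟩ := id ha
  have key := intervalIntegrable_and_integral_of_substitution
    (f := fun φ => a 1 + (a 0 - a 1) * Real.sin φ ^ 2)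
    (f' := fun φ => (a 0 - a 1) * (2 * Real.sin φ * Real.cos φ))
    (g := lengthIntegrand a u₂ u₃) (k := fun φ => 2 * firstDensity a u₂ u₃ φ)
    (half_pos Real.pi_pos) (by fun_prop) (fun φ _ => by
      have := (((Real.hasDerivAt_sin φ).pow 2).const_mul (a 0 - a 1)).const_add (a 1)
      simpa using this) (fun φ hφ => ?_)
    ((continuous_const.mul (continuous_firstDensity ha)).continuousOn) fun φ hφ => ?_
  · simpa using key
  · have := Real.sin_pos_of_pos_of_lt_pi hφ.1 (by linarith [hφ.2, Real.pi_pos])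
    have := Real.cos_pos_of_mem_Ioo ⟨by linarith [hφ.1, Real.pi_pos], hφ.2⟩
    have := sub_pos.2 h1
    positivity
  · have hs := Real.sin_pos_of_pos_of_lt_pi hφ.1 (by linarith [hφ.2, Real.pi_pos])
    have hc := Real.cos_pos_of_mem_Ioo ⟨by linarith [hφ.1, Real.pi_pos], hφ.2⟩
    have h10 := sub_pos.2 h1
    have hsc := Real.sin_sq_add_cos_sq φ
    have hsq := firstDensity_sq ha φ
    set σ := Real.sin φ
    set U := a 1 + (a 0 - a 1) * σ ^ 2 with hU
    have hU1 : 0 ≤ (a 0 - a 1) * σ ^ 2 := by positivity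
    have n2 : 0 < U - u₂ := by linarith
    have n3 : 0 < U - u₃ := by linarith
    have na : 0 < U - a 2 := by linarith
    have hprod : ∏ j, (a j - U) = ((a 0 - a 1) * σ * Real.cos φ) ^ 2 * (U - a 2) := by
      rw [Fin.prod_univ_three]
      have e0 : a 0 - U = (a 0 - a 1) * Real.cos φ ^ 2 := by
        rw [hU]; linear_combination (a 1 - a 0) * hsc
      have e1 : a 1 - U = -((a 0 - a 1) * σ ^ 2) := by rw [hU]; ring
      rw [e0, e1]; ring
    have hnn : 0 ≤ (U - u₂) * (U - u₃) * ∏ j, (a j - U) := by rw [hprod]; positivity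
    have hL := lengthIntegrand_sq (a := a) hnn
    have hL0 : 0 ≤ lengthIntegrand a u₂ u₃ U := by unfold lengthIntegrand; positivity
    rw [← sq_eq_sq₀ (mul_nonneg (by positivity) hL0)
      (mul_nonneg zero_le_two (firstDensity_nonneg φ)), mul_pow, hL, mul_pow 2, hsq, hprod]
    field_simp

theorem integral_lengthIntegrand_second (ha : ConfocalOrder a u₂ u₃) :
    IntervalIntegrable (lengthIntegrand a u₂ u₃) MeasureTheory.volume (a 2) u₂ ∧
      ∫ u in (a 2)..u₂, lengthIntegrand a u₂ u₃ u
        = -(2 * ∫ s in (0 : ℝ)..1, secondDensity a u₂ u₃ s) := by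
  obtain ⟨h1, h2, h3, h4⟩ := id ha
  have h23 := sub_pos.2 h3
  have hsub : Icc (0 : ℝ) 1 ⊆ Icc (-1) 1 := Icc_subset_Icc_left (by norm_num)
  have key := intervalIntegrable_and_integral_of_substitution
    (f := fun s => a 2 + (u₂ - a 2) * s ^ 2) (f' := fun s => (u₂ - a 2) * (2 * s))
    (g := lengthIntegrand a u₂ u₃) (k := fun s => -(2 * secondDensity a u₂ u₃ s))
    one_pos (by fun_prop) (fun s _ => by
      have := (((hasDerivAt_id s).pow 2).const_mul (u₂ - a 2)).const_add (a 2)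
      simpa using this) (fun s hs => by have := hs.1; positivity)
    ((continuousOn_const.mul ((continuousOn_secondDensity ha).mono hsub)).neg) fun s hs => ?_
  · simpa using key
  · obtain ⟨k1, k2, k3, k4⟩ := ha.second_bounds (hsub (Ioo_subset_Icc_self hs))
    have hs0 := hs.1
    have k5 : 0 < 1 - s ^ 2 := by nlinarith [hs.1, hs.2]
    have hsq := secondDensity_sq ha (hsub (Ioo_subset_Icc_self hs))
    set V := a 2 + (u₂ - a 2) * s ^ 2 with hV
    have n2 : V - u₂ = -((u₂ - a 2) * (1 - s ^ 2)) := by rw [hV]; ring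
    have hprod : ∏ j, (a j - V) = -((a 0 - V) * (a 1 - V) * ((u₂ - a 2) * s ^ 2)) := by
      rw [Fin.prod_univ_three]
      have e2 : a 2 - V = -((u₂ - a 2) * s ^ 2) := by rw [hV]; ring
      rw [e2]; ring
    have hnn : 0 ≤ (V - u₂) * (V - u₃) * ∏ j, (a j - V) := by
      rw [hprod, n2, neg_mul, neg_mul_neg]; positivity
    have hL := lengthIntegrand_sq (a := a) hnn
    have hL0 : 0 ≤ -lengthIntegrand a u₂ u₃ V := by
      have : -lengthIntegrand a u₂ u₃ V = (u₂ - a 2) * (1 - s ^ 2) * (V - u₃) /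
        √((V - u₂) * (V - u₃) * ∏ j, (a j - V)) := by rw [lengthIntegrand, n2]; ring
      rw [this]; positivity
    have : (u₂ - a 2) * (2 * s) * -lengthIntegrand a u₂ u₃ V = 2 * secondDensity a u₂ u₃ s := by
      rw [← sq_eq_sq₀ (mul_nonneg (by positivity) hL0)
        (mul_nonneg zero_le_two (secondDensity_nonneg s)), mul_pow, neg_sq, hL, mul_pow 2, hsq, hprod, n2]
      field_simp
    linarith

theorem lengthIntegrand_eq_sqrt (ha : ConfocalOrder a u₂ u₃) {u : ℝ} (hu : u ≤ u₃) :
    lengthIntegrand a u₂ u₃ u = √((u₂ - u) * (u₃ - u) / ((a 0 - u) * (a 1 - u) * (a 2 - u))) := by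
  obtain ⟨h1, h2, h3, h4⟩ := id ha
  have p2 : 0 ≤ u₂ - u := by linarith
  have p3 : 0 ≤ u₃ - u := by linarith
  have q0 : 0 < a 0 - u := by linarith
  have q1 : 0 < a 1 - u := by linarith
  have q2 : 0 < a 2 - u := by linarith
  have e : (u - u₂) * (u - u₃) = (u₂ - u) * (u₃ - u) := by ring
  have hnn : 0 ≤ (u - u₂) * (u - u₃) * ∏ j, (a j - u) := by
    rw [e, Fin.prod_univ_three]; positivity
  have hL0 : 0 ≤ lengthIntegrand a u₂ u₃ u := by unfold lengthIntegrand; rw [e]; positivity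
  rw [← Real.sqrt_sq hL0, lengthIntegrand_sq hnn, Fin.prod_univ_three, e]

theorem continuousOn_lengthIntegrand (ha : ConfocalOrder a u₂ u₃) :
    ContinuousOn (lengthIntegrand a u₂ u₃) (Iic u₃) := by
  obtain ⟨h1, h2, h3, h4⟩ := id ha
  refine ContinuousOn.congr ?_ fun _ => lengthIntegrand_eq_sqrt ha
  refine ContinuousOn.sqrt (ContinuousOn.div (by fun_prop) (by fun_prop) fun u hu => ?_)
  have hu : u ≤ u₃ := hu
  exact mul_ne_zero (mul_ne_zero (by intro h; linarith) (by intro h; linarith))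
    (by intro h; linarith)

theorem intervalIntegrable_lengthIntegrand (ha : ConfocalOrder a u₂ u₃) {w z : ℝ} (hw : w ≤ u₃)
    (hz : z ≤ u₃) : IntervalIntegrable (lengthIntegrand a u₂ u₃) MeasureTheory.volume w z :=
  ((continuousOn_lengthIntegrand ha).mono fun _ hu =>
    hu.2.trans (max_le hw hz)).intervalIntegrable

/-- The length of the thread increases with the distance of the pen, so that it determines the confocal
ellipsoid on which the pen is situated. -/
theorem threadLength_injOn (ha : ConfocalOrder a u₂ u₃) :
    InjOn (threadLength a u₂ u₃) (Iio u₃) := by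
  obtain ⟨h1, h2, h3, h4⟩ := id ha
  refine StrictAntiOn.injOn fun w hw z hz hwz => ?_
  have hw : w < u₃ := hw
  have hz : z < u₃ := hz
  have hsplit := intervalIntegral.integral_add_adjacent_intervals
    (intervalIntegrable_lengthIntegrand ha hw.le hz.le)
    (intervalIntegrable_lengthIntegrand ha hz.le le_rfl)
  have hpos : 0 < ∫ u in w..z, lengthIntegrand a u₂ u₃ u := by
    refine intervalIntegral.intervalIntegral_pos_of_pos_on
      (intervalIntegrable_lengthIntegrand ha hw.le hz.le) (fun u hu => ?_) hwz
    have hu3 : u < u₃ := hu.2.trans hz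
    rw [lengthIntegrand_eq_sqrt ha hu3.le]
    have p2 : 0 < u₂ - u := by linarith
    have p3 : 0 < u₃ - u := by linarith
    have q0 : 0 < a 0 - u := by linarith
    have q1 : 0 < a 1 - u := by linarith
    have q2 : 0 < a 2 - u := by linarith
    exact Real.sqrt_pos.2 (by positivity)
  simp only [threadLength]
  linarith

/-- Over one full turn the first density contributes four times its integral over a quadrant. -/
theorem integral_firstDensity_turn (ha : ConfocalOrder a u₂ u₃) (x : ℝ) :
    ∫ φ in x..(x + 2 * Real.pi), firstDensity a u₂ u₃ φ
      = 4 * ∫ φ in (0 : ℝ)..(Real.pi / 2), firstDensity a u₂ u₃ φ := by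
  have hint : ∀ x y, IntervalIntegrable (firstDensity a u₂ u₃) MeasureTheory.volume x y :=
    fun x y => (continuous_firstDensity ha).intervalIntegrable x y
  have hper : Function.Periodic (firstDensity a u₂ u₃) Real.pi := fun φ => by
    simp only [firstDensity, Real.sin_add_pi, neg_sq]
  have hrefl : ∀ φ, firstDensity a u₂ u₃ (Real.pi - φ) = firstDensity a u₂ u₃ φ := fun φ => by
    simp only [firstDensity, Real.sin_pi_sub]
  have hhalf : ∀ y, ∫ φ in y..(y + Real.pi), firstDensity a u₂ u₃ φ
      = 2 * ∫ φ in (0 : ℝ)..(Real.pi / 2), firstDensity a u₂ u₃ φ := fun y => by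
    rw [hper.intervalIntegral_add_eq y 0, zero_add, ← intervalIntegral.integral_add_adjacent_intervals
      (hint 0 (Real.pi / 2)) (hint (Real.pi / 2) Real.pi)]
    have := intervalIntegral.integral_comp_sub_left (firstDensity a u₂ u₃) Real.pi
      (a := 0) (b := Real.pi / 2)
    simp only [hrefl, sub_zero] at this
    rw [show Real.pi - Real.pi / 2 = Real.pi / 2 by ring] at this
    rw [← this]; ring
  rw [← intervalIntegral.integral_add_adjacent_intervals (hint x (x + Real.pi)) (hint _ _), hhalf,
    show x + 2 * Real.pi = x + Real.pi + Real.pi by ring, hhalf]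
  ring
end

section
variable {a : Fin 3 → ℝ} {u₂ u₃ : ℝ}

/-! ### The length of the thread -/

namespace IsEllipticMotion

variable {ℓ : ℝ} {γ v : ℝ → E3} {U V W : ℝ → ℝ}

theorem eq_of_closed (h : IsEllipticMotion a u₂ u₃ ℓ γ v U V W) (hcl : γ ℓ = γ 0) :
    V ℓ = V 0 ∧ W ℓ = W 0 := by
  obtain ⟨h1, h2, h3, h4⟩ := id h.order
  have h0 : (0 : ℝ) ∈ Icc 0 ℓ := ⟨le_rfl, h.length_pos.le⟩
  have hℓ : ℓ ∈ Icc 0 ℓ := ⟨h.length_pos.le, le_rfl⟩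
  have f0 := h.factor 0 h0
  have fℓ := h.factor ℓ hℓ
  rw [hcl] at fℓ
  have eV := (f0 (V ℓ)).symm.trans (fℓ (V ℓ))
  have eW := (f0 (W ℓ)).symm.trans (fℓ (W ℓ))
  have d1 := h.V_lt_U h0 hℓ
  have d2 := h.W_lt_V hℓ h0
  have d3 := h.W_lt_U h0 hℓ
  have d4 := h.W_lt_V h0 hℓ
  rw [sub_self, mul_zero, zero_mul] at eV
  rw [sub_self, mul_zero] at eW
  constructor
  · have := (mul_eq_zero.1 eV).resolve_right (by intro h; linarith)
    have := (mul_eq_zero.1 this).resolve_left (by intro h; linarith)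
    linarith
  · have := (mul_eq_zero.1 eW).resolve_left
      (mul_ne_zero (by intro h; linarith) (by intro h; linarith))
    linarith

/-- The shares of the three elliptic coordinates in the element of length. -/
theorem sum_shares (h : IsEllipticMotion a u₂ u₃ ℓ γ v U V W) {t : ℝ} (ht : t ∈ Icc 0 ℓ) :
    (U t - u₂) * (U t - u₃) / ((U t - V t) * (U t - W t))
      + (u₂ - V t) * (V t - u₃) / ((U t - V t) * (V t - W t))
      + (u₂ - W t) * (u₃ - W t) / ((U t - W t) * (V t - W t)) = 1 := by
  have n1 := (h.sub_UV_pos ht).ne'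
  have n2 := (h.sub_UW_pos ht).ne'
  have n3 := (h.sub_VW_pos ht).ne'
  field_simp
  ring

theorem continuousOn_velV (h : IsEllipticMotion a u₂ u₃ ℓ γ v U V W) :
    ContinuousOn (fun t => ellipticVel a (γ t) (v t) (V t) (U t) (W t)) (Icc 0 ℓ) :=
  h.continuousOn_ellipticVel h.continuousOn_V h.continuousOn_U h.continuousOn_W
    (fun _ ht => by have := h.sub_UV_pos ht; intro h; linarith)
    (fun _ ht => (h.sub_VW_pos ht).ne')

theorem continuousOn_velU (h : IsEllipticMotion a u₂ u₃ ℓ γ v U V W) :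
    ContinuousOn (fun t => ellipticVel a (γ t) (v t) (U t) (V t) (W t)) (Icc 0 ℓ) :=
  h.continuousOn_ellipticVel h.continuousOn_U h.continuousOn_V h.continuousOn_W
    (fun _ ht => (h.sub_UV_pos ht).ne') (fun _ ht => (h.sub_UW_pos ht).ne')

theorem continuousOn_velW (h : IsEllipticMotion a u₂ u₃ ℓ γ v U V W) :
    ContinuousOn (fun t => ellipticVel a (γ t) (v t) (W t) (U t) (V t)) (Icc 0 ℓ) :=
  h.continuousOn_ellipticVel h.continuousOn_W h.continuousOn_U h.continuousOn_V
    (fun _ ht => by have := h.sub_UW_pos ht; intro h; linarith)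
    (fun _ ht => by have := h.sub_VW_pos ht; intro h; linarith)

theorem continuousOn_share_U (h : IsEllipticMotion a u₂ u₃ ℓ γ v U V W) :
    ContinuousOn (fun t => (U t - u₂) * (U t - u₃) / ((U t - V t) * (U t - W t))) (Icc 0 ℓ) := by
  have hU := h.continuousOn_U
  have hV := h.continuousOn_V
  have hW := h.continuousOn_W
  exact ContinuousOn.div (by fun_prop) (by fun_prop) fun t ht =>
    (mul_pos (h.sub_UV_pos ht) (h.sub_UW_pos ht)).ne'

theorem continuousOn_share_V (h : IsEllipticMotion a u₂ u₃ ℓ γ v U V W) :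
    ContinuousOn (fun t => (u₂ - V t) * (V t - u₃) / ((U t - V t) * (V t - W t))) (Icc 0 ℓ) := by
  have hU := h.continuousOn_U
  have hV := h.continuousOn_V
  have hW := h.continuousOn_W
  exact ContinuousOn.div (by fun_prop) (by fun_prop) fun t ht =>
    (mul_pos (h.sub_UV_pos ht) (h.sub_VW_pos ht)).ne'

theorem continuousOn_share_W (h : IsEllipticMotion a u₂ u₃ ℓ γ v U V W) :
    ContinuousOn (fun t => (u₂ - W t) * (u₃ - W t) / ((U t - W t) * (V t - W t))) (Icc 0 ℓ) := by
  have hU := h.continuousOn_U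
  have hV := h.continuousOn_V
  have hW := h.continuousOn_W
  exact ContinuousOn.div (by fun_prop) (by fun_prop) fun t ht =>
    (mul_pos (h.sub_UW_pos ht) (h.sub_VW_pos ht)).ne'

/-- The first elliptic coordinate is `a₁ + (a₀ - a₁) sin² φ`, where the angle `φ` is monotone and
makes as many turns as the curve. -/
theorem exists_first_phase (h : IsEllipticMotion a u₂ u₃ ℓ γ v U V W) (hcl : γ ℓ = γ 0)
    (hw : WindsOnce γ ℓ) : ∃ φ φ' : ℝ → ℝ, Continuous φ ∧ |φ ℓ - φ 0| = 2 * Real.pi ∧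
      (∀ t ∈ Icc 0 ℓ, U t = a 1 + (a 0 - a 1) * Real.sin (φ t) ^ 2) ∧
      ∀ t ∈ Ioo 0 ℓ, HasDerivAt φ (φ' t) t ∧ φ' t ^ 2 =
        (U t - u₂) * (U t - u₃) * (U t - a 2) / ((U t - V t) * (U t - W t)) ^ 2 := by
  obtain ⟨h1, h2, h3, h4⟩ := id h.order
  have hU := h.continuousOn_U
  have hV := h.continuousOn_V
  have hW := h.continuousOn_W
  have p10 := sub_pos.2 h1
  have p20 : 0 < a 0 - a 2 := by linarith
  have p21 : 0 < a 1 - a 2 := by linarith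
  have bU : ∀ t ∈ Icc 0 ℓ, 0 < U t - u₂ ∧ 0 < U t - u₃ ∧ 0 < U t - a 2 := fun t ht => by
    have := (h.mem_U t ht).1; exact ⟨by linarith, by linarith, by linarith⟩
  have bV : ∀ t ∈ Icc 0 ℓ, 0 < a 0 - V t ∧ 0 < a 1 - V t := fun t ht => by
    have := (h.mem_V t ht).2; exact ⟨by linarith, by linarith⟩
  have bW : ∀ t ∈ Icc 0 ℓ, 0 < a 0 - W t ∧ 0 < a 1 - W t := fun t ht => by
    have := h.le_W t ht; exact ⟨by linarith, by linarith⟩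
  set V' : ℝ → ℝ := fun t => ellipticVel a (γ t) (v t) (V t) (U t) (W t) with hV'
  set W' : ℝ → ℝ := fun t => ellipticVel a (γ t) (v t) (W t) (U t) (V t) with hW'
  have cV' : ContinuousOn V' (Icc 0 ℓ) := h.continuousOn_velV
  have cW' : ContinuousOn W' (Icc 0 ℓ) := h.continuousOn_velW
  set R : ℝ → ℝ := fun t =>
    (U t - u₂) * (U t - u₃) * (U t - a 2) / ((U t - V t) * (U t - W t)) ^ 2 with hR
  have cR : ContinuousOn R (Icc 0 ℓ) := ContinuousOn.div (by fun_prop) (by fun_prop) fun t ht =>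
    (pow_pos (mul_pos (h.sub_UV_pos ht) (h.sub_UW_pos ht)) 2).ne'
  have hRpos : ∀ t ∈ Icc 0 ℓ, 0 < R t := fun t ht => by
    obtain ⟨k1, k2, k3⟩ := bU t ht
    exact div_pos (mul_pos (mul_pos k1 k2) k3)
      (pow_pos (mul_pos (h.sub_UV_pos ht) (h.sub_UW_pos ht)) 2)
  have dk : ∀ j : Fin 3, ∀ t ∈ Ioo 0 ℓ, HasDerivAt (fun t => (a j - V t) * (a j - W t) / (a j - a 2))
      ((-V' t * (a j - W t) + (a j - V t) * -W' t) / (a j - a 2)) t := fun j t ht =>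
    (((h.hasDerivAt_V ht).const_sub (a j)).mul ((h.hasDerivAt_W ht).const_sub (a j))).div_const _
  obtain ⟨cc, cc2, c', cc', dc⟩ := exists_hasDerivAt_signed_sqrt (ℓ := ℓ)
    (x := fun t => γ t 0) (x' := fun t => v t 0)
    (k := fun t => (a 0 - V t) * (a 0 - W t) / (a 0 - a 2))
    (k' := fun t => (-V' t * (a 0 - W t) + (a 0 - V t) * -W' t) / (a 0 - a 2))
    (y := fun t => (a 0 - U t) / (a 0 - a 1))
    (y' := fun t => -ellipticVel a (γ t) (v t) (U t) (V t) (W t) / (a 0 - a 1))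
    (R := fun t => (U t - a 1) / (a 0 - a 1) * R t) (h.continuousOn_coord 0) (by fun_prop)
    (fun t ht => div_pos (mul_pos (bV t ht).1 (bW t ht).1) p20) (h.continuousOn_vel 0) (by fun_prop)
    (by fun_prop) (fun t ht => h.hasDerivAt_coord t ht 0) (dk 0)
    (fun t ht => ((h.hasDerivAt_U ht).const_sub (a 0)).div_const _)
    (fun t ht => by
      rw [h.coord_zero_sq ht]
      field_simp)
    (fun t ht => by
      have ht := Ioo_subset_Icc_self ht
      have n1 := (h.sub_UV_pos ht).ne'
      have n2 := (h.sub_UW_pos ht).ne'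
      simp only [hR]
      rw [div_pow, neg_sq, h.vel_U_sq ht]
      field_simp
      ring)
    (fun t ht => h.vel_coord_ne_zero (Ioo_subset_Icc_self ht) 0)
  obtain ⟨cs, cs2, s', cs', ds⟩ := exists_hasDerivAt_signed_sqrt (ℓ := ℓ)
    (x := fun t => γ t 1) (x' := fun t => v t 1)
    (k := fun t => (a 1 - V t) * (a 1 - W t) / (a 1 - a 2))
    (k' := fun t => (-V' t * (a 1 - W t) + (a 1 - V t) * -W' t) / (a 1 - a 2))
    (y := fun t => (U t - a 1) / (a 0 - a 1))
    (y' := fun t => ellipticVel a (γ t) (v t) (U t) (V t) (W t) / (a 0 - a 1))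
    (R := fun t => (a 0 - U t) / (a 0 - a 1) * R t) (h.continuousOn_coord 1) (by fun_prop)
    (fun t ht => div_pos (mul_pos (bV t ht).2 (bW t ht).2) p21) (h.continuousOn_vel 1) (by fun_prop)
    (by fun_prop) (fun t ht => h.hasDerivAt_coord t ht 1) (dk 1)
    (fun t ht => ((h.hasDerivAt_U ht).sub_const (a 1)).div_const _)
    (fun t ht => by
      rw [h.coord_one_sq ht]
      field_simp)
    (fun t ht => by
      have ht := Ioo_subset_Icc_self ht
      have n1 := (h.sub_UV_pos ht).ne'
      have n2 := (h.sub_UW_pos ht).ne'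
      simp only [hR]
      rw [div_pow, h.vel_U_sq ht]
      field_simp
      ring)
    (fun t ht => h.vel_coord_ne_zero (Ioo_subset_Icc_self ht) 1)
  obtain ⟨φ, φ', cφ, hφ, dφ⟩ := exists_angle h.length_pos cc cs
    (fun t ht => by rw [cc2 t ht, cs2 t ht]; field_simp; ring) cR hRpos cc' cs'
    (fun t ht => (dc t ht).1) (fun t ht => (ds t ht).1)
    (fun t ht => by rw [(dc t ht).2, (ds t ht).2]; field_simp; ring)
  refine ⟨φ, φ', cφ, ?_, fun t ht => ?_, dφ⟩
  · obtain ⟨ρ, θ, hθ, hpol, hturn⟩ := hw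
    have h0 : (0 : ℝ) ∈ Icc 0 ℓ := ⟨le_rfl, h.length_pos.le⟩
    have hℓ : ℓ ∈ Icc 0 ℓ := ⟨h.length_pos.le, le_rfl⟩
    obtain ⟨eV, eW⟩ := h.eq_of_closed hcl
    refine abs_sub_eq_two_pi_of_cos_pos h.length_pos cφ.continuousOn hθ (fun t ht => ?_) ?_ ?_ hturn
    · obtain ⟨hρ, ex, ey⟩ := hpol t ht
      rw [Real.cos_sub, (hφ t ht).1, (hφ t ht).2, ex, ey]
      have k0 : 0 < √((a 0 - V t) * (a 0 - W t) / (a 0 - a 2)) :=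
        Real.sqrt_pos.2 (div_pos (mul_pos (bV t ht).1 (bW t ht).1) p20)
      have k1 : 0 < √((a 1 - V t) * (a 1 - W t) / (a 1 - a 2)) :=
        Real.sqrt_pos.2 (div_pos (mul_pos (bV t ht).2 (bW t ht).2) p21)
      set κ0 := √((a 0 - V t) * (a 0 - W t) / (a 0 - a 2))
      set κ1 := √((a 1 - V t) * (a 1 - W t) / (a 1 - a 2))
      have : ρ t * Real.cos (θ t) / κ0 * Real.cos (θ t) + ρ t * Real.sin (θ t) / κ1 * Real.sin (θ t)
          = ρ t * (Real.cos (θ t) ^ 2 / κ0 + Real.sin (θ t) ^ 2 / κ1) := by ring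
      rw [this]
      refine mul_pos hρ ?_
      rcases eq_or_ne (Real.cos (θ t)) 0 with hz | hz
      · have hs : Real.sin (θ t) ^ 2 = 1 := by
          have := Real.cos_sq_add_sin_sq (θ t); rw [hz] at this; linarith
        rw [hs]; positivity
      · positivity
    · rw [(hφ ℓ hℓ).1, (hφ 0 h0).1, hcl, eV, eW]
    · rw [(hφ ℓ hℓ).2, (hφ 0 h0).2, hcl, eV, eW]
  · rw [(hφ t ht).2, cs2 t ht]
    field_simp
    ring

theorem integral_share_U (h : IsEllipticMotion a u₂ u₃ ℓ γ v U V W) (hcl : γ ℓ = γ 0)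
    (hw : WindsOnce γ ℓ) :
    ∫ t in (0 : ℝ)..ℓ, (U t - u₂) * (U t - u₃) / ((U t - V t) * (U t - W t))
      = 2 * ∫ u in (a 1)..(a 0), lengthIntegrand a u₂ u₃ u := by
  obtain ⟨h1, h2, h3, h4⟩ := id h.order
  obtain ⟨φ, φ', cφ, hturn, hUφ, dφ⟩ := h.exists_first_phase hcl hw
  have hpos : ∀ t ∈ Icc 0 ℓ, 0 < (U t - u₂) * (U t - u₃) ∧ 0 < U t - a 2 ∧
      0 < (U t - V t) * (U t - W t) := fun t ht => by
    have := (h.mem_U t ht).1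
    exact ⟨mul_pos (by linarith) (by linarith), by linarith,
      mul_pos (h.sub_UV_pos ht) (h.sub_UW_pos ht)⟩
  have hshare : ∀ t ∈ Ioo 0 ℓ, (U t - u₂) * (U t - u₃) / ((U t - V t) * (U t - W t)) =
      |φ' t| * firstDensity a u₂ u₃ (φ t) := fun t ht => by
    have ht' := Ioo_subset_Icc_self ht
    obtain ⟨k1, k2, k3⟩ := hpos t ht'
    rw [← sq_eq_sq₀ (div_nonneg k1.le k3.le) (mul_nonneg (abs_nonneg _) (firstDensity_nonneg _)),
      mul_pow, sq_abs, (dφ t ht).2, firstDensity_sq h.order, ← hUφ t ht']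
    field_simp
  have hne : ∀ t ∈ Ioo 0 ℓ, φ' t ≠ 0 := fun t ht h0 => by
    obtain ⟨k1, k2, k3⟩ := hpos t (Ioo_subset_Icc_self ht)
    have := (dφ t ht).2
    rw [h0] at this
    have k4 : 0 < (U t - u₂) * (U t - u₃) * (U t - a 2) / ((U t - V t) * (U t - W t)) ^ 2 := by
      positivity
    rw [← this] at k4
    norm_num at k4
  have hint : ∀ x y : ℝ, y - x = 2 * Real.pi → ∫ φ in x..y, firstDensity a u₂ u₃ φ
      = 2 * ∫ u in (a 1)..(a 0), lengthIntegrand a u₂ u₃ u := fun x y hxy => by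
    rw [show y = x + 2 * Real.pi by linarith, integral_firstDensity_turn h.order,
      (integral_lengthIntegrand_first h.order).2]
    ring
  have hpi := Real.pi_pos
  rcases abs_eq (by positivity) |>.1 hturn with hd | hd
  · rw [integral_eq_integral_of_phase h.length_pos.le cφ.continuousOn (fun t ht => (dφ t ht).1) hne
      (by linarith) (continuous_firstDensity h.order).continuousOn h.continuousOn_share_U hshare]
    exact hint _ _ hd
  · have heven : ∀ x, firstDensity a u₂ u₃ (-x) = firstDensity a u₂ u₃ x := fun x => by
      simp only [firstDensity, Real.sin_neg, neg_sq]
    rw [integral_eq_integral_of_phase (f := fun t => -φ t) (f' := fun t => -φ' t)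
      (h := firstDensity a u₂ u₃) h.length_pos.le cφ.neg.continuousOn
      (fun t ht => (dφ t ht).1.neg) (fun t ht => neg_ne_zero.2 (hne t ht))
      (by linarith) (continuous_firstDensity h.order).continuousOn h.continuousOn_share_U
      (fun t ht => by rw [hshare t ht, abs_neg, heven])]
    exact hint _ _ (by linarith)

/-- The third elliptic coordinate rises to `u₃` before the contact with the ellipsoid, and falls
afterwards. -/
theorem integral_share_W (h : IsEllipticMotion a u₂ u₃ ℓ γ v U V W) (hcl : γ ℓ = γ 0)
    {ε A B C D s t : ℝ} (hT : ContactTimes a u₂ u₃ ℓ γ ε A B C D s t) :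
    ∫ t in (0 : ℝ)..ℓ, (u₂ - W t) * (u₃ - W t) / ((U t - W t) * (V t - W t))
      = ∫ u in (W 0)..u₃, lengthIntegrand a u₂ u₃ u := by
  obtain ⟨h1, h2, h3, h4⟩ := id h.order
  have hs := hT.zero_lt_s
  have hst := hT.s_le_t
  have ht := hT.t_lt
  have hE : ∀ r ∈ Icc 0 ℓ, W r = u₃ ↔ r ∈ Icc s t := fun r hr => by
    rw [← h.mem_quadric_right hr, hT.contact_right r hr]
  have h0 : (0 : ℝ) ∈ Icc 0 ℓ := ⟨le_rfl, h.length_pos.le⟩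
  have hℓ : ℓ ∈ Icc 0 ℓ := ⟨h.length_pos.le, le_rfl⟩
  have hsI : s ∈ Icc 0 ℓ := ⟨hs.le, hst.trans ht.le⟩
  have htI : t ∈ Icc 0 ℓ := ⟨hs.le.trans hst, ht.le⟩
  have eWs : W s = u₃ := (hE s hsI).2 ⟨le_rfl, hst⟩
  have eWt : W t = u₃ := (hE t htI).2 ⟨hst, le_rfl⟩
  have cont := h.continuousOn_share_W
  have hshare : ∀ r ∈ Icc 0 ℓ, (u₂ - W r) * (u₃ - W r) / ((U r - W r) * (V r - W r)) =
      |ellipticVel a (γ r) (v r) (W r) (U r) (V r)| * (lengthIntegrand a u₂ u₃ (W r) / 2) :=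
    fun r hr => by
    have hW := h.le_W r hr
    have nU := h.sub_UW_pos hr
    have nV := h.sub_VW_pos hr
    have p2 : 0 ≤ u₂ - W r := by linarith
    have p3 : 0 ≤ u₃ - W r := by linarith
    have q0 : 0 < a 0 - W r := by linarith
    have q1 : 0 < a 1 - W r := by linarith
    have q2 : 0 < a 2 - W r := by linarith
    have hL0 : 0 ≤ lengthIntegrand a u₂ u₃ (W r) := by
      rw [lengthIntegrand_eq_sqrt h.order hW]; exact Real.sqrt_nonneg _
    rw [← sq_eq_sq₀ (by positivity) (by positivity), mul_pow, sq_abs, h.vel_W_sq hr,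
      div_pow _ (2 : ℝ), lengthIntegrand_eq_sqrt h.order hW, Real.sq_sqrt (by positivity)]
    have n1 : W r - U r ≠ 0 := by intro h; linarith
    have n2 : W r - V r ≠ 0 := by intro h; linarith
    rw [show (W r - U r) * (W r - V r) = (U r - W r) * (V r - W r) by ring]
    field_simp
    ring
  have hne : ∀ r ∈ Ioo 0 ℓ, r ∉ Icc s t → ellipticVel a (γ r) (v r) (W r) (U r) (V r) ≠ 0 :=
    fun r hr hrE hz => by
    have hr' := Ioo_subset_Icc_self hr
    have e := hshare r hr'
    have hW := h.le_W r hr'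
    have hlt : W r < u₃ := lt_of_le_of_ne hW fun e => hrE ((hE r hr').1 e)
    rw [hz, abs_zero, zero_mul] at e
    exact (div_pos (mul_pos (by linarith) (by linarith))
      (mul_pos (h.sub_UW_pos hr') (h.sub_VW_pos hr'))).ne' e
  have hL : ContinuousOn (fun u => lengthIntegrand a u₂ u₃ u / 2) (Iic u₃) :=
    (continuousOn_lengthIntegrand h.order).div_const 2
  have i1 : ∫ r in (0 : ℝ)..s, (u₂ - W r) * (u₃ - W r) / ((U r - W r) * (V r - W r))
      = ∫ u in (W 0)..u₃, lengthIntegrand a u₂ u₃ u / 2 := by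
    have hI : ∀ r ∈ Ioo 0 s, r ∈ Ioo 0 ℓ := fun r hr => ⟨hr.1, hr.2.trans_le hsI.2⟩
    rw [integral_eq_integral_of_phase hs.le (h.continuousOn_W.mono (Icc_subset_Icc_right hsI.2))
      (fun r hr => h.hasDerivAt_W (hI r hr))
      (fun r hr => hne r (hI r hr) fun hrE => hr.2.not_ge hrE.1) (by rw [eWs]; exact h.le_W 0 h0)
      (hL.mono (by rw [eWs]; exact Icc_subset_Iic_self)) (cont.mono (Icc_subset_Icc_right hsI.2))
      (fun r hr => hshare r (Ioo_subset_Icc_self (hI r hr))), eWs]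
  have i2 : ∫ r in s..t, (u₂ - W r) * (u₃ - W r) / ((U r - W r) * (V r - W r)) = 0 := by
    rw [intervalIntegral.integral_congr (g := fun _ => 0), intervalIntegral.integral_zero]
    intro r hr
    rw [uIcc_of_le hst] at hr
    have e := (hE r ⟨hs.le.trans hr.1, hr.2.trans ht.le⟩).2 hr
    simp only [e, sub_self, mul_zero, zero_div]
  have i3 : ∫ r in t..ℓ, (u₂ - W r) * (u₃ - W r) / ((U r - W r) * (V r - W r))
      = ∫ u in (W 0)..u₃, lengthIntegrand a u₂ u₃ u / 2 := by
    have hI : ∀ r ∈ Ioo t ℓ, r ∈ Ioo 0 ℓ := fun r hr => ⟨htI.1.trans_lt hr.1, hr.2⟩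
    rw [integral_eq_integral_of_phase (f := fun r => -W r)
      (f' := fun r => -ellipticVel a (γ r) (v r) (W r) (U r) (V r))
      (h := fun x => lengthIntegrand a u₂ u₃ (-x) / 2) ht.le
      (h.continuousOn_W.neg.mono (Icc_subset_Icc_left htI.1))
      (fun r hr => (h.hasDerivAt_W (hI r hr)).neg)
      (fun r hr => neg_ne_zero.2 (hne r (hI r hr) fun hrE => hr.1.not_ge hrE.2))
      (by rw [eWt]; exact neg_le_neg (h.le_W ℓ hℓ))
      (hL.comp continuousOn_neg fun x hx => by
        rw [eWt] at hx; change -x ≤ u₃; linarith [hx.1])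
      (cont.mono (Icc_subset_Icc_left htI.1))
      (fun r hr => by
        rw [hshare r (Ioo_subset_Icc_self (hI r hr)), abs_neg, neg_neg]),
      intervalIntegral.integral_comp_neg (fun x => lengthIntegrand a u₂ u₃ x / 2), neg_neg, neg_neg,
      eWt, (h.eq_of_closed hcl).2]
  have hii : ∀ x ∈ Icc 0 ℓ, ∀ y ∈ Icc 0 ℓ, IntervalIntegrable
      (fun r => (u₂ - W r) * (u₃ - W r) / ((U r - W r) * (V r - W r))) MeasureTheory.volume x y :=
    fun x hx y hy => (cont.mono (uIcc_subset_Icc hx hy)).intervalIntegrable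
  rw [← intervalIntegral.integral_add_adjacent_intervals (hii 0 h0 s hsI) (hii s hsI ℓ hℓ),
    ← intervalIntegral.integral_add_adjacent_intervals (hii s hsI t htI) (hii t htI ℓ hℓ),
    i1, i2, i3, intervalIntegral.integral_div]
  ring

/-- The second elliptic coordinate is `a₂ + (u₂ - a₂) σ²`, where the phase `σ` oscillates between the
contacts with the two parts of the hyperboloid, at `σ = 1` and `σ = -1`. -/
theorem exists_second_phase (h : IsEllipticMotion a u₂ u₃ ℓ γ v U V W) (hcl : γ ℓ = γ 0)
    {ε : ℝ} (hε : ε = 1 ∨ ε = -1) : ∃ σ σ' κ : ℝ → ℝ, ContinuousOn σ (Icc 0 ℓ) ∧ σ ℓ = σ 0 ∧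
      (∀ t ∈ Icc 0 ℓ, 0 < κ t ∧ σ t = ε * γ t 2 / κ t) ∧
      (∀ t ∈ Icc 0 ℓ, σ t ∈ Icc (-1) 1 ∧ V t = a 2 + (u₂ - a 2) * σ t ^ 2) ∧
      ∀ t ∈ Ioo 0 ℓ, HasDerivAt σ (σ' t) t ∧ σ' t ^ 2 =
        (u₂ - V t) * (V t - u₃) * (a 0 - V t) * (a 1 - V t)
          / ((u₂ - a 2) * ((U t - V t) * (V t - W t)) ^ 2) := by
  obtain ⟨h1, h2, h3, h4⟩ := id h.order
  have hU := h.continuousOn_U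
  have hV := h.continuousOn_V
  have hW := h.continuousOn_W
  have p2 := sub_pos.2 h3
  have p20 : 0 < a 0 - a 2 := by linarith
  have p21 : 0 < a 1 - a 2 := by linarith
  have hε2 : ε ^ 2 = 1 := by rcases hε with rfl | rfl <;> norm_num
  have hε0 : ε ≠ 0 := by rintro rfl; norm_num at hε2
  set U' : ℝ → ℝ := fun t => ellipticVel a (γ t) (v t) (U t) (V t) (W t) with hU'
  set W' : ℝ → ℝ := fun t => ellipticVel a (γ t) (v t) (W t) (U t) (V t) with hW'
  have cU' : ContinuousOn U' (Icc 0 ℓ) := h.continuousOn_velU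
  have cW' : ContinuousOn W' (Icc 0 ℓ) := h.continuousOn_velW
  have kpos : ∀ t ∈ Icc 0 ℓ,
      0 < (U t - a 2) * (a 2 - W t) * ((u₂ - a 2) / ((a 0 - a 2) * (a 1 - a 2))) := fun t ht => by
    have := (h.mem_U t ht).1
    have := h.le_W t ht
    exact mul_pos (mul_pos (by linarith) (by linarith)) (div_pos p2 (mul_pos p20 p21))
  obtain ⟨cσ, cσ2, σ', -, dσ⟩ := exists_hasDerivAt_signed_sqrt (ℓ := ℓ)
    (x := fun t => ε * γ t 2) (x' := fun t => ε * v t 2)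
    (k := fun t => (U t - a 2) * (a 2 - W t) * ((u₂ - a 2) / ((a 0 - a 2) * (a 1 - a 2))))
    (k' := fun t => (U' t * (a 2 - W t) + (U t - a 2) * -W' t) *
      ((u₂ - a 2) / ((a 0 - a 2) * (a 1 - a 2))))
    (y := fun t => (V t - a 2) / (u₂ - a 2))
    (y' := fun t => ellipticVel a (γ t) (v t) (V t) (U t) (W t) / (u₂ - a 2))
    (R := fun t => (u₂ - V t) * (V t - u₃) * (a 0 - V t) * (a 1 - V t)
          / ((u₂ - a 2) * ((U t - V t) * (V t - W t)) ^ 2))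
    (continuousOn_const.mul (h.continuousOn_coord 2)) (by fun_prop) kpos
    (continuousOn_const.mul (h.continuousOn_vel 2)) (by fun_prop)
    (ContinuousOn.div (by fun_prop) (by fun_prop) fun t ht =>
      (mul_pos p2 (pow_pos (mul_pos (h.sub_UV_pos ht) (h.sub_VW_pos ht)) 2)).ne')
    (fun t ht => (h.hasDerivAt_coord t ht 2).const_mul ε)
    (fun t ht => (((h.hasDerivAt_U ht).sub_const (a 2)).mul
      ((h.hasDerivAt_W ht).const_sub (a 2))).mul_const _)
    (fun t ht => ((h.hasDerivAt_V ht).sub_const (a 2)).div_const _)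
    (fun t ht => by
      rw [mul_pow, hε2, h.coord_two_sq ht]
      field_simp)
    (fun t ht => by
      have ht := Ioo_subset_Icc_self ht
      have n1 := (h.sub_UV_pos ht).ne'
      have n2 := (h.sub_VW_pos ht).ne'
      rw [div_pow, h.vel_V_sq ht,
        show ((V t - U t) * (V t - W t)) ^ 2 = ((U t - V t) * (V t - W t)) ^ 2 by ring]
      field_simp
      ring)
    (fun t ht h0 => mul_ne_zero hε0
      (h.vel_coord_ne_zero (Ioo_subset_Icc_self ht) 2 ((mul_eq_zero.1 h0).resolve_left hε0)))
  refine ⟨_, σ', _, cσ, ?_, fun t ht => ⟨Real.sqrt_pos.2 (kpos t ht), rfl⟩, fun t ht => ⟨?_, ?_⟩, dσ⟩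
  · -- The first coordinate takes the same value at both ends, too.
    have h0 : (0 : ℝ) ∈ Icc 0 ℓ := ⟨le_rfl, h.length_pos.le⟩
    have hℓ : ℓ ∈ Icc 0 ℓ := ⟨h.length_pos.le, le_rfl⟩
    have eU : U ℓ = U 0 := by
      have d1 := h.V_lt_U hℓ h0
      have d2 := h.W_lt_U hℓ h0
      have e := h.factor ℓ hℓ (U ℓ)
      rw [hcl, h.factor 0 h0, sub_self, zero_mul, zero_mul] at e
      have := (mul_eq_zero.1 e).resolve_right (by intro h; linarith)
      have := (mul_eq_zero.1 this).resolve_right (by intro h; linarith)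
      linarith
    simp only [hcl, eU, (h.eq_of_closed hcl).2]
  · have := cσ2 t ht
    have hV := h.mem_V t ht
    rw [mem_Icc, ← abs_le, ← sq_le_one_iff_abs_le_one, this, div_le_one p2]
    linarith [hV.2]
  · rw [cσ2 t ht]
    field_simp
    ring

theorem integral_share_V (h : IsEllipticMotion a u₂ u₃ ℓ γ v U V W) (hcl : γ ℓ = γ 0)
    {ε A B C D s t : ℝ} (hT : ContactTimes a u₂ u₃ ℓ γ ε A B C D s t) :
    ∫ t in (0 : ℝ)..ℓ, (u₂ - V t) * (V t - u₃) / ((U t - V t) * (V t - W t))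
      = -(2 * ∫ u in (a 2)..u₂, lengthIntegrand a u₂ u₃ u) := by
  obtain ⟨h1, h2, h3, h4⟩ := id h.order
  have p2 := sub_pos.2 h3
  obtain ⟨σ, σ', κ, cσ, hσcl, hκ, hσ, dσ⟩ := h.exists_second_phase hcl hT.sign
  have hA := hT.zero_lt_A
  have hAB := hT.A_le_B
  have hBC := hT.B_lt_C
  have hCD := hT.C_le_D
  have hD := hT.D_lt
  have h0 : (0 : ℝ) ∈ Icc 0 ℓ := ⟨le_rfl, h.length_pos.le⟩
  have hℓ : ℓ ∈ Icc 0 ℓ := ⟨h.length_pos.le, le_rfl⟩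
  have hAI : A ∈ Icc 0 ℓ := ⟨hA.le, by linarith⟩
  have hBI : B ∈ Icc 0 ℓ := ⟨by linarith, by linarith⟩
  have hCI : C ∈ Icc 0 ℓ := ⟨by linarith, by linarith⟩
  have hDI : D ∈ Icc 0 ℓ := ⟨by linarith, hD.le⟩
  have hH : ∀ r ∈ Icc 0 ℓ, V r = u₂ ↔ r ∈ Icc A B ∪ Icc C D := fun r hr => by
    rw [← h.mem_quadric_left hr, hT.contact_left r hr]
  have hVσ : ∀ r ∈ Icc 0 ℓ, V r = u₂ → σ r ^ 2 = 1 := fun r hr e => by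
    have e2 := (hσ r hr).2
    rw [e] at e2
    exact mul_left_cancel₀ p2.ne' (by linarith)
  have hσ1 : ∀ r ∈ Icc A B, σ r = 1 := fun r hr => by
    have hrI : r ∈ Icc 0 ℓ := ⟨hAI.1.trans hr.1, hr.2.trans hBI.2⟩
    have hp : 0 < σ r := by
      rw [(hκ r hrI).2]; exact div_pos (hT.pos_AB r hr) (hκ r hrI).1
    nlinarith [hVσ r hrI ((hH r hrI).2 (.inl hr))]
  have hσ2 : ∀ r ∈ Icc C D, σ r = -1 := fun r hr => by
    have hrI : r ∈ Icc 0 ℓ := ⟨hCI.1.trans hr.1, hr.2.trans hDI.2⟩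
    have hp : σ r < 0 := by
      rw [(hκ r hrI).2]; exact div_neg_of_neg_of_pos (hT.neg_CD r hr) (hκ r hrI).1
    nlinarith [hVσ r hrI ((hH r hrI).2 (.inr hr))]
  have eA := hσ1 A ⟨le_rfl, hAB⟩
  have eB := hσ1 B ⟨hAB, le_rfl⟩
  have eC := hσ2 C ⟨le_rfl, hCD⟩
  have eD := hσ2 D ⟨hCD, le_rfl⟩
  have cont := h.continuousOn_share_V
  have hpos : ∀ r ∈ Icc 0 ℓ, 0 ≤ u₂ - V r ∧ 0 < V r - u₃ ∧ 0 < a 0 - V r ∧ 0 < a 1 - V r ∧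
      0 < (U r - V r) * (V r - W r) := fun r hr => by
    have hV := h.mem_V r hr
    exact ⟨by linarith [hV.2], by linarith [hV.1], by linarith [hV.2], by linarith [hV.2],
      mul_pos (h.sub_UV_pos hr) (h.sub_VW_pos hr)⟩
  have hshare : ∀ r ∈ Ioo 0 ℓ, (u₂ - V r) * (V r - u₃) / ((U r - V r) * (V r - W r)) =
      |σ' r| * secondDensity a u₂ u₃ (σ r) := fun r hr => by
    have hr' := Ioo_subset_Icc_self hr
    obtain ⟨k1, k2, k3, k4, k5⟩ := hpos r hr'
    rw [← sq_eq_sq₀ (by positivity) (mul_nonneg (abs_nonneg _) (secondDensity_nonneg _)),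
      mul_pow, sq_abs, (dσ r hr).2, secondDensity_sq h.order (hσ r hr').1, ← (hσ r hr').2]
    have e : (u₂ - a 2) ^ 2 * (1 - σ r ^ 2) = (u₂ - a 2) * (u₂ - V r) := by
      rw [(hσ r hr').2]; ring
    rw [e]
    field_simp
  have hne : ∀ r ∈ Ioo 0 ℓ, r ∉ Icc A B ∪ Icc C D → σ' r ≠ 0 := fun r hr hrH hz => by
    have hr' := Ioo_subset_Icc_self hr
    obtain ⟨k1, k2, k3, k4, k5⟩ := hpos r hr'
    have hlt : 0 < u₂ - V r := lt_of_le_of_ne k1 fun e => hrH ((hH r hr').1 (by linarith))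
    have e := hshare r hr
    rw [hz, abs_zero, zero_mul] at e
    exact (div_pos (mul_pos hlt k2) k5).ne' e
  have hdens := continuousOn_secondDensity h.order
  have heven : ∀ x, secondDensity a u₂ u₃ (-x) = secondDensity a u₂ u₃ x := fun x => by
    simp only [secondDensity, neg_sq]
  have hii : ∀ x ∈ Icc 0 ℓ, ∀ y ∈ Icc 0 ℓ, IntervalIntegrable
      (fun r => (u₂ - V r) * (V r - u₃) / ((U r - V r) * (V r - W r))) MeasureTheory.volume x y :=
    fun x hx y hy => (cont.mono (uIcc_subset_Icc hx hy)).intervalIntegrable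
  have hsi : ∀ x ∈ Icc (-1 : ℝ) 1, ∀ y ∈ Icc (-1 : ℝ) 1, IntervalIntegrable
      (secondDensity a u₂ u₃) MeasureTheory.volume x y :=
    fun x hx y hy => (hdens.mono (uIcc_subset_Icc hx hy)).intervalIntegrable
  -- rising arcs, arcs of contact, and the falling arc of the phase
  have hup : ∀ x ∈ Icc 0 ℓ, ∀ y ∈ Icc 0 ℓ, x ≤ y → σ x ≤ σ y →
      (∀ r ∈ Ioo x y, r ∉ Icc A B ∪ Icc C D) →
      ∫ r in x..y, (u₂ - V r) * (V r - u₃) / ((U r - V r) * (V r - W r))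
        = ∫ x in (σ x)..(σ y), secondDensity a u₂ u₃ x := fun x hx y hy hxy hle hoff =>
    integral_eq_integral_of_phase hxy (cσ.mono (Icc_subset_Icc hx.1 hy.2))
      (fun r hr => (dσ r ⟨hx.1.trans_lt hr.1, hr.2.trans_le hy.2⟩).1)
      (fun r hr => hne r ⟨hx.1.trans_lt hr.1, hr.2.trans_le hy.2⟩ (hoff r hr)) hle
      (hdens.mono (Icc_subset_Icc (hσ x hx).1.1 (hσ y hy).1.2))
      (cont.mono (Icc_subset_Icc hx.1 hy.2))
      (fun r hr => hshare r ⟨hx.1.trans_lt hr.1, hr.2.trans_le hy.2⟩)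
  have hzero : ∀ x ∈ Icc 0 ℓ, ∀ y ∈ Icc 0 ℓ, x ≤ y → (∀ r ∈ Icc x y, r ∈ Icc A B ∪ Icc C D) →
      ∫ r in x..y, (u₂ - V r) * (V r - u₃) / ((U r - V r) * (V r - W r)) = 0 :=
    fun x hx y hy hxy hon => by
    rw [intervalIntegral.integral_congr (g := fun _ => 0), intervalIntegral.integral_zero]
    intro r hr
    rw [uIcc_of_le hxy] at hr
    have e := (hH r ⟨hx.1.trans hr.1, hr.2.trans hy.2⟩).2 (hon r hr)
    simp only [e, sub_self, zero_mul, zero_div]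
  have i1 := hup 0 h0 A hAI hA.le (by rw [eA]; exact (hσ 0 h0).1.2) (by
    rintro r hr (hI | hI)
    · exact hr.2.not_ge hI.1
    · linarith [hr.2, hI.1])
  have i2 := hzero A hAI B hBI hAB fun r hr => .inl hr
  have i3 : ∫ r in B..C, (u₂ - V r) * (V r - u₃) / ((U r - V r) * (V r - W r))
      = ∫ x in (-1 : ℝ)..1, secondDensity a u₂ u₃ x := by
    have hI : ∀ r ∈ Ioo B C, r ∈ Ioo 0 ℓ := fun r hr => ⟨hBI.1.trans_lt hr.1, hr.2.trans_le hCI.2⟩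
    rw [integral_eq_integral_of_phase (f := fun r => -σ r) (f' := fun r => -σ' r)
      (h := secondDensity a u₂ u₃) hBC.le (cσ.neg.mono (Icc_subset_Icc hBI.1 hCI.2))
      (fun r hr => (dσ r (hI r hr)).1.neg)
      (fun r hr => neg_ne_zero.2 (hne r (hI r hr) (by
        rintro (h | h)
        · exact hr.1.not_ge h.2
        · exact hr.2.not_ge h.1)))
      (by rw [eB, eC]; norm_num) (hdens.mono (by rw [eB, eC, neg_neg]))
      (cont.mono (Icc_subset_Icc hBI.1 hCI.2))
      (fun r hr => by rw [hshare r (hI r hr), abs_neg, heven]), eB, eC, neg_neg]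
  have i4 := hzero C hCI D hDI hCD fun r hr => .inr hr
  have i5 := hup D hDI ℓ hℓ hD.le (by rw [eD]; exact (hσ ℓ hℓ).1.1) (by
    rintro r hr (hI | hI)
    · linarith [hr.1, hI.2]
    · exact hr.1.not_ge hI.2)
  rw [eA] at i1
  rw [eD, hσcl] at i5
  have m1 : (-1 : ℝ) ∈ Icc (-1 : ℝ) 1 := by norm_num
  have m0 : (0 : ℝ) ∈ Icc (-1 : ℝ) 1 := by norm_num
  have m2 : (1 : ℝ) ∈ Icc (-1 : ℝ) 1 := by norm_num
  have j1 := intervalIntegral.integral_add_adjacent_intervals (hsi _ m1 _ (hσ 0 h0).1)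
    (hsi _ (hσ 0 h0).1 _ m2)
  have j2 := intervalIntegral.integral_add_adjacent_intervals (hsi _ m1 _ m0) (hsi _ m0 _ m2)
  have j3 := intervalIntegral.integral_comp_neg (secondDensity a u₂ u₃) (a := (0 : ℝ)) (b := 1)
  simp only [heven, neg_zero] at j3
  rw [← intervalIntegral.integral_add_adjacent_intervals (hii 0 h0 A hAI) (hii A hAI ℓ hℓ),
    ← intervalIntegral.integral_add_adjacent_intervals (hii A hAI B hBI) (hii B hBI ℓ hℓ),
    ← intervalIntegral.integral_add_adjacent_intervals (hii B hBI C hCI) (hii C hCI ℓ hℓ),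
    ← intervalIntegral.integral_add_adjacent_intervals (hii C hCI D hDI) (hii D hDI ℓ hℓ),
    i1, i2, i3, i4, i5, (integral_lengthIntegrand_second h.order).2]
  linarith

theorem length_eq (h : IsEllipticMotion a u₂ u₃ ℓ γ v U V W) (hcl : γ ℓ = γ 0)
    (hw : WindsOnce γ ℓ) {ε A B C D s t : ℝ} (hT : ContactTimes a u₂ u₃ ℓ γ ε A B C D s t) :
    ℓ = threadLength a u₂ u₃ (W 0) := by
  have e : ∫ _ in (0 : ℝ)..ℓ, (1 : ℝ) = ℓ := by simp
  have hI : uIcc 0 ℓ = Icc 0 ℓ := uIcc_of_le h.length_pos.le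
  rw [← intervalIntegral.integral_congr fun t ht => h.sum_shares (hI ▸ ht),
    intervalIntegral.integral_add, intervalIntegral.integral_add, h.integral_share_U hcl hw,
    h.integral_share_V hcl hT, h.integral_share_W hcl hT] at e
  · rw [threadLength]; linarith
  · exact (hI ▸ h.continuousOn_share_U).intervalIntegrable
  · exact (hI ▸ h.continuousOn_share_V).intervalIntegrable
  · exact (hI ▸ h.continuousOn_share_U.add h.continuousOn_share_V).intervalIntegrable
  · exact (hI ▸ h.continuousOn_share_W).intervalIntegrable

end IsEllipticMotion
end

theorem theorem4p3 (a : Fin 3 → ℝ) (u₂ u₃ : ℝ)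
    (h₁ : a 1 < a 0) (h₂ : u₂ < a 1) (h₃ : a 2 < u₂) (h₄ : u₃ < a 2) :
    -- the integrals in the length formula exist
    (IntervalIntegrable (lengthIntegrand a u₂ u₃) MeasureTheory.volume (a 1) (a 0) ∧
      IntervalIntegrable (lengthIntegrand a u₂ u₃) MeasureTheory.volume (a 2) u₂ ∧
      ∀ w < u₃, IntervalIntegrable (lengthIntegrand a u₂ u₃) MeasureTheory.volume w u₃) ∧
    (∀ (ℓ : ℝ) (P : E3) (γ : ℝ → E3), IsStretchedThread a u₂ u₃ ℓ P γ →
      -- all tangents of the thread are tangent to both quadrics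
      (∀ t ∈ Icc 0 ℓ,
        IsTangentLine a u₂ (γ t) (derivWithin γ (Icc 0 ℓ) t) ∧
        IsTangentLine a u₃ (γ t) (derivWithin γ (Icc 0 ℓ) t)) ∧
      -- the thread touches the ellipsoid once
      (∃ s t, 0 < s ∧ s ≤ t ∧ t < ℓ ∧
        {r | r ∈ Icc 0 ℓ ∧ γ r ∈ confocalQuadric a u₃} = Icc s t) ∧
      -- the arcs of which the thread consists, in order (those between the first and the last
      -- may be absent)
      (∃ mid : List ArcKind,
        mid.Sublist [.hyperboloidGeodesic, .rectilinear, .ellipsoidGeodesic, .lineOfCurvature,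
          .ellipsoidGeodesic, .lineOfCurvature, .ellipsoidGeodesic, .rectilinear,
          .hyperboloidGeodesic] ∧
        ConsistsOf a u₂ u₃ γ (.rectilinear :: (mid ++ [.rectilinear])) 0 ℓ) ∧
      -- if no arc of the thread runs on the hyperboloid off the ellipsoid
      ((∀ s t, 0 ≤ s → s < t → t ≤ ℓ →
          ∃ r ∈ Icc s t, ¬ (γ r ∈ confocalQuadric a u₂ ∧ γ r ∉ confocalQuadric a u₃)) →
        ∃ mid : List ArcKind,
          mid.Sublist [.ellipsoidGeodesic, .lineOfCurvature, .ellipsoidGeodesic,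
            .lineOfCurvature, .ellipsoidGeodesic] ∧
          ConsistsOf a u₂ u₃ γ (.rectilinear :: (mid ++ [.rectilinear])) 0 ℓ) ∧
      -- the length depends only on the confocal ellipsoid on which the pen is situated
      ∃ w < u₃, P ∈ confocalQuadric a w ∧ ℓ = threadLength a u₂ u₃ w) ∧
    -- the pen moves on a confocal ellipsoid as long as the length of the thread is kept
    (∀ ℓ : ℝ, ∃ w < u₃, ∀ (P : E3) (γ : ℝ → E3), IsStretchedThread a u₂ u₃ ℓ P γ →
      P ∈ confocalQuadric a w) := by
  have ha : ConfocalOrder a u₂ u₃ := ⟨h₁, h₂, h₃, h₄⟩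
  have key : ∀ (ℓ : ℝ) (P : E3) (γ : ℝ → E3), IsStretchedThread a u₂ u₃ ℓ P γ →
      ∃ w < u₃, P ∈ confocalQuadric a w ∧ ℓ = threadLength a u₂ u₃ w := by
    intro ℓ P γ hγ
    obtain ⟨v, p, q, h⟩ := hγ.exists_isEquilibrium
    obtain ⟨U, V, W, hm, ε, A, B, C, D, s, t, hT⟩ :=
      h.exists_contactTimes ha hγ.touches_upper hγ.touches_lower
    have h0 : (0 : ℝ) ∈ Icc 0 ℓ := ⟨le_rfl, h.length_pos.le⟩
    refine ⟨W 0, lt_of_le_of_ne (hm.le_W 0 h0) fun e => ?_, hγ.start ▸ hm.mem_quadric_W h0,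
      hm.length_eq (hγ.finish.trans hγ.start.symm) hγ.around hT⟩
    exact ((hT.contact_right 0 h0).1 ((hm.mem_quadric_right h0).2 e)).1.not_gt hT.zero_lt_s
  refine ⟨⟨(integral_lengthIntegrand_first ha).1, (integral_lengthIntegrand_second ha).1,
    fun w hw => intervalIntegrable_lengthIntegrand ha hw.le le_rfl⟩, ?_, ?_⟩
  · intro ℓ P γ hγ
    obtain ⟨v, p, q, h⟩ := hγ.exists_isEquilibrium
    obtain ⟨U, V, W, hm, ε, A, B, C, D, s, t, hT⟩ :=
      h.exists_contactTimes ha hγ.touches_upper hγ.touches_lower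
    refine ⟨fun r hr => ?_, ⟨s, t, hT.zero_lt_s, hT.s_le_t, hT.t_lt, ?_⟩, hT.exists_arcs h ha,
      hT.exists_arcs_of_no_hyperboloid_arc h ha, key ℓ P γ hγ⟩
    · rw [(h.hasDeriv r hr).derivWithin (uniqueDiffOn_Icc h.length_pos r hr),
        isTangentLine_iff ha.sub_u₂_ne_zero, isTangentLine_iff ha.sub_u₃_ne_zero,
        hm.tangency r hr, hm.tangency r hr]
      constructor <;> ring
    · ext r
      refine ⟨fun hr => (hT.contact_right r hr.1).1 hr.2, fun hr => ?_⟩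
      have hI : r ∈ Icc 0 ℓ := ⟨hT.zero_lt_s.le.trans hr.1, hr.2.trans hT.t_lt.le⟩
      exact ⟨hI, (hT.contact_right r hI).2 hr⟩
  · intro ℓ
    by_cases hex : ∃ (P : E3) (γ : ℝ → E3), IsStretchedThread a u₂ u₃ ℓ P γ
    · obtain ⟨P, γ, hγ⟩ := hex
      obtain ⟨w, hw, -, e⟩ := key ℓ P γ hγ
      refine ⟨w, hw, fun P' γ' hγ' => ?_⟩
      obtain ⟨w', hw', hP', e'⟩ := key ℓ P' γ' hγ'
      rwa [threadLength_injOn ha hw hw' (e.symm.trans e')]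
    · exact ⟨u₃ - 1, by linarith, fun P γ hγ => absurd ⟨P, γ, hγ⟩ hex⟩
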